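/- **Setting.** Let $K$ be a connected compact metrizable space, $N\ge 2$, $S=\{1,\dots,N\}$, $\Sigma=S^{\mathbb N}$ with the product $\sigma$-field, and let $\psi_i\colon K\to K$ $(i\in S)$ be continuous injections for which there is a continuous surjection $\pi\colon\Sigma\to K$ with $\psi_i\circ\pi=\pi\circ\sigma_i$, where $\sigma_i(\omega_1\omega_2\cdots)=i\omega_1\omega_2\cdots$. For $w=w_1\cdots w_m\in W_m=S^m$ put $\psi_w=\psi_{w_1}\circ\cdots\circ\psi_{w_m}$ and $\Sigma_w=\{\omega\in\Sigma:\omega_1\cdots\omega_m=w\}$. With the shift $\sigma(\omega_1\omega_2\cdots)=\omega_2\omega_3\cdots$, let $\mathcal P=\bigcup_{m\ge1}\sigma^m\bigl(\pi^{-1}\bigl(\bigcup_{i\ne j}\psi_i(K)\cap\psi_j(K)\bigr)\bigr)$ and $V_0=\pi(\mathcal P)$. Assume that $\mathcal P$ is finite, and that every $p\in V_0$ is a fixed point of some $\psi_i$ and $K\setminus\{p\}$ is connected. Let $D$ be a symmetric real matrix indexed by $V_0$ that is nonpositive definite, satisfies $Du=0$ if and only if $u$ is constant, and has $D_{pq}\ge0$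 for $p\ne q$; let $0<r_i<1$ for $i\in S$ and $r_w=r_{w_1}\cdots r_{w_m}$. Put $V_m=\bigcup_{w\in W_m}\psi_w(V_0)$, $\mathcal E^{(0)}(u,v)=(-Du,v)$ and $$\mathcal E^{(m)}(u,v)=\sum_{w\in W_m}\frac1{r_w}\,\mathcal E^{(0)}(u\circ\psi_w|_{V_0},v\circ\psi_w|_{V_0})$$ for functions $u,v$ on $V_m$. Assume that $(D,r)$ is a harmonic structure, i.e. $\mathcal E^{(0)}(u,u)=\min\{\mathcal E^{(1)}(v,v): v\colon V_1\to\mathbb R,\ v|_{V_0}=u\}$ for every $u\colon V_0\to\mathbb R$ (it is regular since all $r_i<1$). Let $\mathcal F=\{u\in C(K):\lim_{m}\mathcal E^{(m)}(u|_{V_m},u|_{V_m})<\infty\}$ and $\mathcal E(u,v)=\lim_m\mathcal E^{(m)}(u|_{V_m},v|_{V_m})$ for $u,v\in\mathcal F$. For $f\in\mathcal F$ let $\lambda_{\langle f\rangle}$ be the unique finite Borel measure on $\Sigma$ with $\lambda_{\langle f\rangle}(\Sigma_w)=\frac{2}{r_w}\mathcal E(f\circ\psi_w,f\circ\psi_w)$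 for all finite words $w$, and for $f,g\in\mathcal F$ let $\lambda_{\langle f,g\rangle}=(\lambda_{\langle f+g\rangle}-\lambda_{\langle f-g\rangle})/4$. **Proposition.** Let $J$ be finite or countably infinite, let $\{f_i\}_{i\in J}$ be an arbitrary family in $\mathcal F$, and let $b_i>0$ $(i\in J)$ be such that $\hat\lambda=\sum_{i\in J}b_i\lambda_{\langle f_i\rangle}$ is a probability measure on $\Sigma$. Then $\lambda_{\langle f_i,f_j\rangle}$ is absolutely continuous with respect to $\hat\lambda$ for all $i,j\in J$, and there exist measurable functions $\hat\zeta_i\colon\Sigma\to\mathbb R$ $(i\in J)$ such that, for all $i,j\in J$, $$\frac{d\lambda_{\langle f_i,f_j\rangle}}{d\hat\lambda}(\omega)=\hat\zeta_i(\omega)\,\hat\zeta_j(\omega)\qquad\text{for }\hat\lambda\text{-a.e. }\omega.$$ -/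

import Mathlib

open Filter Topology MeasureTheory

/-- A self-similar structure on `K` with symbol set `S = Fin N`: continuous injections
`ψ i : K → K` together with a continuous surjection `π : S^ℕ → K` such that
`ψ i ∘ π = π ∘ σ i`, where `σ i` prepends the symbol `i`. -/
structure SelfSimilarStructure (K : Type*) [TopologicalSpace K] (N : ℕ) where
  ψ : Fin N → K → K
  ψ_continuous : ∀ i, Continuous (ψ i)
  ψ_injective : ∀ i, Function.Injective (ψ i)
  π : (ℕ → Fin N) → K
  π_continuous : Continuous π
  π_surjective : Function.Surjective π
  ψ_π : ∀ (i : Fin N) (ω : ℕ → Fin N),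
    ψ i (π ω) = π (fun n => Nat.casesOn n i (fun k => ω k))

namespace SelfSimilarStructure

variable {K : Type*} [TopologicalSpace K] {N : ℕ} (L : SelfSimilarStructure K N)

/-- The post-critical set: all iterated shifts `σ^m τ`, `m ≥ 1`, of sequences `τ` such that `π τ`
lies in `ψ i (K) ∩ ψ j (K)` for some `i ≠ j`. -/
def postCritical : Set (ℕ → Fin N) :=
  {ω | ∃ m : ℕ, 1 ≤ m ∧ ∃ τ : ℕ → Fin N,
    (∃ i j : Fin N, i ≠ j ∧ L.π τ ∈ Set.range (L.ψ i) ∩ Set.range (L.ψ j)) ∧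
    ω = fun n => τ (n + m)}

/-- The boundary `V₀`. -/
def V0 : Set K := L.π '' L.postCritical

/-- `ψ_w = ψ_{w₁} ∘ ⋯ ∘ ψ_{w_m}` for a finite word `w`. -/
def ψword : List (Fin N) → K → K
  | [] => id
  | i :: w => L.ψ i ∘ ψword w

/-- The form `ℰ⁽⁰⁾(u, v) = (-D u, v)` on `l(V₀)`, evaluated at the restrictions to `V₀` of two
functions on `K`. -/
def form0 [Fintype L.V0] (D : Matrix L.V0 L.V0 ℝ) (u v : K → ℝ) : ℝ :=
  (-(D.mulVec (fun p => u p))) ⬝ᵥ (fun p => v p)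

/-- The form `ℰ⁽ᵐ⁾(u, v) = ∑_{w ∈ W_m} r_w⁻¹ ℰ⁽⁰⁾(u ∘ ψ_w, v ∘ ψ_w)`. It only depends on the
restrictions of `u` and `v` to `V_m = ⋃_{w ∈ W_m} ψ_w(V₀)`, and every function on `V_m` is such a
restriction. -/
noncomputable def form [Fintype L.V0] (D : Matrix L.V0 L.V0 ℝ) (r : Fin N → ℝ) (m : ℕ)
    (u v : K → ℝ) : ℝ :=
  ∑ w : Fin m → Fin N,
    (∏ k, r (w k))⁻¹ *
      L.form0 D (u ∘ L.ψword (List.ofFn w)) (v ∘ L.ψword (List.ofFn w))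

/-- `(D, r)` is a harmonic structure: `D` is a symmetric, nonpositive definite matrix on `V₀` whose
kernel consists of the constants and whose off-diagonal entries are nonnegative, `r` is a positive
weight, and `ℰ⁽⁰⁾` is the trace on `V₀` of `ℰ⁽¹⁾`, i.e. `ℰ⁽⁰⁾(u, u)` is the minimum of `ℰ⁽¹⁾(v, v)`
over all `v` with `v = u` on `V₀`. -/
structure IsHarmonicStructure [Fintype L.V0] (D : Matrix L.V0 L.V0 ℝ) (r : Fin N → ℝ) :
    Prop where
  symm : D.IsSymm
  nonpos : ∀ u : L.V0 → ℝ, D.mulVec u ⬝ᵥ u ≤ 0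
  ker : ∀ u : L.V0 → ℝ, D.mulVec u = 0 ↔ ∃ c : ℝ, u = fun _ => c
  offDiag : ∀ p q : L.V0, p ≠ q → 0 ≤ D p q
  r_pos : ∀ i, 0 < r i
  le_form : ∀ u : K → ℝ, L.form0 D u u ≤ L.form D r 1 u u
  form_attained : ∀ u : K → ℝ, ∃ v : K → ℝ, (∀ p ∈ L.V0, v p = u p) ∧
    L.form D r 1 v v = L.form0 D u u

/-- The domain `ℱ`: continuous functions `u` for which `lim_m ℰ⁽ᵐ⁾(u, u)` is finite. -/
def domain [Fintype L.V0] (D : Matrix L.V0 L.V0 ℝ) (r : Fin N → ℝ) : Set (K → ℝ) :=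
  {u | Continuous u ∧ ∃ l : ℝ, Tendsto (fun m => L.form D r m u u) atTop (𝓝 l)}

/-- `ℰ(u, v) = lim_m ℰ⁽ᵐ⁾(u, v)` (for `u, v ∈ ℱ`). -/
noncomputable def energy [Fintype L.V0] (D : Matrix L.V0 L.V0 ℝ) (r : Fin N → ℝ)
    (u v : K → ℝ) : ℝ :=
  limUnder atTop (fun m => L.form D r m u v)

/-- `ν` is a finite Borel measure on `Σ = S^ℕ` with `ν(Σ_w) = 2 r_w⁻¹ ℰ(f ∘ ψ_w, f ∘ ψ_w)` for every
finite word `w`, where `Σ_w` is the set of all sequences that begin with `w`. -/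
def IsEnergyMeasure [Fintype L.V0] (D : Matrix L.V0 L.V0 ℝ) (r : Fin N → ℝ) (f : K → ℝ)
    (ν : Measure (ℕ → Fin N)) : Prop :=
  IsFiniteMeasure ν ∧ ∀ (m : ℕ) (w : Fin m → Fin N),
    ν {ω | ∀ k : Fin m, ω k = w k} =
      ENNReal.ofReal (2 * ((∏ k, r (w k))⁻¹ *
        L.energy D r (f ∘ L.ψword (List.ofFn w)) (f ∘ L.ψword (List.ofFn w))))

open Classical in
/-- The measure `λ_⟨f⟩` on `S^ℕ`: the unique measure with the property above. For `f ∈ ℱ` it exists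
by Kolmogorov's extension theorem; the value `0` is only used outside `ℱ`. -/
noncomputable def energyMeasure [Fintype L.V0] (D : Matrix L.V0 L.V0 ℝ) (r : Fin N → ℝ)
    (f : K → ℝ) : Measure (ℕ → Fin N) :=
  if h : ∃ ν, L.IsEnergyMeasure D r f ν then h.choose else 0

instance [Fintype L.V0] (D : Matrix L.V0 L.V0 ℝ) (r : Fin N → ℝ) (f : K → ℝ) :
    IsFiniteMeasure (L.energyMeasure D r f) := by
  unfold energyMeasure
  split_ifs with h
  · exact h.choose_spec.1
  · infer_instance

/-- The signed measure `λ_⟨f,g⟩ = (λ_⟨f+g⟩ - λ_⟨f-g⟩) / 4`. -/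
noncomputable def mutualEnergyMeasure [Fintype L.V0] (D : Matrix L.V0 L.V0 ℝ) (r : Fin N → ℝ)
    (f g : K → ℝ) : SignedMeasure (ℕ → Fin N) :=
  (1 / 4 : ℝ) • ((L.energyMeasure D r (f + g)).toSignedMeasure -
    (L.energyMeasure D r (f - g)).toSignedMeasure)

/-- The weighted sum `∑_i b_i λ_⟨f_i⟩`. -/
noncomputable def weightedEnergyMeasure [Fintype L.V0] (D : Matrix L.V0 L.V0 ℝ) (r : Fin N → ℝ)
    {J : Type*} (b : J → ℝ) (f : J → K → ℝ) : Measure (ℕ → Fin N) :=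
  Measure.sum (fun i => ENNReal.ofReal (b i) • L.energyMeasure D r (f i))

end SelfSimilarStructure

/-!
The theorem says that the matrix of densities `Z i j = dλ_⟨f_i, f_j⟩ / dλ̂` has the form
`ζ i * ζ j`. It is positive semidefinite almost everywhere, because `λ_⟨f + t g⟩` is a positive
measure for every `t`, and every `λ_⟨f_i⟩` is dominated by `λ̂`. So the point is that its rank is at
most one, that is, `Z f f * Z g g = Z f g ^ 2` almost everywhere for any two functions of finite
energy. This is proved by measuring areas.

For two functions `f, g` and a word `w`, consider the area `√(E(f,f) E(g,g) - E(f,g)²)` spanned by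
`f ∘ ψ_w` and `g ∘ ψ_w` with respect to the energy `E`. The function `√det` is concave on positive
semidefinite matrices, so the integral of `√(Z f f * Z g g - Z f g ^ 2)` over the cylinder of `w` is
at most `2 / r_w` times this area (`integral_gramArea_le`). It is therefore enough to show that the
total area of all cells of level `m`, weighted by `1 / r_w`, becomes arbitrarily small
(`exists_sum_energyArea_lt`). Since functions of finite energy are approximated in energy by
piecewise harmonic functions, this reduces to harmonic functions, for which the total area is
decreasing in the level by superadditivity, and in fact contracts by a factor less than one over a
fixed number of levels (`exists_areaSum_le_mul`).

By compactness, it suffices to see a strict decrease for each single pair `u, v` of unit energy. The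
area is at most half the trace of the Gram matrix, whose total is the same at all levels; equality
on all cells would mean that `u, v` are orthogonal with equal energies on every cell. At a boundary
point `p` fixed by `ψ i` this is impossible (`exists_word_not_proportional`): some rotation of the
pair has one member with vanishing normal derivative at `p`, and the energy of that member on the
cells `ψ_i^m(K)` is of smaller order than the energy of the other one. The latter is the
Perron-Frobenius property of the harmonic matrix of the cell at `p`
(`exists_tendsto_energy_replicate`), where positivity comes from the strong maximum principle
(`mul_Aword_eq_zero`) and from the connectedness of `K \ {p}`, which makes the graph of `D` on
`V₀ \ {p}` connected (`boundary_graph_connected`).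

The energy measures exist as limit points of discrete measures in the compact space of finite
measures on the sequence space (`exists_measure_wordCylinder`), and all identities between the
signed measures are checked on cylinders (`signedMeasure_ext_wordCylinder`).
-/

/-! ### Transfer operators -/

section Transfer

variable {ι Ω Ω' : Type*} [Fintype ι]

/-- The transfer operator `Φ ↦ ∑ i, (r i)⁻¹ Φ(act i ·)` of a finite family of self-maps
`act i : Ω → Ω` with weights `(r i)⁻¹`. Its `m`-th iterate is a sum over the words of length `m`;
all level-`m` quantities of the fractal are written as such iterates. -/
noncomputable def transfer (r : ι → ℝ) (act : ι → Ω → Ω) (Φ : Ω → ℝ) (x : Ω) : ℝ :=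
  ∑ i, (r i)⁻¹ * Φ (act i x)

variable {r : ι → ℝ} {act : ι → Ω → Ω}

lemma transfer_iterate_succ (m : ℕ) (Φ : Ω → ℝ) (x : Ω) :
    (transfer r act)^[m + 1] Φ x = ∑ i, (r i)⁻¹ * (transfer r act)^[m] Φ (act i x) := by
  rw [Function.iterate_succ_apply']; rfl

lemma transfer_iterate_add (m : ℕ) (Φ Ψ : Ω → ℝ) (x : Ω) :
    (transfer r act)^[m] (fun y => Φ y + Ψ y) x =
      (transfer r act)^[m] Φ x + (transfer r act)^[m] Ψ x := by
  induction m generalizing x with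
  | zero => rfl
  | succ m ih => simp only [transfer_iterate_succ, ih, mul_add, Finset.sum_add_distrib]

lemma transfer_iterate_const_mul (m : ℕ) (c : ℝ) (Φ : Ω → ℝ) (x : Ω) :
    (transfer r act)^[m] (fun y => c * Φ y) x = c * (transfer r act)^[m] Φ x := by
  induction m generalizing x with
  | zero => rfl
  | succ m ih =>
    simp only [transfer_iterate_succ, ih, Finset.mul_sum]
    exact Finset.sum_congr rfl fun i _ => by ring

lemma transfer_iterate_sub (m : ℕ) (Φ Ψ : Ω → ℝ) (x : Ω) :
    (transfer r act)^[m] (fun y => Φ y - Ψ y) x =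
      (transfer r act)^[m] Φ x - (transfer r act)^[m] Ψ x := by
  induction m generalizing x with
  | zero => rfl
  | succ m ih => simp only [transfer_iterate_succ, ih, mul_sub, Finset.sum_sub_distrib]

lemma transfer_iterate_mono (hr : ∀ i, 0 < r i) (m : ℕ) {Φ Ψ : Ω → ℝ} (h : ∀ y, Φ y ≤ Ψ y)
    (x : Ω) : (transfer r act)^[m] Φ x ≤ (transfer r act)^[m] Ψ x := by
  induction m generalizing x with
  | zero => exact h x
  | succ m ih =>
    simp only [transfer_iterate_succ]
    exact Finset.sum_le_sum fun i _ => mul_le_mul_of_nonneg_left (ih _) (inv_pos.2 (hr i)).le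

lemma transfer_iterate_nonneg (hr : ∀ i, 0 < r i) (m : ℕ) {Φ : Ω → ℝ} (h : ∀ y, 0 ≤ Φ y) (x : Ω) :
    0 ≤ (transfer r act)^[m] Φ x := by
  induction m generalizing x with
  | zero => exact h x
  | succ m ih =>
    simp only [transfer_iterate_succ]
    exact Finset.sum_nonneg fun i _ => mul_nonneg (inv_pos.2 (hr i)).le (ih _)

/-- Transfer operators commute with pull-back along an equivariant map. -/
lemma transfer_iterate_comp {act' : ι → Ω' → Ω'} {e : Ω → Ω'}
    (he : ∀ i x, e (act i x) = act' i (e x)) (m : ℕ) (Φ : Ω' → ℝ) (x : Ω) :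
    (transfer r act)^[m] (fun y => Φ (e y)) x = (transfer r act')^[m] Φ (e x) := by
  induction m generalizing x with
  | zero => rfl
  | succ m ih => simp only [transfer_iterate_succ, ih, he]

/-- A fixed function of the transfer operator is fixed by its iterates. -/
lemma transfer_iterate_eq_self {Φ : Ω → ℝ} (h : ∀ x, ∑ i, (r i)⁻¹ * Φ (act i x) = Φ x)
    (m : ℕ) (x : Ω) : (transfer r act)^[m] Φ x = Φ x := by
  induction m generalizing x with
  | zero => rfl
  | succ m ih => simp only [transfer_iterate_succ, ih, h]

/-- The Cauchy-Schwarz inequality for sums over words. -/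
lemma transfer_iterate_sqrt_mul_sqrt_le (hr : ∀ i, 0 < r i) (m : ℕ) {Φ Ψ : Ω → ℝ}
    (hΦ : ∀ y, 0 ≤ Φ y) (hΨ : ∀ y, 0 ≤ Ψ y) (x : Ω) :
    (transfer r act)^[m] (fun y => √(Φ y) * √(Ψ y)) x ≤
      √((transfer r act)^[m] Φ x) * √((transfer r act)^[m] Ψ x) := by
  induction m generalizing x with
  | zero => exact le_rfl
  | succ m ih =>
    simp only [transfer_iterate_succ]
    refine le_trans (Finset.sum_le_sum fun i _ =>
      mul_le_mul_of_nonneg_left (ih (act i x)) (inv_pos.2 (hr i)).le) ?_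
    refine le_trans (le_of_eq ?_) (Real.sum_sqrt_mul_sqrt_le Finset.univ
      (f := fun i => (r i)⁻¹ * (transfer r act)^[m] Φ (act i x))
      (g := fun i => (r i)⁻¹ * (transfer r act)^[m] Ψ (act i x))
      (fun i => mul_nonneg (inv_pos.2 (hr i)).le (transfer_iterate_nonneg hr m hΦ _))
      (fun i => mul_nonneg (inv_pos.2 (hr i)).le (transfer_iterate_nonneg hr m hΨ _)))
    refine Finset.sum_congr rfl fun i _ => ?_
    rw [Real.sqrt_mul (inv_pos.2 (hr i)).le, Real.sqrt_mul (inv_pos.2 (hr i)).le]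
    have := Real.mul_self_sqrt (inv_pos.2 (hr i)).le
    linear_combination (-(√((transfer r act)^[m] Φ (act i x)) *
      √((transfer r act)^[m] Ψ (act i x)))) * this

lemma transfer_iterate_add_sqrt_le (hr : ∀ i, 0 < r i) (m : ℕ) {W Φ Ψ : Ω → ℝ}
    (hΦ : ∀ y, 0 ≤ Φ y) (hΨ : ∀ y, 0 ≤ Ψ y) {x : Ω} {w a b : ℝ}
    (hW : (transfer r act)^[m] W x ≤ w) (ha : (transfer r act)^[m] Φ x = a)
    (hb : (transfer r act)^[m] Ψ x = b) :
    (transfer r act)^[m] (fun y => W y + √(Φ y) * √(Ψ y)) x ≤ w + √a * √b := by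
  rw [transfer_iterate_add m W (fun y => √(Φ y) * √(Ψ y)), ← ha, ← hb]
  exact add_le_add hW (transfer_iterate_sqrt_mul_sqrt_le hr m hΦ hΨ x)

/-- If `Φ` is nonnegative at all images of `x` under words as long as `w`, then the contribution of
the single word `w` is at most the whole sum. -/
lemma transfer_iterate_ge_word (hr : ∀ i, 0 < r i) (w : List ι) {Φ : Ω → ℝ} (x : Ω)
    (h : ∀ w' : List ι, w'.length = w.length → 0 ≤ Φ (w'.foldl (fun y i => act i y) x)) :
    (w.map fun i => (r i)⁻¹).prod * Φ (w.foldl (fun y i => act i y) x) ≤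
      (transfer r act)^[w.length] Φ x := by
  have key : ∀ (m : ℕ) (x : Ω),
      (∀ w' : List ι, w'.length = m → 0 ≤ Φ (w'.foldl (fun y i => act i y) x)) →
      0 ≤ (transfer r act)^[m] Φ x := by
    intro m
    induction m with
    | zero => intro x h; exact h [] rfl
    | succ m ih =>
      intro x h
      rw [transfer_iterate_succ]
      exact Finset.sum_nonneg fun i _ => mul_nonneg (inv_pos.2 (hr i)).le
        (ih _ fun w' hw' => h (i :: w') (by simp [hw']))
  induction w generalizing x with
  | nil => simp
  | cons i w ih =>
    simp only [List.map_cons, List.prod_cons, List.foldl_cons, List.length_cons,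
      transfer_iterate_succ]
    have h1 : ∀ j, 0 ≤ (r j)⁻¹ * (transfer r act)^[w.length] Φ (act j x) := fun j =>
      mul_nonneg (inv_pos.2 (hr j)).le
        (key _ _ fun w' hw' => h (j :: w') (by simp [hw']))
    refine le_trans ?_ (Finset.single_le_sum (fun j _ => h1 j) (Finset.mem_univ i))
    rw [mul_assoc]
    exact mul_le_mul_of_nonneg_left (ih _ fun w' hw' => h (i :: w') (by simp [hw']))
      (inv_pos.2 (hr i)).le

end Transfer

/-! ### Gram determinants of pairs of vectors -/

section Gram

/-- The square root of the determinant of the symmetric matrix `!![a, c; c, b]`. For the Gram matrix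
of two vectors this is the area of the parallelogram they span. -/
noncomputable def gramArea (a b c : ℝ) : ℝ := √(a * b - c ^ 2)

lemma gramArea_nonneg (a b c : ℝ) : 0 ≤ gramArea a b c := Real.sqrt_nonneg _

lemma gramArea_le_sqrt_mul_sqrt {a b c : ℝ} (ha : 0 ≤ a) :
    gramArea a b c ≤ √a * √b := by
  rw [← Real.sqrt_mul ha]
  exact Real.sqrt_le_sqrt (by nlinarith [sq_nonneg c])

lemma gramArea_smul {t : ℝ} (ht : 0 ≤ t) (a b c : ℝ) :
    gramArea (t * a) (t * b) (t * c) = t * gramArea a b c := by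
  rw [gramArea, gramArea, show t * a * (t * b) - (t * c) ^ 2 = t ^ 2 * (a * b - c ^ 2) by ring,
    Real.sqrt_mul (sq_nonneg t), Real.sqrt_sq ht]

/-- The mixed discriminant inequality for two symmetric `2 × 2` matrices, the first of them positive
semidefinite. -/
lemma four_mul_det_mul_det_le {a b c a' b' c' : ℝ} (ha : 0 ≤ a)
    (h : c ^ 2 ≤ a * b) :
    4 * ((a * b - c ^ 2) * (a' * b' - c' ^ 2)) ≤ (a * b' + a' * b - 2 * c * c') ^ 2 := by
  rcases ha.eq_or_lt with rfl | ha
  · have hc : c = 0 := by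
      have : c ^ 2 ≤ 0 := by simpa using h
      exact pow_eq_zero_iff (two_ne_zero) |>.1 (le_antisymm this (sq_nonneg c))
    subst hc
    simp only [zero_mul, mul_zero, zero_add, sub_zero]
    nlinarith [sq_nonneg (a' * b)]
  · have e : a ^ 2 * ((a * b' + a' * b - 2 * c * c') ^ 2
        - 4 * ((a * b - c ^ 2) * (a' * b' - c' ^ 2))) =
        ((a ^ 2 * b' - 2 * a * c * c' + c ^ 2 * a') - a' * (a * b - c ^ 2)) ^ 2
          + 4 * (a * b - c ^ 2) * (a * c' - c * a') ^ 2 := by ring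
    have : 0 ≤ a ^ 2 * ((a * b' + a' * b - 2 * c * c') ^ 2
        - 4 * ((a * b - c ^ 2) * (a' * b' - c' ^ 2))) := by
      rw [e]
      have := mul_nonneg (sub_nonneg.2 h) (sq_nonneg (a * c' - c * a'))
      nlinarith [sq_nonneg ((a ^ 2 * b' - 2 * a * c * c' + c ^ 2 * a') - a' * (a * b - c ^ 2))]
    have := nonneg_of_mul_nonneg_right this (by positivity)
    linarith

lemma mixed_nonneg {a b c a' b' c' : ℝ} (ha : 0 ≤ a) (hb : 0 ≤ b) (ha' : 0 ≤ a') (hb' : 0 ≤ b')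
    (h : c ^ 2 ≤ a * b) (h' : c' ^ 2 ≤ a' * b') : 0 ≤ a * b' + a' * b - 2 * c * c' := by
  have h1 : (c * c') ^ 2 ≤ (a * b') * (a' * b) := by
    calc (c * c') ^ 2 = c ^ 2 * c' ^ 2 := by ring
      _ ≤ (a * b) * (a' * b') := mul_le_mul h h' (sq_nonneg _) (mul_nonneg ha hb)
      _ = _ := by ring
  have h2 : (2 * (c * c')) ^ 2 ≤ (a * b' + a' * b) ^ 2 := by
    nlinarith [sq_nonneg (a * b' - a' * b)]
  have := abs_le_of_sq_le_sq' h2 (by positivity)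
  linarith [this.2]

/-- The mixed discriminant inequality, with square roots. -/
lemma two_mul_gramArea_mul_gramArea_le {a b c a' b' c' : ℝ} (ha : 0 ≤ a) (hb : 0 ≤ b)
    (ha' : 0 ≤ a') (hb' : 0 ≤ b') (h : c ^ 2 ≤ a * b) (h' : c' ^ 2 ≤ a' * b') :
    2 * (gramArea a b c * gramArea a' b' c') ≤ a * b' + a' * b - 2 * c * c' := by
  refine le_of_abs_le (abs_le_of_sq_le_sq ?_ (mixed_nonneg ha hb ha' hb' h h'))
  rw [mul_pow, mul_pow, gramArea, gramArea, Real.sq_sqrt (sub_nonneg.2 h),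
    Real.sq_sqrt (sub_nonneg.2 h')]
  linarith [four_mul_det_mul_det_le (a' := a') (b' := b') (c' := c') ha h]

/-- Minkowski's determinant inequality for `2 × 2` matrices. -/
lemma gramArea_add_le {a b c a' b' c' : ℝ} (ha : 0 ≤ a) (hb : 0 ≤ b)
    (ha' : 0 ≤ a') (hb' : 0 ≤ b') (h : c ^ 2 ≤ a * b) (h' : c' ^ 2 ≤ a' * b') :
    gramArea a b c + gramArea a' b' c' ≤ gramArea (a + a') (b + b') (c + c') := by
  refine Real.le_sqrt_of_sq_le ?_
  have h1 := two_mul_gramArea_mul_gramArea_le ha hb ha' hb' h h'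
  have h2 : gramArea a b c ^ 2 = _ := Real.sq_sqrt (sub_nonneg.2 h)
  have h3 : gramArea a' b' c' ^ 2 = _ := Real.sq_sqrt (sub_nonneg.2 h')
  nlinarith

/-- Areas are superadditive, and a sum of positive semidefinite matrices is positive
semidefinite. -/
lemma sum_gramArea_le {ι : Type*} (s : Finset ι) (a b c : ι → ℝ) (ha : ∀ i, 0 ≤ a i)
    (hb : ∀ i, 0 ≤ b i) (h : ∀ i, c i ^ 2 ≤ a i * b i) :
    ∑ i ∈ s, gramArea (a i) (b i) (c i) ≤
        gramArea (∑ i ∈ s, a i) (∑ i ∈ s, b i) (∑ i ∈ s, c i) ∧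
      (∑ i ∈ s, c i) ^ 2 ≤ (∑ i ∈ s, a i) * ∑ i ∈ s, b i := by
  classical
  induction s using Finset.induction_on with
  | empty => simp [gramArea]
  | insert i s hi ih =>
    simp only [Finset.sum_insert hi]
    have hA : 0 ≤ ∑ i ∈ s, a i := Finset.sum_nonneg fun i _ => ha i
    have hB : 0 ≤ ∑ i ∈ s, b i := Finset.sum_nonneg fun i _ => hb i
    refine ⟨(add_le_add_right ih.1 _).trans (gramArea_add_le (ha i) (hb i) hA hB (h i) ih.2), ?_⟩
    have := mixed_nonneg (ha i) (hb i) hA hB (h i) ih.2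
    nlinarith [h i, ih.2]

/-- An upper estimate for the area of a sum of two positive semidefinite matrices, useful when the
second one is small. -/
lemma gramArea_add_le_of_small {a b c a' b' c' : ℝ} (ha : 0 ≤ a) (hb : 0 ≤ b)
    (ha' : 0 ≤ a') (hb' : 0 ≤ b') (h : c ^ 2 ≤ a * b) (h' : c' ^ 2 ≤ a' * b') :
    gramArea (a + a') (b + b') (c + c') ≤
      gramArea a b c + √a * √b' + √a' * √b + √a' * √b' := by
  have h2 : gramArea a b c ^ 2 = _ := Real.sq_sqrt (sub_nonneg.2 h)
  have h0 := gramArea_nonneg a b c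
  have hx := Real.sqrt_nonneg a
  have hy := Real.sqrt_nonneg b
  have hx' := Real.sqrt_nonneg a'
  have hy' := Real.sqrt_nonneg b'
  have ex := Real.sq_sqrt ha
  have ey := Real.sq_sqrt hb
  have ex' := Real.sq_sqrt ha'
  have ey' := Real.sq_sqrt hb'
  have hcc : |c * c'| ≤ √a * √b * (√a' * √b') := by
    refine abs_le_of_sq_le_sq ?_ (by positivity)
    calc (c * c') ^ 2 = c ^ 2 * c' ^ 2 := by ring
      _ ≤ (a * b) * (a' * b') := mul_le_mul h h' (sq_nonneg _) (mul_nonneg ha hb)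
      _ = (√a * √b * (√a' * √b')) ^ 2 := by rw [mul_pow, mul_pow, mul_pow, ex, ey, ex', ey']
  have hcc' := neg_le_of_abs_le hcc
  refine Real.sqrt_le_iff.2 ⟨by positivity, ?_⟩
  have e : (gramArea a b c + √a * √b' + √a' * √b + √a' * √b') ^ 2 =
      gramArea a b c ^ 2 + √a ^ 2 * √b' ^ 2 + √a' ^ 2 * √b ^ 2 + √a' ^ 2 * √b' ^ 2
       + 2 * (√a * √b * (√a' * √b')) + 2 * (gramArea a b c * (√a * √b' + √a' * √b + √a' * √b'))
       + 2 * (√a' * √b' * (√a * √b' + √a' * √b)) := by ring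
  rw [e, ex, ey, ex', ey', h2]
  have p1 : 0 ≤ gramArea a b c * (√a * √b' + √a' * √b + √a' * √b') := by positivity
  have p2 : 0 ≤ √a' * √b' * (√a * √b' + √a' * √b) := by positivity
  nlinarith [sq_nonneg c']

lemma sq_le_mul_of_forall_quadratic_nonneg {a b c : ℝ}
    (h : ∀ t : ℝ, 0 ≤ a + 2 * t * c + t ^ 2 * b) : c ^ 2 ≤ a * b := by
  have := discrim_le_zero (a := b) (b := 2 * c) (c := a) fun t => by
    have := h t
    linarith
  rw [discrim] at this
  nlinarith

variable {V : Type*} [AddCommGroup V] [Module ℝ V]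

/-- The area `√(B(u,u) B(v,v) - B(u,v)²)` of the parallelogram spanned by `u` and `v`, with respect
to a positive semidefinite form `B`. -/
noncomputable def formArea (B : LinearMap.BilinForm ℝ V) (u v : V) : ℝ :=
  gramArea (B u u) (B v v) (B u v)

variable {B : LinearMap.BilinForm ℝ V}

lemma formArea_comm (hs : ∀ u v, B u v = B v u) (u v : V) : formArea B u v = formArea B v u := by
  rw [formArea, formArea, hs u v, gramArea, gramArea, mul_comm]

lemma form_sq_le (hs : ∀ u v, B u v = B v u) (hB : ∀ u, 0 ≤ B u u) (u v : V) :
    B u v ^ 2 ≤ B u u * B v v := by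
  have := LinearMap.BilinForm.apply_mul_apply_le_of_forall_zero_le B hB u v
  rwa [hs v u, ← sq] at this

/-- For fixed `v` the area is a seminorm in `u`. -/
lemma formArea_add_left_le (hs : ∀ u v, B u v = B v u) (hB : ∀ u, 0 ≤ B u u) (u u' v : V) :
    formArea B (u + u') v ≤ formArea B u v + formArea B u' v := by
  have hq : ∀ w, B w v ^ 2 ≤ B w w * B v v := fun w => form_sq_le hs hB w v
  have hmix : (B u u' * B v v - B u v * B u' v) ^ 2 ≤
      (B u u * B v v - B u v ^ 2) * (B u' u' * B v v - B u' v ^ 2) := by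
    refine sq_le_mul_of_forall_quadratic_nonneg fun t => ?_
    have := hq (u + t • u')
    simp only [map_add, LinearMap.add_apply, map_smul, LinearMap.smul_apply, smul_eq_mul,
      hs u' u] at this
    nlinarith
  have h1 : formArea B u v ^ 2 = B u u * B v v - B u v ^ 2 := Real.sq_sqrt (sub_nonneg.2 (hq u))
  have h2 : formArea B u' v ^ 2 = B u' u' * B v v - B u' v ^ 2 :=
    Real.sq_sqrt (sub_nonneg.2 (hq u'))
  have n1 : 0 ≤ formArea B u v := gramArea_nonneg _ _ _
  have n2 : 0 ≤ formArea B u' v := gramArea_nonneg _ _ _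
  have hmix' : B u u' * B v v - B u v * B u' v ≤ formArea B u v * formArea B u' v := by
    refine le_of_abs_le (abs_le_of_sq_le_sq ?_ (mul_nonneg n1 n2))
    rwa [mul_pow, h1, h2]
  refine Real.sqrt_le_iff.2 ⟨add_nonneg n1 n2, ?_⟩
  simp only [map_add, LinearMap.add_apply, hs u' u]
  nlinarith

/-- The area depends continuously on both vectors, in the seminorm of `B`. -/
lemma formArea_le_add (hs : ∀ u v, B u v = B v u) (hB : ∀ u, 0 ≤ B u u) (u u' v v' : V) :
    formArea B u v ≤ formArea B u' v' + √(B (u - u') (u - u')) * √(B v v)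
      + √(B u' u') * √(B (v - v') (v - v')) := by
  have h1 := formArea_add_left_le hs hB u' (u - u') v
  rw [add_sub_cancel] at h1
  have h2 := formArea_add_left_le hs hB v' (v - v') u'
  rw [add_sub_cancel, formArea_comm hs, formArea_comm hs v' u', formArea_comm hs (v - v')] at h2
  have h3 : formArea B (u - u') v ≤ _ := gramArea_le_sqrt_mul_sqrt (hB _)
  have h4 : formArea B u' (v - v') ≤ _ := gramArea_le_sqrt_mul_sqrt (hB _)
  linarith

end Gram

/-! ### Cells and boundary points -/

namespace SelfSimilarStructure

section Cells

variable {K : Type*} [TopologicalSpace K] {N : ℕ} (L : SelfSimilarStructure K N)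

/-- Two first-level cells meet only in images of boundary points. -/
lemma mem_V0_of_ψ_eq {i j : Fin N} (hij : i ≠ j) {y z : K} (h : L.ψ i y = L.ψ j z) :
    y ∈ L.V0 := by
  obtain ⟨η, rfl⟩ := L.π_surjective y
  refine ⟨η, ⟨1, le_rfl, fun n => Nat.casesOn n i (fun k => η k), ⟨i, j, hij, ?_, ?_⟩, rfl⟩, rfl⟩
  · exact ⟨_, L.ψ_π i η⟩
  · rw [← L.ψ_π i η, h]
    exact ⟨_, rfl⟩

lemma ψword_append (l l' : List (Fin N)) : L.ψword (l ++ l') = L.ψword l ∘ L.ψword l' := by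
  induction l with
  | nil => rfl
  | cons i l ih => simp only [List.cons_append, ψword, ih]; rfl

lemma ψword_continuous (w : List (Fin N)) : Continuous (L.ψword w) := by
  induction w with
  | nil => exact continuous_id
  | cons i w ih => exact (L.ψ_continuous i).comp ih

lemma ψword_injective (w : List (Fin N)) : Function.Injective (L.ψword w) := by
  induction w with
  | nil => exact Function.injective_id
  | cons i w ih => exact (L.ψ_injective i).comp ih

lemma exists_ψ_eq (x : K) : ∃ i y, L.ψ i y = x := by
  obtain ⟨ω, rfl⟩ := L.π_surjective x
  refine ⟨ω 0, L.π fun n => ω (n + 1), ?_⟩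
  rw [L.ψ_π]
  congr 1
  funext n
  cases n <;> rfl

lemma exists_ψword_eq (m : ℕ) (x : K) :
    ∃ w : List (Fin N), w.length = m ∧ ∃ y, L.ψword w y = x := by
  induction m generalizing x with
  | zero => exact ⟨[], rfl, x, rfl⟩
  | succ m ih =>
    obtain ⟨i, y, rfl⟩ := L.exists_ψ_eq x
    obtain ⟨w, hw, z, rfl⟩ := ih y
    exact ⟨i :: w, by simp [hw], z, rfl⟩

lemma ψword_replicate_fixed {i : Fin N} {p : K} (hp : L.ψ i p = p) (m : ℕ) :
    L.ψword (List.replicate m i) p = p := by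
  induction m with
  | zero => rfl
  | succ m ih => simp only [List.replicate_succ, ψword, Function.comp_apply, ih, hp]

lemma ψword_replicate_π (i : Fin N) (m : ℕ) (η : ℕ → Fin N) :
    L.ψword (List.replicate m i) (L.π η) = L.π (fun n => if n < m then i else η (n - m)) := by
  induction m with
  | zero => simp [ψword]
  | succ m ih =>
    simp only [List.replicate_succ, ψword, Function.comp_apply, ih, L.ψ_π]
    congr 1
    funext n
    cases n with
    | zero => simp
    | succ n => simp

/-- The nested cells `ψ_i^m(K)` shrink to a point. -/
lemma eq_π_const_of_forall_mem [T2Space K] {i : Fin N} {x : K}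
    (h : ∀ m, x ∈ Set.range (L.ψword (List.replicate m i))) : x = L.π fun _ => i := by
  have h' : ∀ m, ∃ η : ℕ → Fin N, L.π (fun n => if n < m then i else η (n - m)) = x := by
    intro m
    obtain ⟨y, hy⟩ := h m
    obtain ⟨η, rfl⟩ := L.π_surjective y
    exact ⟨η, by rw [← L.ψword_replicate_π, hy]⟩
  choose η hη using h'
  have ht : Tendsto (fun m : ℕ => fun n => if n < m then i else η m (n - m)) atTop
      (𝓝 fun _ => i) := by
    refine tendsto_pi_nhds.2 fun n => ?_
    refine tendsto_const_nhds.congr' ?_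
    filter_upwards [eventually_gt_atTop n] with m hm
    rw [if_pos hm]
  have h2 := (L.π_continuous.tendsto _).comp ht
  refine tendsto_nhds_unique (tendsto_const_nhds.congr fun m => ?_) h2
  exact (hη m).symm

lemma exists_notMem_range_replicate [T2Space K] {i : Fin N} {p q : K} (hp : L.ψ i p = p)
    (hq : q ≠ p) : ∃ m, q ∉ Set.range (L.ψword (List.replicate m i)) := by
  by_contra! h
  refine hq ((L.eq_π_const_of_forall_mem h).trans
    (L.eq_π_const_of_forall_mem fun m => ⟨p, ?_⟩).symm)
  exact L.ψword_replicate_fixed hp m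

lemma range_replicate_antitone (i : Fin N) :
    Antitone fun m => Set.range (L.ψword (List.replicate m i)) := by
  refine antitone_nat_of_succ_le fun m => ?_
  rintro _ ⟨y, rfl⟩
  rw [List.replicate_succ', ψword_append]
  exact ⟨_, rfl⟩

lemma fixed_point_unique [T2Space K] {i : Fin N} {p q : K} (hp : L.ψ i p = p)
    (hq : L.ψ i q = q) : q = p := by
  by_contra h
  obtain ⟨m, hm⟩ := L.exists_notMem_range_replicate hp h
  exact hm ⟨q, L.ψword_replicate_fixed hq m⟩

variable {L}

/-- In a post-critically finite structure the fixed point of `ψ i` lies in no other cell: otherwise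
the infinitely many sequences `i ⋯ i j η` would all be post-critical. -/
lemma eq_of_ψ_eq_fixed (hpcf : L.postCritical.Finite) {i j : Fin N} {p z : K}
    (hp : L.ψ i p = p) (hz : L.ψ j z = p) : j = i := by
  by_contra hij
  obtain ⟨η, rfl⟩ := L.π_surjective z
  let τ : ℕ → ℕ → Fin N := fun k n => if n < k then i else Nat.casesOn (n - k) j (fun l => η l)
  have hτ : ∀ k, L.π (τ k) = p := by
    intro k
    have := L.ψword_replicate_π i k (fun n => Nat.casesOn n j (fun l => η l))
    rw [← L.ψ_π, hz, L.ψword_replicate_fixed hp] at this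
    exact this.symm
  have hmem : ∀ k, τ k ∈ L.postCritical := by
    intro k
    refine ⟨1, le_rfl, τ (k + 1), ⟨j, i, hij, ?_, ?_⟩, ?_⟩
    · rw [hτ, ← hz]; exact ⟨_, rfl⟩
    · rw [hτ]; exact ⟨p, hp⟩
    · funext n
      simp [τ]
  have hinj : Function.Injective τ := by
    intro k l hkl
    by_contra hne
    wlog hlt : k < l generalizing k l
    · exact this hkl.symm (Ne.symm hne) (lt_of_le_of_ne (not_lt.1 hlt) (Ne.symm hne))
    have := congrFun hkl k
    simp only [τ, lt_irrefl, if_false, hlt, if_true, Nat.sub_self] at this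
    exact hij this
  exact Set.infinite_range_of_injective hinj (hpcf.subset (Set.range_subset_iff.2 hmem))

/-- The only cell of a given level that contains the fixed point of `ψ i` is `ψ_i^m(K)`. -/
lemma eq_replicate_of_ψword_eq_fixed (hpcf : L.postCritical.Finite) {i : Fin N} {p : K}
    (hp : L.ψ i p = p) (w : List (Fin N)) {y : K} (h : L.ψword w y = p) :
    w = List.replicate w.length i ∧ y = p := by
  induction w with
  | nil => exact ⟨rfl, h⟩
  | cons j t ih =>
    have hj : j = i := eq_of_ψ_eq_fixed hpcf hp (z := L.ψword t y) h
    subst hj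
    have h' : L.ψword t y = p := L.ψ_injective j (by rw [hp]; exact h)
    obtain ⟨h1, h2⟩ := ih h'
    refine ⟨?_, h2⟩
    rw [List.length_cons, List.replicate_succ, ← h1]

/-- Distinct cells of the same level meet only in images of boundary points. -/
lemma mem_V0_of_ψword_eq (hpcf : L.postCritical.Finite) (hfix : ∀ p ∈ L.V0, ∃ i, L.ψ i p = p)
    (w w' : List (Fin N)) (hlen : w.length = w'.length) (hne : w ≠ w') {y y' : K}
    (h : L.ψword w y = L.ψword w' y') : y ∈ L.V0 := by
  induction w generalizing w' with
  | nil =>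
    simp only [List.length_nil] at hlen
    exact absurd (List.length_eq_zero_iff.1 hlen.symm).symm hne
  | cons i t ih =>
    cases w' with
    | nil => simp at hlen
    | cons i' t' =>
      by_cases hi : i = i'
      · subst hi
        exact ih t' (by simpa using hlen) (fun h' => hne (by rw [h'])) (L.ψ_injective i h)
      · have hz : L.ψword t y ∈ L.V0 := L.mem_V0_of_ψ_eq hi h
        obtain ⟨j, hj⟩ := hfix _ hz
        rw [(eq_replicate_of_ψword_eq_fixed hpcf hj t rfl).2]
        exact hz

/-- Without boundary points the first-level cells would be disjoint, closed and, by `2 ≤ N`, proper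
subsets of the connected space `K`. -/
lemma nonempty_V0 [ConnectedSpace K] [CompactSpace K] [T2Space K] (hN : 2 ≤ N) :
    L.V0.Nonempty := by
  by_contra hV
  rw [Set.not_nonempty_iff_eq_empty] at hV
  have hdisj : ∀ i j : Fin N, i ≠ j → Disjoint (Set.range (L.ψ i)) (Set.range (L.ψ j)) := by
    intro i j hij
    rw [Set.disjoint_iff]
    rintro x ⟨⟨y, rfl⟩, ⟨z, hz⟩⟩
    have := L.mem_V0_of_ψ_eq hij hz.symm
    rw [hV] at this
    exact this
  have hcl : ∀ i : Fin N, IsClosed (Set.range (L.ψ i)) := fun i =>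
    (isCompact_range (L.ψ_continuous i)).isClosed
  let i0 : Fin N := ⟨0, by omega⟩
  let i1 : Fin N := ⟨1, by omega⟩
  have hcompl : (Set.range (L.ψ i0))ᶜ = ⋃ j ∈ {j : Fin N | j ≠ i0}, Set.range (L.ψ j) := by
    ext x
    simp only [Set.mem_compl_iff, Set.mem_ofPred_eq, Set.mem_iUnion, exists_prop]
    constructor
    · intro hx
      obtain ⟨j, y, rfl⟩ := L.exists_ψ_eq x
      exact ⟨j, fun h => hx (h ▸ ⟨y, rfl⟩), y, rfl⟩
    · rintro ⟨j, hj, hx⟩ hx'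
      exact (Set.disjoint_left.1 (hdisj j i0 hj)) hx hx'
  have hclopen : IsClopen (Set.range (L.ψ i0)) := by
    refine ⟨hcl i0, ?_⟩
    rw [← isClosed_compl_iff, hcompl]
    exact (Set.toFinite _).isClosed_biUnion fun j _ => hcl j
  rcases isClopen_iff.1 hclopen with h | h
  · obtain ⟨x⟩ := (inferInstance : Nonempty K)
    exact (Set.eq_empty_iff_forall_notMem.1 h) (L.ψ i0 x) ⟨x, rfl⟩
  · obtain ⟨x⟩ := (inferInstance : Nonempty K)
    refine (Set.disjoint_left.1 (hdisj i1 i0 (by simp [i0, i1]))) (a := L.ψ i1 x) ⟨x, rfl⟩ ?_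
    rw [h]; trivial

end Cells

end SelfSimilarStructure

/-! ### The energy form on the boundary -/

section EnergyForm

lemma energyForm_term_nonneg_of_disjoint {ι : Type*} {D : Matrix ι ι ℝ}
    (h : ∀ p q, p ≠ q → 0 ≤ D p q) {a b : ι → ℝ} (ha : ∀ p, 0 ≤ a p) (hb : ∀ p, 0 ≤ b p)
    (hab : ∀ p, a p * b p = 0) (p q : ι) :
    0 ≤ D p q * a p * b q := by
  by_cases hpq : p = q
  · subst hpq
    rw [mul_assoc, hab, mul_zero]
  · exact mul_nonneg (mul_nonneg (h p q hpq) (ha p)) (hb q)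

variable {ι : Type*} [Fintype ι]

open Classical in
/-- The quadratic form `(u, v) ↦ (u, -D v)` of a matrix `D`. -/
noncomputable def energyForm (D : Matrix ι ι ℝ) : LinearMap.BilinForm ℝ (ι → ℝ) :=
  Matrix.toBilin' (-D)

variable {D : Matrix ι ι ℝ}

lemma energyForm_apply (u v : ι → ℝ) : energyForm D u v = -(u ⬝ᵥ D.mulVec v) := by
  classical
  rw [energyForm, Matrix.toBilin'_apply', Matrix.neg_mulVec, dotProduct_neg]

lemma energyForm_eq_sum (u v : ι → ℝ) :
    energyForm D u v = -∑ p, ∑ q, D p q * u p * v q := by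
  rw [energyForm_apply]
  simp only [dotProduct, Matrix.mulVec, Finset.mul_sum]
  congr 1
  exact Finset.sum_congr rfl fun p _ => Finset.sum_congr rfl fun q _ => by ring

lemma energyForm_symm (hs : D.IsSymm) (u v : ι → ℝ) : energyForm D u v = energyForm D v u := by
  rw [energyForm_eq_sum, energyForm_eq_sum, Finset.sum_comm]
  congr 1
  refine Finset.sum_congr rfl fun p _ => Finset.sum_congr rfl fun q _ => ?_
  rw [← hs.apply p q]; ring

/-- The unit contraction `u ↦ |u|` decreases the energy. -/
lemma energyForm_abs_le (h : ∀ p q, p ≠ q → 0 ≤ D p q) (u : ι → ℝ) :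
    energyForm D (fun p => |u p|) (fun p => |u p|) ≤ energyForm D u u := by
  rw [energyForm_eq_sum, energyForm_eq_sum]
  refine neg_le_neg (Finset.sum_le_sum fun p _ => Finset.sum_le_sum fun q _ => ?_)
  by_cases hpq : p = q
  · subst hpq
    rw [mul_assoc, mul_assoc, abs_mul_abs_self]
  · rw [mul_assoc, mul_assoc, ← abs_mul]
    exact mul_le_mul_of_nonneg_left (le_abs_self _) (h p q hpq)

lemma energyForm_nonpos_of_disjoint (h : ∀ p q, p ≠ q → 0 ≤ D p q) {a b : ι → ℝ}
    (ha : ∀ p, 0 ≤ a p) (hb : ∀ p, 0 ≤ b p) (hab : ∀ p, a p * b p = 0) :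
    energyForm D a b ≤ 0 := by
  rw [energyForm_eq_sum, neg_nonpos]
  exact Finset.sum_nonneg fun p _ => Finset.sum_nonneg fun q _ =>
    energyForm_term_nonneg_of_disjoint h ha hb hab p q

lemma mul_mul_eq_zero_of_energyForm_eq_zero (h : ∀ p q, p ≠ q → 0 ≤ D p q) {a b : ι → ℝ}
    (ha : ∀ p, 0 ≤ a p) (hb : ∀ p, 0 ≤ b p) (hab : ∀ p, a p * b p = 0)
    (h0 : energyForm D a b = 0) (p q : ι) : D p q * a p * b q = 0 := by
  rw [energyForm_eq_sum, neg_eq_zero] at h0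
  have ht := energyForm_term_nonneg_of_disjoint h ha hb hab
  have h1 := (Finset.sum_eq_zero_iff_of_nonneg
    fun p _ => Finset.sum_nonneg fun q _ => ht p q).1 h0 p (Finset.mem_univ p)
  exact (Finset.sum_eq_zero_iff_of_nonneg fun q _ => ht p q).1 h1 q (Finset.mem_univ q)

end EnergyForm

namespace SelfSimilarStructure

section Words

variable {K : Type*} [TopologicalSpace K] {N : ℕ} {L : SelfSimilarStructure K N}

variable (L) in
/-- Restriction of functions to the boundary. -/
def bdry : (K → ℝ) →ₗ[ℝ] (L.V0 → ℝ) := LinearMap.funLeft ℝ ℝ Subtype.val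

@[simp] lemma bdry_apply (u : K → ℝ) (p : L.V0) : L.bdry u p = u p := rfl

variable (L) in
/-- A pair of functions is moved to the cell `i` by composition with `ψ i`. -/
def compPair (i : Fin N) (u : (K → ℝ) × (K → ℝ)) : (K → ℝ) × (K → ℝ) :=
  (u.1 ∘ L.ψ i, u.2 ∘ L.ψ i)

/-- Sums over all words of length `m`, as they occur in the definition of `form`, are iterates of a
transfer operator. -/
lemma sum_words_eq_transfer (r : Fin N → ℝ) (Φ : (K → ℝ) × (K → ℝ) → ℝ) (m : ℕ)
    (u : (K → ℝ) × (K → ℝ)) :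
    ∑ w : Fin m → Fin N, (∏ k, r (w k))⁻¹ *
      Φ (u.1 ∘ L.ψword (List.ofFn w), u.2 ∘ L.ψword (List.ofFn w)) =
      (transfer r L.compPair)^[m] Φ u := by
  induction m generalizing u with
  | zero => simp [ψword]
  | succ m ih =>
    rw [transfer_iterate_succ, ← (Fin.consEquiv fun _ => Fin N).sum_comp, Fintype.sum_prod_type]
    refine Finset.sum_congr rfl fun i _ => ?_
    rw [← ih, Finset.mul_sum]
    refine Finset.sum_congr rfl fun w _ => ?_
    simp only [Fin.consEquiv_apply, Fin.prod_univ_succ, Fin.cons_zero, Fin.cons_succ, mul_inv,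
      List.ofFn_succ, ψword, compPair, Function.comp_assoc, mul_assoc]

/-- Labels on the first-level cells that agree on intersecting cells are constant, because `K` is
connected. -/
lemma cell_label_const [CompactSpace K] [T2Space K] [PreconnectedSpace K] [Nonempty K] {α : Type*}
    (c : Fin N → α)
    (hc : ∀ i j, (Set.range (L.ψ i) ∩ Set.range (L.ψ j)).Nonempty → c i = c j) (i j : Fin N) :
    c i = c j := by
  have hcl : ∀ i : Fin N, IsClosed (Set.range (L.ψ i)) := fun i =>
    (isCompact_range (L.ψ_continuous i)).isClosed
  have hcompl : (⋃ k ∈ {k | c k = c j}, Set.range (L.ψ k))ᶜ =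
      ⋃ k ∈ {k | c k ≠ c j}, Set.range (L.ψ k) := by
    ext x
    simp only [Set.mem_compl_iff, Set.mem_ofPred_eq, Set.mem_iUnion, exists_prop, not_exists,
      not_and]
    constructor
    · intro hx
      obtain ⟨k, y, rfl⟩ := L.exists_ψ_eq x
      exact ⟨k, fun h => hx k h ⟨y, rfl⟩, y, rfl⟩
    · rintro ⟨k, hk, hx⟩ l hl hx'
      exact hk ((hc k l ⟨x, hx, hx'⟩).trans hl)
  have hclopen : IsClopen (⋃ k ∈ {k | c k = c j}, Set.range (L.ψ k)) := by
    refine ⟨(Set.toFinite _).isClosed_biUnion fun k _ => hcl k, ?_⟩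
    rw [← isClosed_compl_iff, hcompl]
    exact (Set.toFinite _).isClosed_biUnion fun k _ => hcl k
  obtain ⟨x⟩ := (inferInstance : Nonempty K)
  have huniv := hclopen.eq_univ ⟨L.ψ j x, Set.mem_biUnion (x := j) rfl ⟨x, rfl⟩⟩
  have : L.ψ i x ∈ ⋃ k ∈ {k | c k = c j}, Set.range (L.ψ k) := huniv ▸ Set.mem_univ _
  simp only [Set.mem_iUnion, exists_prop, Set.mem_ofPred_eq] at this
  obtain ⟨k, hk, hx⟩ := this
  exact (hc i k ⟨_, ⟨x, rfl⟩, hx⟩).trans hk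

end Words

section Harmonic

variable {K : Type*} [TopologicalSpace K] {N : ℕ} {L : SelfSimilarStructure K N}
  [Fintype L.V0] {D : Matrix L.V0 L.V0 ℝ} {r : Fin N → ℝ}

lemma IsHarmonicStructure.symm_form (hD : L.IsHarmonicStructure D r) (u v : L.V0 → ℝ) :
    energyForm D u v = energyForm D v u := energyForm_symm hD.symm u v

lemma IsHarmonicStructure.nonneg_form (hD : L.IsHarmonicStructure D r) (u : L.V0 → ℝ) :
    0 ≤ energyForm D u u := by
  rw [energyForm_apply, dotProduct_comm]
  linarith [hD.nonpos u]

lemma IsHarmonicStructure.form0_eq (hD : L.IsHarmonicStructure D r) (u v : K → ℝ) :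
    L.form0 D u v = energyForm D (L.bdry u) (L.bdry v) := by
  rw [hD.symm_form, energyForm_apply, form0, dotProduct_comm, dotProduct_neg]
  rfl

lemma IsHarmonicStructure.form_const_right (hD : L.IsHarmonicStructure D r) (u : L.V0 → ℝ)
    (c : ℝ) : energyForm D u (fun _ => c) = 0 := by
  rw [energyForm_apply, (hD.ker fun _ => c).2 ⟨c, rfl⟩, dotProduct_zero, neg_zero]

lemma IsHarmonicStructure.form_const_left (hD : L.IsHarmonicStructure D r) (u : L.V0 → ℝ)
    (c : ℝ) : energyForm D (fun _ => c) u = 0 := by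
  rw [hD.symm_form, hD.form_const_right]

lemma IsHarmonicStructure.exists_const_of_form_eq_zero (hD : L.IsHarmonicStructure D r)
    {u : L.V0 → ℝ} (h : energyForm D u u = 0) : ∃ c : ℝ, u = fun _ => c := by
  refine (hD.ker u).1 ?_
  have h1 : ∀ v, energyForm D v u = 0 := by
    intro v
    have := form_sq_le hD.symm_form hD.nonneg_form v u
    rw [h, mul_zero] at this
    exact pow_eq_zero_iff two_ne_zero |>.1 (le_antisymm this (sq_nonneg _))
  have h2 := h1 (D.mulVec u)
  rw [energyForm_apply, neg_eq_zero] at h2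
  exact dotProduct_self_eq_zero.1 h2

lemma form_eq_transfer (m : ℕ) (u v : K → ℝ) :
    L.form D r m u v = (transfer r L.compPair)^[m] (fun x => L.form0 D x.1 x.2) (u, v) :=
  sum_words_eq_transfer r (fun x => L.form0 D x.1 x.2) m (u, v)

lemma form_zero (u v : K → ℝ) : L.form D r 0 u v = L.form0 D u v := form_eq_transfer 0 u v

lemma form_succ (m : ℕ) (u v : K → ℝ) :
    L.form D r (m + 1) u v = ∑ i, (r i)⁻¹ * L.form D r m (u ∘ L.ψ i) (v ∘ L.ψ i) := by
  simp only [form_eq_transfer, transfer_iterate_succ]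
  rfl

/-! ### Harmonic extension -/

variable (L D r) in
/-- The form `ℰ⁽¹⁾ - ℰ⁽⁰⁾` on functions on `K`; it is positive semidefinite for a harmonic
structure, and its kernel consists of the functions that are harmonic on `V₁`. -/
noncomputable def gapForm : LinearMap.BilinForm ℝ (K → ℝ) :=
  ∑ i, (r i)⁻¹ • (energyForm D).compl₁₂ (L.bdry ∘ₗ LinearMap.funLeft ℝ ℝ (L.ψ i))
      (L.bdry ∘ₗ LinearMap.funLeft ℝ ℝ (L.ψ i)) - (energyForm D).compl₁₂ L.bdry L.bdry

lemma gapForm_apply (u v : K → ℝ) :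
    L.gapForm D r u v = ∑ i, (r i)⁻¹ * energyForm D (L.bdry (u ∘ L.ψ i)) (L.bdry (v ∘ L.ψ i)) -
      energyForm D (L.bdry u) (L.bdry v) := by
  simp only [gapForm, LinearMap.sub_apply, LinearMap.coe_sum, Finset.sum_apply,
    LinearMap.smul_apply, LinearMap.compl₁₂_apply, smul_eq_mul]
  rfl

namespace IsHarmonicStructure

lemma gapForm_self (hD : L.IsHarmonicStructure D r) (u : K → ℝ) :
    L.gapForm D r u u = L.form D r 1 u u - L.form0 D u u := by
  rw [gapForm_apply, form_succ]
  simp only [form_zero, hD.form0_eq]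

lemma gapForm_symm (hD : L.IsHarmonicStructure D r) (u v : K → ℝ) :
    L.gapForm D r u v = L.gapForm D r v u := by
  rw [gapForm_apply, gapForm_apply, hD.symm_form]
  congr 1
  exact Finset.sum_congr rfl fun i _ => by rw [hD.symm_form]

lemma gapForm_nonneg (hD : L.IsHarmonicStructure D r) (u : K → ℝ) : 0 ≤ L.gapForm D r u u := by
  rw [hD.gapForm_self]
  exact sub_nonneg.2 (hD.le_form u)

lemma gapForm_eq_zero (hD : L.IsHarmonicStructure D r) {v : K → ℝ} (hv : L.gapForm D r v v = 0)
    (u : K → ℝ) : L.gapForm D r u v = 0 := by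
  have := form_sq_le hD.gapForm_symm hD.gapForm_nonneg u v
  rw [hv, mul_zero] at this
  exact pow_eq_zero_iff two_ne_zero |>.1 (le_antisymm this (sq_nonneg _))

/-- A function on `K` whose restriction to `V₁` is harmonic with boundary values `1` at `q` and
`0` elsewhere. -/
noncomputable def basisExt (hD : L.IsHarmonicStructure D r) (q : L.V0) : K → ℝ :=
  (hD.form_attained (Set.indicator {(q : K)} 1)).choose

lemma gapForm_basisExt (hD : L.IsHarmonicStructure D r) (q : L.V0) :
    L.gapForm D r (hD.basisExt q) (hD.basisExt q) = 0 := by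
  have key : ∀ u v : K → ℝ, (∀ p ∈ L.V0, v p = u p) → L.form D r 1 v v = L.form0 D u u →
      L.gapForm D r v v = 0 := by
    intro u v h h'
    have hb : L.bdry v = L.bdry u := by
      funext p
      exact h p p.2
    rw [hD.gapForm_self, h', hD.form0_eq, hD.form0_eq, hb, sub_self]
  have h := (hD.form_attained (Set.indicator {(q : K)} 1)).choose_spec
  exact key _ _ h.1 h.2

/-- Extension of boundary data to functions on `K` that are harmonic on `V₁`. Only the values on
`V₁` matter. -/
noncomputable def ext (hD : L.IsHarmonicStructure D r) : (L.V0 → ℝ) →ₗ[ℝ] (K → ℝ) where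
  toFun u := ∑ q, u q • hD.basisExt q
  map_add' u v := by simp only [Pi.add_apply, add_smul, Finset.sum_add_distrib]
  map_smul' c u := by
    simp only [Pi.smul_apply, smul_assoc, Finset.smul_sum, RingHom.id_apply]

lemma ext_apply (hD : L.IsHarmonicStructure D r) (u : L.V0 → ℝ) :
    hD.ext u = ∑ q, u q • hD.basisExt q := rfl

lemma bdry_ext (hD : L.IsHarmonicStructure D r) (u : L.V0 → ℝ) : L.bdry (hD.ext u) = u := by
  classical
  funext p
  have h : ∀ q : L.V0, hD.basisExt q p = if p = q then 1 else 0 := by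
    intro q
    rw [basisExt, (hD.form_attained (Set.indicator {(q : K)} 1)).choose_spec.1 p p.2]
    simp [Set.indicator_apply, Subtype.ext_iff]
  rw [bdry_apply, ext_apply, Finset.sum_apply]
  simp [h]

lemma gapForm_ext_right (hD : L.IsHarmonicStructure D r) (G : K → ℝ) (u : L.V0 → ℝ) :
    L.gapForm D r G (hD.ext u) = 0 := by
  rw [ext_apply, map_sum]
  refine Finset.sum_eq_zero fun q _ => ?_
  rw [map_smul, hD.gapForm_eq_zero (hD.gapForm_basisExt q), smul_zero]

/-- The harmonic matrix of the cell `i`: it maps boundary data `u` to the boundary data on the cell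
`ψ i (K)` of the harmonic extension of `u`. -/
noncomputable def A (hD : L.IsHarmonicStructure D r) (i : Fin N) : (L.V0 → ℝ) →ₗ[ℝ] (L.V0 → ℝ) :=
  L.bdry ∘ₗ LinearMap.funLeft ℝ ℝ (L.ψ i) ∘ₗ hD.ext

lemma A_apply (hD : L.IsHarmonicStructure D r) (i : Fin N) (u : L.V0 → ℝ) (q : L.V0) :
    hD.A i u q = hD.ext u (L.ψ i q) := rfl

/-- Harmonicity in weak form: the level-one energy of any function against a harmonic function is
its boundary energy. -/
lemma sum_form_A (hD : L.IsHarmonicStructure D r) (G : K → ℝ) (u : L.V0 → ℝ) :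
    ∑ i, (r i)⁻¹ * energyForm D (L.bdry (G ∘ L.ψ i)) (hD.A i u) = energyForm D (L.bdry G) u := by
  have := hD.gapForm_ext_right G u
  rw [gapForm_apply, sub_eq_zero, hD.bdry_ext] at this
  exact this

lemma sum_form_A_A (hD : L.IsHarmonicStructure D r) (u v : L.V0 → ℝ) :
    ∑ i, (r i)⁻¹ * energyForm D (hD.A i u) (hD.A i v) = energyForm D u v := by
  have := hD.sum_form_A (hD.ext u) v
  rwa [hD.bdry_ext] at this

/-- Replacing `v` by `|v|` increases the gap at most by the loss of boundary energy. In particular,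
if the boundary energy does not change, then `|v|` is harmonic along with `v`. -/
lemma gapForm_abs_le (hD : L.IsHarmonicStructure D r) (v : K → ℝ) :
    L.gapForm D r (fun x => |v x|) (fun x => |v x|) ≤ L.gapForm D r v v +
      (energyForm D (L.bdry v) (L.bdry v) -
        energyForm D (L.bdry fun x => |v x|) (L.bdry fun x => |v x|)) := by
  rw [gapForm_apply, gapForm_apply]
  have : ∑ i, (r i)⁻¹ * energyForm D (L.bdry ((fun x => |v x|) ∘ L.ψ i))
      (L.bdry ((fun x => |v x|) ∘ L.ψ i)) ≤
      ∑ i, (r i)⁻¹ * energyForm D (L.bdry (v ∘ L.ψ i)) (L.bdry (v ∘ L.ψ i)) :=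
    Finset.sum_le_sum fun i _ => mul_le_mul_of_nonneg_left
      (energyForm_abs_le hD.offDiag (L.bdry (v ∘ L.ψ i))) (inv_pos.2 (hD.r_pos i)).le
  linarith

variable [CompactSpace K] [T2Space K] [ConnectedSpace K]

/-- Harmonic functions on `V₁` are determined by their boundary values. -/
lemma bdry_comp_eq_of_gapForm_eq_zero (hD : L.IsHarmonicStructure D r)
    (hfix : ∀ p ∈ L.V0, ∃ i, L.ψ i p = p) {v v' : K → ℝ} (hv : L.gapForm D r v v = 0)
    (hv' : L.gapForm D r v' v' = 0) (h : L.bdry v = L.bdry v') (i : Fin N) (q : L.V0) :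
    v (L.ψ i q) = v' (L.ψ i q) := by
  have h0 : ∑ i, (r i)⁻¹ * energyForm D (L.bdry ((v - v') ∘ L.ψ i)) (L.bdry ((v - v') ∘ L.ψ i))
      = 0 := by
    have h1 : L.gapForm D r (v - v') (v - v') = 0 := by
      rw [map_sub, hD.gapForm_eq_zero hv, hD.gapForm_eq_zero hv', sub_zero]
    have h2 : L.bdry (v - v') = 0 := by rw [map_sub, h, sub_self]
    rw [gapForm_apply, h2] at h1
    simpa using h1
  have h1 : ∀ i, energyForm D (L.bdry ((v - v') ∘ L.ψ i)) (L.bdry ((v - v') ∘ L.ψ i)) = 0 := by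
    intro i
    have := (Finset.sum_eq_zero_iff_of_nonneg fun i _ =>
      mul_nonneg (inv_pos.2 (hD.r_pos i)).le (hD.nonneg_form _)).1 h0 i (Finset.mem_univ i)
    exact (mul_eq_zero.1 this).resolve_left (inv_pos.2 (hD.r_pos i)).ne'
  choose c hc using fun i => hD.exists_const_of_form_eq_zero (h1 i)
  have hc' : ∀ i (q : L.V0), (v - v') (L.ψ i q) = c i := fun i q => congrFun (hc i) q
  have hconst := cell_label_const (L := L) c fun j k ⟨x, ⟨y, hy⟩, ⟨z, hz⟩⟩ => by
    by_cases hjk : j = k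
    · rw [hjk]
    · have hy0 : y ∈ L.V0 := L.mem_V0_of_ψ_eq hjk (hy.trans hz.symm)
      have hz0 : z ∈ L.V0 := L.mem_V0_of_ψ_eq (Ne.symm hjk) (hz.trans hy.symm)
      rw [← hc' j ⟨y, hy0⟩, ← hc' k ⟨z, hz0⟩]
      simp only [hy, hz]
  obtain ⟨j, hj⟩ := hfix q q.2
  have h3 : c j = 0 := by
    rw [← hc' j q, hj, Pi.sub_apply, sub_eq_zero]
    exact congrFun h q
  have h4 := hc' i q
  rw [hconst i j, h3, Pi.sub_apply, sub_eq_zero] at h4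
  exact h4

lemma A_eq_of_gapForm_eq_zero (hD : L.IsHarmonicStructure D r)
    (hfix : ∀ p ∈ L.V0, ∃ i, L.ψ i p = p) {v : K → ℝ} (hv : L.gapForm D r v v = 0)
    (i : Fin N) (q : L.V0) : hD.A i (L.bdry v) q = v (L.ψ i q) :=
  hD.bdry_comp_eq_of_gapForm_eq_zero hfix (hD.gapForm_ext_right _ _) hv (hD.bdry_ext _) i q

lemma A_const (hD : L.IsHarmonicStructure D r) (hfix : ∀ p ∈ L.V0, ∃ i, L.ψ i p = p)
    (i : Fin N) (c : ℝ) : hD.A i (fun _ => c) = fun _ => c := by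
  funext q
  refine hD.A_eq_of_gapForm_eq_zero hfix (v := fun _ => c) ?_ i q
  rw [gapForm_apply]
  have h1 : ∀ i, L.bdry ((fun _ : K => c) ∘ L.ψ i) = fun _ => c := fun i => rfl
  have h2 : L.bdry (fun _ : K => c) = fun _ => c := rfl
  simp only [h1, h2, hD.form_const_right, mul_zero, Finset.sum_const_zero, sub_zero]

/-- The weak maximum principle. -/
lemma A_nonneg (hD : L.IsHarmonicStructure D r) (hfix : ∀ p ∈ L.V0, ∃ i, L.ψ i p = p)
    (i : Fin N) {u : L.V0 → ℝ} (hu : ∀ p, 0 ≤ u p) (q : L.V0) : 0 ≤ hD.A i u q := by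
  have hb : L.bdry (fun x => |hD.ext u x|) = u := by
    funext p
    have := congrFun (hD.bdry_ext u) p
    rw [bdry_apply] at this ⊢
    rw [this, abs_of_nonneg (hu p)]
  have h0 : L.gapForm D r (fun x => |hD.ext u x|) (fun x => |hD.ext u x|) = 0 := by
    refine le_antisymm ?_ (hD.gapForm_nonneg _)
    refine (hD.gapForm_abs_le _).trans ?_
    rw [hb, hD.bdry_ext, hD.gapForm_ext_right]
    simp
  have := hD.A_eq_of_gapForm_eq_zero hfix h0 i q
  rw [hb] at this
  rw [this]
  exact abs_nonneg _

/-- If two nonnegative boundary functions have disjoint supports and no energy interaction, then so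
do their harmonic extensions on every cell. -/
lemma A_disjoint (hD : L.IsHarmonicStructure D r) (hfix : ∀ p ∈ L.V0, ∃ i, L.ψ i p = p)
    {a b : L.V0 → ℝ} (ha : ∀ p, 0 ≤ a p) (hb : ∀ p, 0 ≤ b p) (hab : ∀ p, a p * b p = 0)
    (h0 : energyForm D a b = 0) (i : Fin N) :
    (∀ p, hD.A i a p * hD.A i b p = 0) ∧ energyForm D (hD.A i a) (hD.A i b) = 0 := by
  set v : K → ℝ := fun x => |hD.ext (a - b) x| with hv
  have hbd : L.bdry v = a + b := by
    funext p
    have := congrFun (hD.bdry_ext (a - b)) p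
    rw [bdry_apply] at this
    simp only [hv, bdry_apply, this, Pi.sub_apply, Pi.add_apply]
    rcases mul_eq_zero.1 (hab p) with h | h <;> simp [h, abs_of_nonneg (ha p), abs_of_nonneg (hb p)]
  have hgap : L.gapForm D r v v = 0 := by
    refine le_antisymm ?_ (hD.gapForm_nonneg _)
    refine (hD.gapForm_abs_le _).trans ?_
    rw [hbd, hD.bdry_ext, hD.gapForm_ext_right]
    simp only [map_add, map_sub, LinearMap.add_apply, LinearMap.sub_apply, hD.symm_form b a, h0]
    simp
  have hdis : ∀ j p, hD.A j a p * hD.A j b p = 0 := by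
    intro j p
    have h1 := hD.A_eq_of_gapForm_eq_zero hfix hgap j p
    rw [hbd, hv, map_add, Pi.add_apply] at h1
    change _ = |hD.A j (a - b) p| at h1
    rw [map_sub, Pi.sub_apply] at h1
    have h2 : (hD.A j a p + hD.A j b p) ^ 2 = (hD.A j a p - hD.A j b p) ^ 2 := by
      rw [h1, sq_abs]
    linarith
  refine ⟨hdis i, ?_⟩
  have hnp : ∀ j, (r j)⁻¹ * energyForm D (hD.A j a) (hD.A j b) ≤ 0 := fun j =>
    mul_nonpos_of_nonneg_of_nonpos (inv_pos.2 (hD.r_pos j)).le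
      (energyForm_nonpos_of_disjoint hD.offDiag (hD.A_nonneg hfix j ha) (hD.A_nonneg hfix j hb)
        (hdis j))
  have h1 := hD.sum_form_A_A a b
  rw [h0] at h1
  have h2 := (Finset.sum_eq_zero_iff_of_nonpos fun j _ => hnp j).1 h1 i (Finset.mem_univ i)
  exact (mul_eq_zero.1 h2).resolve_left (inv_pos.2 (hD.r_pos i)).ne'

end IsHarmonicStructure

end Harmonic

end SelfSimilarStructure

/-! ### Products of harmonic matrices and the strong maximum principle -/

namespace SelfSimilarStructure

namespace IsHarmonicStructure

variable {K : Type*} [TopologicalSpace K] {N : ℕ} {L : SelfSimilarStructure K N}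
  [Fintype L.V0] {D : Matrix L.V0 L.V0 ℝ} {r : Fin N → ℝ}

/-- The product of the harmonic matrices along a word `w`: it maps boundary data `u` to the boundary
data on the cell `ψ_w(K)` of the harmonic extension of `u`. -/
noncomputable def Aword (hD : L.IsHarmonicStructure D r) :
    List (Fin N) → (L.V0 → ℝ) →ₗ[ℝ] (L.V0 → ℝ)
  | [] => LinearMap.id
  | i :: w => Aword hD w ∘ₗ hD.A i

lemma Aword_nil (hD : L.IsHarmonicStructure D r) (u : L.V0 → ℝ) : hD.Aword [] u = u := rfl

lemma Aword_cons (hD : L.IsHarmonicStructure D r) (i : Fin N) (w : List (Fin N)) (u : L.V0 → ℝ) :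
    hD.Aword (i :: w) u = hD.Aword w (hD.A i u) := rfl

lemma Aword_append (hD : L.IsHarmonicStructure D r) (w w' : List (Fin N)) (u : L.V0 → ℝ) :
    hD.Aword (w ++ w') u = hD.Aword w' (hD.Aword w u) := by
  induction w generalizing u with
  | nil => rfl
  | cons i w ih => rw [List.cons_append, Aword_cons, Aword_cons, ih]

/-- The action of the symbol `i` on a function on `K` together with boundary data. -/
noncomputable def compA (hD : L.IsHarmonicStructure D r) (i : Fin N)
    (x : (K → ℝ) × (L.V0 → ℝ)) : (K → ℝ) × (L.V0 → ℝ) :=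
  (x.1 ∘ L.ψ i, hD.A i x.2)

lemma foldl_compA (hD : L.IsHarmonicStructure D r) (w : List (Fin N)) (G : K → ℝ)
    (u : L.V0 → ℝ) :
    w.foldl (fun y i => hD.compA i y) (G, u) = (G ∘ L.ψword w, hD.Aword w u) := by
  induction w generalizing G u with
  | nil => rfl
  | cons i w ih => rw [List.foldl_cons, compA, ih]; rfl

/-- The graph on `V₀` whose edges are the nonzero entries of `D` is connected: every proper nonempty
subset `Z` has an edge to its complement. -/
lemma exists_adj (hD : L.IsHarmonicStructure D r) {Z : Set L.V0} {z s : L.V0} (hz : z ∈ Z)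
    (hs : s ∉ Z) : ∃ z ∈ Z, ∃ s ∉ Z, D z s ≠ 0 := by
  classical
  by_contra! h
  set u : L.V0 → ℝ := Z.indicator 1 with hu
  have h1 : energyForm D u u = 0 := by
    have h2 : energyForm D u (fun _ => 1) - energyForm D u u = 0 := by
      rw [← map_sub, energyForm_eq_sum, neg_eq_zero]
      refine Finset.sum_eq_zero fun p _ => Finset.sum_eq_zero fun q _ => ?_
      by_cases hp : p ∈ Z
      · by_cases hq : q ∈ Z
        · simp [hu, hq]
        · rw [h p hp q hq]; simp
      · simp [hu, hp]
    rw [hD.form_const_right] at h2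
    linarith
  obtain ⟨c, hc⟩ := hD.exists_const_of_form_eq_zero h1
  have e1 : u z = 1 := by simp [hu, hz]
  have e2 : u s = 0 := by simp [hu, hs]
  rw [hc] at e1 e2
  exact one_ne_zero (e1.symm.trans e2)

lemma Aword_replicate_fixed (hD : L.IsHarmonicStructure D r) {i : Fin N} {p : L.V0}
    (hp : L.ψ i p = p) (m : ℕ) (u : L.V0 → ℝ) : hD.Aword (List.replicate m i) u p = u p := by
  induction m generalizing u with
  | zero => rfl
  | succ m ih =>
    rw [List.replicate_succ, Aword_cons, ih, A_apply, hp]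
    exact congrFun (hD.bdry_ext u) p

/-- On a cell containing a boundary point, the harmonic extension has the prescribed value there. -/
lemma Aword_apply_of_ψword_eq (hD : L.IsHarmonicStructure D r) (hpcf : L.postCritical.Finite)
    (hfix : ∀ p ∈ L.V0, ∃ i, L.ψ i p = p) {w : List (Fin N)} {q z : L.V0}
    (h : L.ψword w q = z) (u : L.V0 → ℝ) : hD.Aword w u q = u z := by
  obtain ⟨i, hi⟩ := hfix z z.2
  obtain ⟨h1, h2⟩ := eq_replicate_of_ψword_eq_fixed hpcf hi w h
  have : q = z := Subtype.ext h2
  rw [h1, this]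
  exact hD.Aword_replicate_fixed hi _ u

/-- The boundary data on the cells of a given level are restrictions of one function. -/
lemma Aword_consistent (hD : L.IsHarmonicStructure D r) (hpcf : L.postCritical.Finite)
    (hfix : ∀ p ∈ L.V0, ∃ i, L.ψ i p = p) {w w' : List (Fin N)} (hlen : w.length = w'.length)
    {q q' : L.V0} (h : L.ψword w q = L.ψword w' q') (u : L.V0 → ℝ) :
    hD.Aword w u q = hD.Aword w' u q' := by
  induction w generalizing w' u with
  | nil =>
    obtain rfl := List.length_eq_zero_iff.1 hlen.symm
    rw [show q = q' from Subtype.ext h]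
  | cons i t ih =>
    cases w' with
    | nil => simp at hlen
    | cons i' t' =>
      by_cases hi : i = i'
      · subst hi
        exact ih (by simpa using hlen) (L.ψ_injective i h) _
      · have h' : L.ψ i (L.ψword t q) = L.ψ i' (L.ψword t' q') := h
        have hy := L.mem_V0_of_ψ_eq hi h'
        have hy' := L.mem_V0_of_ψ_eq (Ne.symm hi) h'.symm
        rw [Aword_cons, Aword_cons,
          hD.Aword_apply_of_ψword_eq hpcf hfix (z := ⟨_, hy⟩) rfl,
          hD.Aword_apply_of_ψword_eq hpcf hfix (z := ⟨_, hy'⟩) rfl, A_apply, A_apply]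
        exact congrArg _ h'

variable [CompactSpace K] [T2Space K] [ConnectedSpace K]

lemma Aword_nonneg (hD : L.IsHarmonicStructure D r) (hfix : ∀ p ∈ L.V0, ∃ i, L.ψ i p = p)
    (w : List (Fin N)) {u : L.V0 → ℝ} (hu : ∀ p, 0 ≤ u p) (q : L.V0) : 0 ≤ hD.Aword w u q := by
  induction w generalizing u with
  | nil => exact hu q
  | cons i w ih => exact ih (hD.A_nonneg hfix i hu)

lemma Aword_const (hD : L.IsHarmonicStructure D r) (hfix : ∀ p ∈ L.V0, ∃ i, L.ψ i p = p)
    (w : List (Fin N)) (c : ℝ) : hD.Aword w (fun _ => c) = fun _ => c := by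
  induction w with
  | nil => rfl
  | cons i w ih => rw [Aword_cons, hD.A_const hfix, ih]

lemma Aword_pos (hD : L.IsHarmonicStructure D r) (hfix : ∀ p ∈ L.V0, ∃ i, L.ψ i p = p)
    (w : List (Fin N)) {u : L.V0 → ℝ} (hu : ∀ p, 0 < u p) (q : L.V0) : 0 < hD.Aword w u q := by
  have : Nonempty L.V0 := ⟨q⟩
  obtain ⟨p, hp⟩ := Finite.exists_min u
  have h := hD.Aword_nonneg hfix w (u := u - fun _ => u p) (fun q => sub_nonneg.2 (hp q)) q
  rw [map_sub, hD.Aword_const hfix, Pi.sub_apply] at h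
  linarith [hu p]

lemma Aword_disjoint (hD : L.IsHarmonicStructure D r) (hfix : ∀ p ∈ L.V0, ∃ i, L.ψ i p = p)
    (w : List (Fin N)) {a b : L.V0 → ℝ} (ha : ∀ p, 0 ≤ a p) (hb : ∀ p, 0 ≤ b p)
    (hab : ∀ p, a p * b p = 0) (h0 : energyForm D a b = 0) :
    (∀ p, hD.Aword w a p * hD.Aword w b p = 0) ∧
      energyForm D (hD.Aword w a) (hD.Aword w b) = 0 := by
  induction w generalizing a b with
  | nil => exact ⟨hab, h0⟩
  | cons i w ih =>
    obtain ⟨h1, h2⟩ := hD.A_disjoint hfix ha hb hab h0 i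
    exact ih (hD.A_nonneg hfix i ha) (hD.A_nonneg hfix i hb) h1 h2

/-- The strong maximum principle: a nonnegative harmonic function that vanishes at a vertex outside
`V₀` vanishes at all neighbours of this vertex. -/
lemma mul_Aword_eq_zero (hD : L.IsHarmonicStructure D r) (hpcf : L.postCritical.Finite)
    (hfix : ∀ p ∈ L.V0, ∃ i, L.ψ i p = p) {u : L.V0 → ℝ} (hu : ∀ p, 0 ≤ u p)
    {w : List (Fin N)} {q : L.V0} (hq : L.ψword w q ∉ L.V0) (h0 : hD.Aword w u q = 0)
    (s : L.V0) : D q s * hD.Aword w u s = 0 := by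
  classical
  -- Testing harmonicity against the indicator of the vertex gives a sum of nonnegative terms with
  -- sum zero.
  set G : K → ℝ := Set.indicator {L.ψword w q} 1 with hG
  let Φ : (K → ℝ) × (L.V0 → ℝ) → ℝ := fun x => -energyForm D (L.bdry x.1) x.2
  have hG0 : ∀ x, 0 ≤ G x := fun x => Set.indicator_nonneg (fun _ _ => zero_le_one) x
  have hdis : ∀ w' : List (Fin N), w'.length = w.length →
      ∀ p, L.bdry (G ∘ L.ψword w') p * hD.Aword w' u p = 0 := by
    intro w' hw' p
    by_cases hp : L.ψword w' p = L.ψword w q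
    · rw [hD.Aword_consistent hpcf hfix hw' hp, h0, mul_zero]
    · simp [hG, hp]
  have hΦ : ∀ w' : List (Fin N), w'.length = w.length →
      0 ≤ Φ (w'.foldl (fun y i => hD.compA i y) (G, u)) := by
    intro w' hw'
    rw [foldl_compA]
    exact neg_nonneg.2 (energyForm_nonpos_of_disjoint hD.offDiag
      (fun p => hG0 (L.ψword w' p)) (hD.Aword_nonneg hfix w' hu) (hdis w' hw'))
  have h1 := transfer_iterate_ge_word hD.r_pos w (G, u) hΦ
  have h2 : (transfer r hD.compA)^[w.length] Φ (G, u) = 0 := by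
    rw [transfer_iterate_eq_self]
    · have : L.bdry G = 0 := by
        funext p
        have : (p : K) ≠ L.ψword w q := fun h => hq (h ▸ p.2)
        simp [hG, this]
      simp [Φ, this]
    · intro x
      have := hD.sum_form_A x.1 x.2
      simp only [Φ, compA, mul_neg, Finset.sum_neg_distrib, this]
  rw [h2] at h1
  have hprod : 0 < (w.map fun i => (r i)⁻¹).prod := by
    refine List.prod_pos ?_
    simp only [List.mem_map, forall_exists_index, and_imp]
    rintro _ i _ rfl
    exact inv_pos.2 (hD.r_pos i)
  have h3 := le_antisymm (nonpos_of_mul_nonpos_right h1 hprod) (hΦ w rfl)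
  rw [foldl_compA, neg_eq_zero] at h3
  have h4 := mul_mul_eq_zero_of_energyForm_eq_zero hD.offDiag (fun p => hG0 (L.ψword w p))
    (hD.Aword_nonneg hfix w hu) (hdis w rfl) h3 q s
  have h5 : G (L.ψword w q) = 1 := by simp [hG]
  rwa [h5, mul_one] at h4

/-! ### Connectedness of the boundary graph -/

/-- If no edge joins `Q` to the rest `R` of `V₀ \ {p}`, then the harmonic extension of the indicator
of `Q` vanishes identically or is positive on every cell that does not contain `p`. -/
lemma Aword_eq_zero_or_pos (hD : L.IsHarmonicStructure D r) (hpcf : L.postCritical.Finite)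
    (hfix : ∀ p ∈ L.V0, ∃ i, L.ψ i p = p) {p : L.V0} {i : Fin N} (hi : L.ψ i p = p)
    {Q : Set L.V0} (hQ : ∀ q ∈ Q, ∀ q' ∉ Q, q' ≠ p → D q q' = 0) {w : List (Fin N)}
    (hw : w ≠ List.replicate w.length i) :
    (∀ q, hD.Aword w (Q.indicator 1) q = 0) ∨ ∀ q, 0 < hD.Aword w (Q.indicator 1) q := by
  classical
  set a : L.V0 → ℝ := Q.indicator 1 with ha
  set b : L.V0 → ℝ := {q | q ∉ Q ∧ q ≠ p}.indicator 1 with hb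
  have ha0 : ∀ q, 0 ≤ a q := fun q => Set.indicator_nonneg (fun _ _ => zero_le_one) q
  have hb0 : ∀ q, 0 ≤ b q := fun q => Set.indicator_nonneg (fun _ _ => zero_le_one) q
  have hab : ∀ q, a q * b q = 0 := by
    intro q
    by_cases hq : q ∈ Q <;> simp [ha, hb, hq]
  have he : energyForm D a b = 0 := by
    rw [energyForm_eq_sum, neg_eq_zero]
    refine Finset.sum_eq_zero fun q _ => Finset.sum_eq_zero fun q' _ => ?_
    by_cases hq : q ∈ Q
    · by_cases hq' : q' ∉ Q ∧ q' ≠ p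
      · rw [hQ q hq q' hq'.1 hq'.2]; simp
      · have : b q' = 0 := Set.indicator_of_notMem (s := {q | q ∉ Q ∧ q ≠ p}) hq' _
        rw [this, mul_zero]
    · have : a q = 0 := Set.indicator_of_notMem hq _
      rw [this]; simp
  obtain ⟨hdis, he'⟩ := hD.Aword_disjoint hfix w ha0 hb0 hab he
  have ha1 := hD.Aword_nonneg hfix w ha0
  have hb1 := hD.Aword_nonneg hfix w hb0
  by_contra! hcon
  obtain ⟨⟨s₀, hs₀⟩, z₀, hz₀⟩ := hcon
  obtain ⟨z, hz, s, hs, hzs⟩ := hD.exists_adj (Z := {q | hD.Aword w a q = 0})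
    (le_antisymm hz₀ (ha1 z₀)) hs₀
  change hD.Aword w a z = 0 at hz
  change ¬ hD.Aword w a s = 0 at hs
  by_cases hV : L.ψword w z ∈ L.V0
  · have hza := hD.Aword_apply_of_ψword_eq hpcf hfix (w := w) (q := z) (z := ⟨_, hV⟩) rfl a
    have hzb := hD.Aword_apply_of_ψword_eq hpcf hfix (w := w) (q := z) (z := ⟨_, hV⟩) rfl b
    by_cases h1 : (⟨_, hV⟩ : L.V0) ∈ Q
    · rw [hz, ha, Set.indicator_of_mem h1] at hza
      exact zero_ne_one hza
    by_cases h2 : (⟨_, hV⟩ : L.V0) = p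
    · exact hw (eq_replicate_of_ψword_eq_fixed hpcf hi w (congrArg Subtype.val h2)).1
    · rw [hb, Set.indicator_of_mem (show _ ∈ {q | q ∉ Q ∧ q ≠ p} from ⟨h1, h2⟩)] at hzb
      have h3 := mul_mul_eq_zero_of_energyForm_eq_zero hD.offDiag ha1 hb1 hdis he' s z
      rw [hzb, Pi.one_apply, mul_one, hD.symm.apply z s] at h3
      exact (mul_ne_zero hzs hs) h3
  · exact (mul_ne_zero hzs hs) (hD.mul_Aword_eq_zero hpcf hfix ha0 hV hz s)

/-- If `K \ {p}` is connected, then so is the graph on `V₀ \ {p}` whose edges are the nonzero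
entries of `D`. -/
lemma boundary_graph_connected (hD : L.IsHarmonicStructure D r) (hpcf : L.postCritical.Finite)
    (hfix : ∀ p ∈ L.V0, ∃ i, L.ψ i p = p) {p : L.V0} (hconn : IsPreconnected ({(p : K)}ᶜ : Set K))
    {Q : Set L.V0} (hpQ : p ∉ Q) (hQ : ∀ q ∈ Q, ∀ q' ∉ Q, q' ≠ p → D q q' = 0)
    (hne : Q.Nonempty) {q₂ : L.V0} (hq₂ : q₂ ≠ p) : q₂ ∈ Q := by
  by_contra hq₂Q
  obtain ⟨q₁, hq₁Q⟩ := hne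
  have hq₁ : q₁ ≠ p := fun h => hpQ (h ▸ hq₁Q)
  obtain ⟨i, hi⟩ := hfix p p.2
  set a : L.V0 → ℝ := Q.indicator 1 with ha
  -- `Pos m` is the union of the level-`m` cells away from `p` on which the extension of `a` is
  -- positive, `Zer m` that of the cells on which it vanishes. Both are closed, increase with `m`,
  -- never meet, and exhaust the complement of the cell `C m` at `p`. As the cells `C m` shrink to
  -- `p`, this separates `K \ {p}` into two disjoint open sets, one with `q₁` and one with `q₂`.
  let Pos : ℕ → Set K := fun m => ⋃ w ∈ {w : List (Fin N) | w.length = m ∧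
    w ≠ List.replicate m i ∧ ∀ q, 0 < hD.Aword w a q}, Set.range (L.ψword w)
  let Zer : ℕ → Set K := fun m => ⋃ w ∈ {w : List (Fin N) | w.length = m ∧
    w ≠ List.replicate m i ∧ ∀ q, hD.Aword w a q = 0}, Set.range (L.ψword w)
  let C : ℕ → Set K := fun m => Set.range (L.ψword (List.replicate m i))
  have hcl : ∀ w : List (Fin N), IsClosed (Set.range (L.ψword w)) := fun w =>
    (isCompact_range (L.ψword_continuous w)).isClosed
  have hfin : ∀ m, {w : List (Fin N) | w.length = m}.Finite := fun m =>
    List.finite_length_eq (Fin N) m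
  have hPos : ∀ m, IsClosed (Pos m) := fun m =>
    ((hfin m).subset fun w hw => hw.1).isClosed_biUnion fun w _ => hcl w
  have hZer : ∀ m, IsClosed (Zer m) := fun m =>
    ((hfin m).subset fun w hw => hw.1).isClosed_biUnion fun w _ => hcl w
  have hmemPos : ∀ m x, x ∈ Pos m ↔ ∃ w : List (Fin N), (w.length = m ∧
      w ≠ List.replicate m i ∧ ∀ q, 0 < hD.Aword w a q) ∧ ∃ y, L.ψword w y = x := by
    intro m x
    simp only [Pos, Set.mem_iUnion, exists_prop, Set.mem_ofPred_eq, Set.mem_range]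
  have hmemZer : ∀ m x, x ∈ Zer m ↔ ∃ w : List (Fin N), (w.length = m ∧
      w ≠ List.replicate m i ∧ ∀ q, hD.Aword w a q = 0) ∧ ∃ y, L.ψword w y = x := by
    intro m x
    simp only [Zer, Set.mem_iUnion, exists_prop, Set.mem_ofPred_eq, Set.mem_range]
  have hcover : ∀ m x, x ∉ C m → x ∈ Pos m ∨ x ∈ Zer m := by
    intro m x hx
    obtain ⟨w, hw, y, rfl⟩ := L.exists_ψword_eq m x
    have hwi : w ≠ List.replicate m i := fun h => hx ⟨y, by rw [h]⟩
    rcases hD.Aword_eq_zero_or_pos hpcf hfix hi hQ (w := w) (by rwa [hw]) with h | h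
    · exact Or.inr ((hmemZer _ _).2 ⟨w, ⟨hw, hwi, h⟩, y, rfl⟩)
    · exact Or.inl ((hmemPos _ _).2 ⟨w, ⟨hw, hwi, h⟩, y, rfl⟩)
  have hdisj : ∀ m x, x ∈ Pos m → x ∈ Zer m → False := by
    intro m x h1 h2
    obtain ⟨w, ⟨hw, -, hpos⟩, y, rfl⟩ := (hmemPos _ _).1 h1
    obtain ⟨w', ⟨hw', -, hzer⟩, y', hy'⟩ := (hmemZer _ _).1 h2
    by_cases hww : w = w'
    · subst hww
      exact (hpos p).ne' (hzer p)
    · have hyV := mem_V0_of_ψword_eq hpcf hfix w w' (hw.trans hw'.symm) hww hy'.symm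
      have hyV' := mem_V0_of_ψword_eq hpcf hfix w' w (hw'.trans hw.symm) (Ne.symm hww) hy'
      have := hD.Aword_consistent hpcf hfix (hw.trans hw'.symm) (q := ⟨y, hyV⟩)
        (q' := ⟨y', hyV'⟩) hy'.symm a
      rw [hzer] at this
      exact (hpos _).ne' this
  have hne' : ∀ {m n : ℕ} {w v : List (Fin N)}, w.length = m → w ≠ List.replicate m i →
      w ++ v ≠ List.replicate n i := by
    intro m n w v hw hwi h
    have := congrArg (List.take m) h
    rw [List.take_left' hw, List.take_replicate] at this
    refine hwi (this.trans ?_)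
    have hl := congrArg List.length h
    simp only [List.length_append, List.length_replicate] at hl
    rw [min_eq_left (by omega)]
  have hPosMono : ∀ m n, m ≤ n → Pos m ⊆ Pos n := by
    intro m n hmn x hx
    obtain ⟨w, ⟨hw, hwi, hpos⟩, y, rfl⟩ := (hmemPos _ _).1 hx
    obtain ⟨v, hv, z, rfl⟩ := L.exists_ψword_eq (n - m) y
    refine (hmemPos _ _).2 ⟨w ++ v, ⟨by simp [hw, hv, hmn], hne' hw hwi, ?_⟩, z, ?_⟩
    · intro q
      rw [Aword_append]
      exact hD.Aword_pos hfix v hpos q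
    · rw [ψword_append]; rfl
  have hZerMono : ∀ m n, m ≤ n → Zer m ⊆ Zer n := by
    intro m n hmn x hx
    obtain ⟨w, ⟨hw, hwi, hzer⟩, y, rfl⟩ := (hmemZer _ _).1 hx
    obtain ⟨v, hv, z, rfl⟩ := L.exists_ψword_eq (n - m) y
    refine (hmemZer _ _).2 ⟨w ++ v, ⟨by simp [hw, hv, hmn], hne' hw hwi, ?_⟩, z, ?_⟩
    · intro q
      rw [Aword_append, show hD.Aword w a = 0 from funext hzer, map_zero]
      rfl
    · rw [ψword_append]; rfl
  have hone : ∀ q : L.V0, q ≠ p → (q : K) ∉ C 1 := by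
    rintro q hq ⟨z, hz⟩
    obtain ⟨j, hj⟩ := hfix q q.2
    have hij : i = j := eq_of_ψ_eq_fixed hpcf hj (z := z) hz
    subst hij
    exact hq (Subtype.ext (L.fixed_point_unique hi hj))
  have hin₁ : (q₁ : K) ∈ Pos 1 := by
    rcases hcover 1 q₁ (hone q₁ hq₁) with h | h
    · exact h
    obtain ⟨w, ⟨hw, -, hz⟩, y, hy⟩ := (hmemZer _ _).1 h
    obtain ⟨j, hj⟩ := hfix q₁ q₁.2
    obtain ⟨-, h2⟩ := eq_replicate_of_ψword_eq_fixed hpcf hj w hy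
    subst h2
    have := hD.Aword_apply_of_ψword_eq hpcf hfix (w := w) hy a
    rw [hz, ha, Set.indicator_of_mem hq₁Q] at this
    exact absurd this zero_ne_one
  have hin₂ : (q₂ : K) ∈ Zer 1 := by
    rcases hcover 1 q₂ (hone q₂ hq₂) with h | h
    · obtain ⟨w, ⟨hw, -, hz⟩, y, hy⟩ := (hmemPos _ _).1 h
      obtain ⟨j, hj⟩ := hfix q₂ q₂.2
      obtain ⟨-, h2⟩ := eq_replicate_of_ψword_eq_fixed hpcf hj w hy
      subst h2
      have := hD.Aword_apply_of_ψword_eq hpcf hfix (w := w) hy a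
      rw [ha, Set.indicator_of_notMem hq₂Q] at this
      exact absurd this (hz q₂).ne'
    · exact h
  have hopen : ∀ F : ℕ → Set K, (∀ m, IsClosed (F m)) → IsOpen (⋃ m, (C m ∪ F m)ᶜ) :=
    fun F hF => isOpen_iUnion fun m => ((hcl _).union (hF m)).isOpen_compl
  have hsub : ({(p : K)}ᶜ : Set K) ⊆ (⋃ m, (C m ∪ Zer m)ᶜ) ∪ ⋃ m, (C m ∪ Pos m)ᶜ := by
    intro x hx
    obtain ⟨m, hm⟩ := L.exists_notMem_range_replicate hi hx
    rcases hcover m x hm with h | h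
    · exact Or.inl (Set.mem_iUnion.2 ⟨m, fun h' => h'.elim hm (hdisj m x h)⟩)
    · exact Or.inr (Set.mem_iUnion.2 ⟨m, fun h' => h'.elim hm fun h'' => hdisj m x h'' h⟩)
  obtain ⟨x, -, hx₁, hx₂⟩ := hconn (⋃ m, (C m ∪ Zer m)ᶜ) (⋃ m, (C m ∪ Pos m)ᶜ)
    (hopen _ hZer) (hopen _ hPos) hsub
    ⟨q₁, fun h => hq₁ (Subtype.ext h), Set.mem_iUnion.2
      ⟨1, fun h' => h'.elim (hone q₁ hq₁) (hdisj 1 _ hin₁)⟩⟩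
    ⟨q₂, fun h => hq₂ (Subtype.ext h), Set.mem_iUnion.2
      ⟨1, fun h' => h'.elim (hone q₂ hq₂) fun h'' => hdisj 1 _ h'' hin₂⟩⟩
  obtain ⟨m, hm⟩ := Set.mem_iUnion.1 hx₁
  obtain ⟨n, hn⟩ := Set.mem_iUnion.1 hx₂
  rw [Set.mem_compl_iff, Set.mem_union, not_or] at hm hn
  have h1 := (hcover m x hm.1).resolve_right hm.2
  have h2 := (hcover n x hn.1).resolve_left hn.2
  exact hdisj (max m n) x (hPosMono _ _ (le_max_left _ _) h1) (hZerMono _ _ (le_max_right _ _) h2)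

end IsHarmonicStructure

end SelfSimilarStructure

/-! ### Asymptotics of the harmonic matrices at a boundary point -/

/-- Doeblin's contraction: if `ρ` is a nonnegative left eigenvector of the matrix `β` for the
eigenvalue `lam` and all rows of `β` are at least `ε ρ`, then on the kernel of `ρ` the matrix
contracts the `ρ`-weighted `ℓ¹` norm by the factor `lam - ε ∑ ρ`. -/
lemma sum_mul_abs_mulVec_le {X : Type*} [Fintype X] {ρ : X → ℝ} {β : Matrix X X ℝ} {lam ε : ℝ}
    (hρ : ∀ q, 0 ≤ ρ q) (hβ : ∀ q', ∑ q, ρ q * β q q' = lam * ρ q')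
    (hε : ∀ q q', ε * ρ q' ≤ β q q') {u : X → ℝ} (hu : ∑ q, ρ q * u q = 0) :
    ∑ q, ρ q * |β.mulVec u q| ≤ (lam - ε * ∑ q, ρ q) * ∑ q, ρ q * |u q| := by
  have h1 : ∀ q, |β.mulVec u q| ≤ ∑ q', (β q q' - ε * ρ q') * |u q'| := by
    intro q
    have e : β.mulVec u q = ∑ q', (β q q' - ε * ρ q') * u q' := by
      simp only [sub_mul, Finset.sum_sub_distrib, mul_assoc]
      rw [← Finset.mul_sum, hu, mul_zero, sub_zero]
      rfl
    rw [e]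
    refine (Finset.abs_sum_le_sum_abs _ _).trans (Finset.sum_le_sum fun q' _ => ?_)
    rw [abs_mul, abs_of_nonneg (sub_nonneg.2 (hε q q'))]
  calc ∑ q, ρ q * |β.mulVec u q|
      ≤ ∑ q, ρ q * ∑ q', (β q q' - ε * ρ q') * |u q'| :=
        Finset.sum_le_sum fun q _ => mul_le_mul_of_nonneg_left (h1 q) (hρ q)
    _ = ∑ q', ∑ q, (ρ q * β q q' - ρ q * (ε * ρ q')) * |u q'| := by
        rw [Finset.sum_comm]
        simp only [Finset.mul_sum]
        exact Finset.sum_congr rfl fun q _ => Finset.sum_congr rfl fun q' _ => by ring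
    _ = ∑ q', (lam - ε * ∑ q, ρ q) * (ρ q' * |u q'|) := by
        refine Finset.sum_congr rfl fun q' _ => ?_
        rw [← Finset.sum_mul, Finset.sum_sub_distrib, hβ, ← Finset.sum_mul]
        ring
    _ = _ := (Finset.mul_sum _ _ _).symm

/-- If moreover the columns of `β` are bounded by multiples of the entries of `ρ`, then the iterates
of `β` on the kernel of `ρ` grow strictly slower than the powers of `lam`. -/
lemma exists_bound_iterate_mulVec {X : Type*} [Fintype X] {ρ : X → ℝ} {β : Matrix X X ℝ}
    {lam ε C : ℝ} (hρ : ∀ q, 0 ≤ ρ q) {q₀ : X} (hq₀ : 0 < ρ q₀)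
    (hβ : ∀ q', ∑ q, ρ q * β q q' = lam * ρ q')
    (hε0 : 0 < ε) (hε : ∀ q q', ε * ρ q' ≤ β q q') (hC : ∀ q q', |β q q'| ≤ C * ρ q')
    {u : X → ℝ} (hu : ∑ q, ρ q * u q = 0) :
    ∃ M θ : ℝ, 0 ≤ θ ∧ θ < lam ∧ ∀ k q, |β.mulVec^[k + 1] u q| ≤ M * θ ^ k := by
  have hR : 0 < ∑ q, ρ q := by
    refine lt_of_lt_of_le hq₀ (Finset.single_le_sum (fun q _ => hρ q) (Finset.mem_univ q₀))
  have hθ : 0 ≤ lam - ε * ∑ q, ρ q := by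
    have h1 : (∑ q, ρ q) * (ε * ρ q₀) ≤ lam * ρ q₀ := by
      rw [← hβ, Finset.sum_mul]
      exact Finset.sum_le_sum fun q _ => mul_le_mul_of_nonneg_left (hε q q₀) (hρ q)
    have h2 : (ε * ∑ q, ρ q) * ρ q₀ ≤ lam * ρ q₀ := by linarith
    linarith [le_of_mul_le_mul_right h2 hq₀]
  have hker : ∀ k, ∑ q, ρ q * β.mulVec^[k] u q = 0 := by
    intro k
    induction k with
    | zero => exact hu
    | succ k ih =>
      rw [Function.iterate_succ_apply']
      simp only [Matrix.mulVec, dotProduct, Finset.mul_sum]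
      rw [Finset.sum_comm]
      simp only [← mul_assoc, ← Finset.sum_mul, hβ]
      simp only [mul_assoc, ← Finset.mul_sum]
      rw [ih, mul_zero]
  have hnorm : ∀ k, ∑ q, ρ q * |β.mulVec^[k] u q| ≤
      (lam - ε * ∑ q, ρ q) ^ k * ∑ q, ρ q * |u q| := by
    intro k
    induction k with
    | zero => simp
    | succ k ih =>
      rw [Function.iterate_succ_apply']
      refine (sum_mul_abs_mulVec_le hρ hβ hε (hker k)).trans ?_
      rw [pow_succ', mul_assoc]
      exact mul_le_mul_of_nonneg_left ih hθ
  have hC0 : 0 ≤ C := by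
    have := (abs_nonneg _).trans (hC q₀ q₀)
    exact nonneg_of_mul_nonneg_left this hq₀
  refine ⟨C * ∑ q, ρ q * |u q|, lam - ε * ∑ q, ρ q, hθ, by nlinarith, fun k q => ?_⟩
  rw [Function.iterate_succ_apply']
  calc |β.mulVec (β.mulVec^[k] u) q|
      ≤ ∑ q', |β q q' * β.mulVec^[k] u q'| := Finset.abs_sum_le_sum_abs _ _
    _ ≤ ∑ q', C * (ρ q' * |β.mulVec^[k] u q'|) := by
        refine Finset.sum_le_sum fun q' _ => ?_
        rw [abs_mul, ← mul_assoc]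
        exact mul_le_mul_of_nonneg_right (hC q q') (abs_nonneg _)
    _ = C * ∑ q', ρ q' * |β.mulVec^[k] u q'| := by rw [Finset.mul_sum]
    _ ≤ C * ((lam - ε * ∑ q, ρ q) ^ k * ∑ q, ρ q * |u q|) :=
        mul_le_mul_of_nonneg_left (hnorm k) hC0
    _ = _ := by ring

lemma abs_energyForm_le {ι : Type*} [Fintype ι] (D : Matrix ι ι ℝ) {a : ι → ℝ} {δ : ℝ}
    (h : ∀ q, |a q| ≤ δ) : energyForm D a a ≤ (∑ p, ∑ q, |D p q|) * δ ^ 2 := by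
  rw [energyForm_eq_sum]
  refine (neg_le_abs _).trans ?_
  rw [Finset.sum_mul]
  refine (Finset.abs_sum_le_sum_abs _ _).trans (Finset.sum_le_sum fun p _ => ?_)
  rw [Finset.sum_mul]
  refine (Finset.abs_sum_le_sum_abs _ _).trans (Finset.sum_le_sum fun q _ => ?_)
  rw [mul_assoc, abs_mul, abs_mul, sq]
  exact mul_le_mul_of_nonneg_left
    (mul_le_mul (h p) (h q) (abs_nonneg _) ((abs_nonneg _).trans (h p))) (abs_nonneg _)

namespace SelfSimilarStructure

lemma exists_replicate_notMem_V0 {K : Type*} [TopologicalSpace K] [T2Space K] {N : ℕ}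
    {L : SelfSimilarStructure K N} [Finite L.V0] {i : Fin N} {p : L.V0} (hi : L.ψ i p = p) :
    ∃ m, ∀ q : K, q ≠ p → L.ψword (List.replicate m i) q ∉ L.V0 := by
  have h : ∀ z : L.V0, z ≠ p → ∀ᶠ m in atTop,
      (z : K) ∉ Set.range (L.ψword (List.replicate m i)) := by
    intro z hz
    obtain ⟨m₀, hm₀⟩ := L.exists_notMem_range_replicate hi (q := z) fun h => hz (Subtype.ext h)
    filter_upwards [eventually_ge_atTop m₀] with m hm hmem
    exact hm₀ (L.range_replicate_antitone i hm hmem)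
  have h' : ∀ᶠ m in atTop, ∀ z : L.V0, z ≠ p →
      (z : K) ∉ Set.range (L.ψword (List.replicate m i)) :=
    eventually_all.2 fun z => by
      by_cases hz : z = p
      · simp [hz]
      · filter_upwards [h z hz] with m hm _ using hm
  obtain ⟨m, hm⟩ := h'.exists
  refine ⟨m, fun q hq hqV => ?_⟩
  by_cases hz : (⟨_, hqV⟩ : L.V0) = p
  · refine hq (L.ψword_injective (List.replicate m i) ?_)
    rw [L.ψword_replicate_fixed hi]
    exact congrArg Subtype.val hz
  · exact hm _ hz ⟨q, rfl⟩

namespace IsHarmonicStructure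

variable {K : Type*} [TopologicalSpace K] {N : ℕ} {L : SelfSimilarStructure K N}
  [Fintype L.V0] {D : Matrix L.V0 L.V0 ℝ} {r : Fin N → ℝ}

open Classical in
lemma form_single_left (p : L.V0) (u : L.V0 → ℝ) :
    energyForm D (Pi.single p 1) u = -D.mulVec u p := by
  rw [energyForm_apply, single_dotProduct, one_mul]

/-- The normal derivative `(Du)(p)` of the harmonic extension is multiplied by `r i` under passage
to the cell `i` that contains `p`. -/
lemma mulVec_A (hD : L.IsHarmonicStructure D r) (hpcf : L.postCritical.Finite) {i : Fin N}
    {p : L.V0} (hi : L.ψ i p = p) (u : L.V0 → ℝ) :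
    D.mulVec (hD.A i u) p = r i * D.mulVec u p := by
  classical
  have h := hD.sum_form_A (Set.indicator {(p : K)} 1) u
  have h1 : L.bdry (Set.indicator {(p : K)} 1) = Pi.single p 1 := by
    funext q
    simp [Pi.single_apply, Subtype.ext_iff]
  have h2 : L.bdry (Set.indicator {(p : K)} 1 ∘ L.ψ i) = Pi.single p 1 := by
    funext q
    have : L.ψ i q = p ↔ q = p := by
      rw [← (L.ψ_injective i).eq_iff.trans Subtype.ext_iff.symm, hi]
    simp [Pi.single_apply, this]
  have h3 : ∀ j, j ≠ i → L.bdry (Set.indicator {(p : K)} 1 ∘ L.ψ j) = 0 := by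
    intro j hj
    funext q
    have : L.ψ j q ≠ p := fun h => hj (eq_of_ψ_eq_fixed hpcf hi h)
    simp [this]
  rw [Finset.sum_eq_single i (fun j _ hj => by rw [h3 j hj]; simp) (by simp), h1, h2,
    form_single_left, form_single_left] at h
  have := (hD.r_pos i).ne'
  field_simp at h
  linarith

lemma mulVec_Aword_replicate (hD : L.IsHarmonicStructure D r) (hpcf : L.postCritical.Finite)
    {i : Fin N} {p : L.V0} (hi : L.ψ i p = p) (m : ℕ) (u : L.V0 → ℝ) :
    D.mulVec (hD.Aword (List.replicate m i) u) p = r i ^ m * D.mulVec u p := by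
  induction m generalizing u with
  | zero => rw [List.replicate_zero, Aword_nil, pow_zero, one_mul]
  | succ m ih => rw [List.replicate_succ, Aword_cons, ih, hD.mulVec_A hpcf hi, pow_succ, mul_assoc]

lemma Aword_replicate_mul (hD : L.IsHarmonicStructure D r) (i : Fin N) (m k : ℕ) (u : L.V0 → ℝ) :
    hD.Aword (List.replicate (k * m) i) u = (hD.Aword (List.replicate m i))^[k] u := by
  induction k with
  | zero => simp [Aword_nil]
  | succ k ih =>
    rw [add_mul, one_mul, List.replicate_add, Aword_append, ih, Function.iterate_succ_apply']

variable [CompactSpace K] [T2Space K] [ConnectedSpace K]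

/-- On `V₀ \ {p}`, the columns of a high power of the harmonic matrix of the cell at `p` vanish or
are positive. -/
lemma exists_column_dichotomy (hD : L.IsHarmonicStructure D r) (hpcf : L.postCritical.Finite)
    (hfix : ∀ p ∈ L.V0, ∃ i, L.ψ i p = p) {p : L.V0} (hconn : IsPreconnected ({(p : K)}ᶜ : Set K))
    {i : Fin N} (hi : L.ψ i p = p) :
    ∃ m, ∀ u : L.V0 → ℝ, (∀ q, 0 ≤ u q) →
      (∀ q, q ≠ p → hD.Aword (List.replicate m i) u q = 0) ∨
      (∀ q, q ≠ p → 0 < hD.Aword (List.replicate m i) u q) := by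
  obtain ⟨m, hm⟩ := exists_replicate_notMem_V0 (L := L) hi
  refine ⟨m, fun u hu => ?_⟩
  set w := List.replicate m i
  by_cases hne : ({q : L.V0 | q ≠ p ∧ hD.Aword w u q = 0} : Set L.V0).Nonempty
  · left
    intro q hq
    refine (hD.boundary_graph_connected hpcf hfix hconn
      (Q := {q : L.V0 | q ≠ p ∧ hD.Aword w u q = 0}) (fun h => h.1 rfl) ?_ hne hq).2
    intro z hz s hs hsp
    have hs' : hD.Aword w u s ≠ 0 := fun h => hs ⟨hsp, h⟩
    have := hD.mul_Aword_eq_zero hpcf hfix hu (w := w) (q := z)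
      (hm z fun h => hz.1 (Subtype.ext h)) hz.2 s
    exact (mul_eq_zero.1 this).resolve_right hs'
  · right
    intro q hq
    refine lt_of_le_of_ne (hD.Aword_nonneg hfix w hu q) fun h => hne ⟨q, hq, h.symm⟩

/-- If the normal derivative of `u` at `p` vanishes (and that of some other function `v` does not),
then the energy of `u` on the cells `ψ_i^m(K)` shrinking to `p` is of smaller order than
`(r i)^(2m)`, at least along multiples of a fixed level. The reason is the Perron-Frobenius property
of the harmonic matrix: modulo constants, `r i` is a simple eigenvalue that dominates all
others. -/
lemma exists_tendsto_energy_replicate (hD : L.IsHarmonicStructure D r)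
    (hpcf : L.postCritical.Finite) (hfix : ∀ p ∈ L.V0, ∃ i, L.ψ i p = p) {p : L.V0}
    (hconn : IsPreconnected ({(p : K)}ᶜ : Set K)) {i : Fin N} (hi : L.ψ i p = p)
    {v : L.V0 → ℝ} (hv : D.mulVec v p ≠ 0) {u : L.V0 → ℝ} (hu : D.mulVec u p = 0) :
    ∃ m, Tendsto (fun k => energyForm D (hD.Aword (List.replicate (k * m) i) u)
      (hD.Aword (List.replicate (k * m) i) u) / (r i ^ (k * m)) ^ 2) atTop (𝓝 0) := by
  classical
  obtain ⟨m, hm⟩ := hD.exists_column_dichotomy hpcf hfix hconn hi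
  refine ⟨m, ?_⟩
  set B := hD.Aword (List.replicate m i) with hB
  have hBp : ∀ u, B u p = u p := fun u => hD.Aword_replicate_fixed hi m u
  have hflux : ∀ u, D.mulVec (B u) p = r i ^ m * D.mulVec u p := fun u =>
    hD.mulVec_Aword_replicate hpcf hi m u
  -- `β` is a power of the harmonic matrix on the functions that vanish at `p`, and the normal
  -- derivative `ρ` is a left eigenvector of `β`.
  let X := {q : L.V0 // q ≠ p}
  let ρ : X → ℝ := fun q => D p q
  let β : Matrix X X ℝ := fun q q' => B (Pi.single (q' : L.V0) 1) q
  have hsum : ∀ u : L.V0 → ℝ, u p = 0 → D.mulVec u p = ∑ q : X, ρ q * u q := by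
    intro u hup
    rw [Matrix.mulVec, dotProduct, Fintype.sum_eq_add_sum_subtype_ne _ p, hup, mul_zero, zero_add]
  have hsingle : ∀ q : X, (Pi.single (q : L.V0) (1 : ℝ) : L.V0 → ℝ) p = 0 := fun q =>
    Pi.single_eq_of_ne q.2.symm _
  have hBβ : ∀ u : L.V0 → ℝ, u p = 0 → ∀ q : X, B u q = β.mulVec (fun q => u q) q := by
    intro u hup q
    have e : u = ∑ q', u q' • (Pi.single q' (1 : ℝ) : L.V0 → ℝ) := by
      simpa using (pi_eq_sum_univ' u)
    conv_lhs => rw [e]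
    rw [map_sum, Finset.sum_apply, Fintype.sum_eq_add_sum_subtype_ne _ p, hup, zero_smul, map_zero,
      Pi.zero_apply, zero_add]
    refine Finset.sum_congr rfl fun q' _ => ?_
    rw [map_smul, Pi.smul_apply, smul_eq_mul, mul_comm]
  have hρ : ∀ q, 0 ≤ ρ q := fun q => hD.offDiag p q q.2.symm
  have hβ : ∀ q', ∑ q, ρ q * β q q' = r i ^ m * ρ q' := by
    intro q'
    have h1 := hflux (Pi.single (q' : L.V0) 1)
    rw [hsum _ (by rw [hBp, hsingle]), Matrix.mulVec_single_one] at h1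
    exact h1
  have hlam : 0 < r i ^ m := pow_pos (hD.r_pos i) m
  have hβ0 : ∀ q q', 0 ≤ β q q' := fun q q' =>
    hD.Aword_nonneg hfix _ (fun s => by
      rw [Pi.single_apply]; split_ifs <;> norm_num) q
  have hdich : ∀ q' : X, (∀ q : X, β q q' = 0) ∨ ∀ q : X, 0 < β q q' := by
    intro q'
    rcases hm (Pi.single (q' : L.V0) 1) (fun s => by
      rw [Pi.single_apply]; split_ifs <;> norm_num) with h | h
    · exact Or.inl fun q => h q q.2
    · exact Or.inr fun q => h q q.2
  obtain ⟨q₀, hq₀⟩ : ∃ q₀ : X, 0 < ρ q₀ := by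
    by_contra! hcon
    have hρ0 : ∀ q, ρ q = 0 := fun q => le_antisymm (hcon q) (hρ q)
    have h1 : D.mulVec (v - fun _ => v p) p = D.mulVec v p := by
      rw [Matrix.mulVec_sub, (hD.ker fun _ => v p).2 ⟨_, rfl⟩, sub_zero]
    rw [hsum _ (by simp)] at h1
    simp only [hρ0, zero_mul, Finset.sum_const_zero] at h1
    exact hv h1.symm
  have hρβ : ∀ q', ρ q' = 0 → ∀ q, β q q' = 0 := by
    intro q' hq'
    refine (hdich q').resolve_right fun h => ?_
    have h1 := hβ q'
    rw [hq', mul_zero] at h1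
    have h2 := (Finset.sum_eq_zero_iff_of_nonneg fun q _ => mul_nonneg (hρ q) (hβ0 q q')).1 h1 q₀
      (Finset.mem_univ _)
    exact (mul_pos hq₀ (h q₀)).ne' h2
  have hβρ : ∀ q q', β q q' = 0 → ρ q' = 0 := by
    intro q q' hq
    have h0 : ∀ q, β q q' = 0 := (hdich q').resolve_right fun h => (h q).ne' hq
    have h1 := hβ q'
    simp only [h0, mul_zero, Finset.sum_const_zero] at h1
    exact (mul_eq_zero.1 h1.symm).resolve_left hlam.ne'
  obtain ⟨ε, hε, hε0⟩ : ∃ ε : ℝ, (∀ q q', ε * ρ q' ≤ β q q') ∧ 0 < ε := by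
    have : ∀ᶠ ε in 𝓝[>] (0 : ℝ), ∀ q q', ε * ρ q' ≤ β q q' := by
      refine eventually_all.2 fun q => eventually_all.2 fun q' => ?_
      rcases (hβ0 q q').eq_or_lt with h | h
      · rw [← h, hβρ q q' h.symm]
        simp
      · have : Tendsto (fun ε : ℝ => ε * ρ q') (𝓝[>] 0) (𝓝 (0 * ρ q')) :=
          (tendsto_id.mul_const _).mono_left nhdsWithin_le_nhds
        rw [zero_mul] at this
        filter_upwards [this.eventually (gt_mem_nhds h)] with ε hε using hε.le
    exact (this.and self_mem_nhdsWithin).exists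
  obtain ⟨C, hC⟩ : ∃ C : ℝ, ∀ q q', |β q q'| ≤ C * ρ q' := by
    have : ∀ᶠ C in atTop, ∀ q q', |β q q'| ≤ C * ρ q' := by
      refine eventually_all.2 fun q => eventually_all.2 fun q' => ?_
      rcases (hρ q').eq_or_lt with h | h
      · rw [← h, hρβ q' h.symm q]
        simp
      · filter_upwards [eventually_ge_atTop (|β q q'| / ρ q')] with C hC
        exact (div_le_iff₀ h).1 hC
    exact this.exists
  set u₀ : L.V0 → ℝ := u - fun _ => u p with hu₀
  have hu₀p : u₀ p = 0 := by simp [hu₀]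
  have hu₀f : ∑ q : X, ρ q * u₀ q = 0 := by
    rw [← hsum u₀ hu₀p, hu₀, Matrix.mulVec_sub, (hD.ker fun _ => u p).2 ⟨_, rfl⟩, sub_zero, hu]
  obtain ⟨M, θ, hθ0, hθ, hM⟩ := exists_bound_iterate_mulVec hρ hq₀ hβ hε0 hε hC hu₀f
  have hiter : ∀ k, (B^[k] u₀ p = 0) ∧ ∀ q : X, B^[k] u₀ q = β.mulVec^[k] (fun q => u₀ q) q := by
    intro k
    induction k with
    | zero => exact ⟨hu₀p, fun q => rfl⟩
    | succ k ih =>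
      simp only [Function.iterate_succ_apply']
      refine ⟨by rw [hBp, ih.1], fun q => ?_⟩
      rw [hBβ _ ih.1]
      congr 1
      exact funext ih.2
  have hM0 : 0 ≤ M := by
    have := (abs_nonneg _).trans (hM 0 q₀)
    simpa using this
  have hbound : ∀ k q, |B^[k + 1] u₀ q| ≤ M * θ ^ k := by
    intro k q
    by_cases hq : q = p
    · rw [hq, (hiter (k + 1)).1, abs_zero]
      positivity
    · rw [(hiter (k + 1)).2 ⟨q, hq⟩]
      exact hM k ⟨q, hq⟩
  have henergy : ∀ k, energyForm D (hD.Aword (List.replicate (k * m) i) u)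
      (hD.Aword (List.replicate (k * m) i) u) = energyForm D (B^[k] u₀) (B^[k] u₀) := by
    intro k
    rw [← hD.Aword_replicate_mul, hu₀, map_sub, hD.Aword_const hfix]
    simp only [map_sub, LinearMap.sub_apply, hD.form_const_right, hD.form_const_left, sub_zero]
  simp only [henergy]
  rw [← tendsto_add_atTop_iff_nat 1]
  have hlim : Tendsto (fun k : ℕ => ((∑ p, ∑ q, |D p q|) * M ^ 2 / (r i ^ m) ^ 2) *
      ((θ / r i ^ m) ^ k) ^ 2) atTop (𝓝 (((∑ p, ∑ q, |D p q|) * M ^ 2 / (r i ^ m) ^ 2) * 0 ^ 2)) :=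
    ((tendsto_pow_atTop_nhds_zero_of_lt_one (div_nonneg hθ0 hlam.le)
      ((div_lt_one hlam).2 hθ)).pow 2).const_mul _
  rw [zero_pow two_ne_zero, mul_zero] at hlim
  refine squeeze_zero (fun k => div_nonneg (hD.nonneg_form _) (sq_nonneg _)) (fun k => ?_) hlim
  rw [div_le_iff₀ (pow_pos (pow_pos (hD.r_pos i) _) 2)]
  refine (abs_energyForm_le D (hbound k)).trans (le_of_eq ?_)
  have : r i ^ m ≠ 0 := hlam.ne'
  rw [add_mul, one_mul, pow_add, mul_comm k m, pow_mul, div_pow, mul_pow, mul_pow]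
  field_simp

/-- It is impossible that on every cell two nonconstant harmonic functions are orthogonal with equal
energies: by `exists_tendsto_energy_replicate`, at a boundary point the pair becomes asymptotically
one-dimensional after a suitable rotation. -/
lemma exists_word_not_proportional (hD : L.IsHarmonicStructure D r) (hpcf : L.postCritical.Finite)
    (hfix : ∀ p ∈ L.V0, ∃ i, L.ψ i p = p)
    (hconn : ∀ p ∈ L.V0, IsPreconnected ({p}ᶜ : Set K)) {u v : L.V0 → ℝ}
    (hu : energyForm D u u = 1) :
    ∃ w, ¬(energyForm D (hD.Aword w u) (hD.Aword w u) =
      energyForm D (hD.Aword w v) (hD.Aword w v) ∧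
      energyForm D (hD.Aword w u) (hD.Aword w v) = 0) := by
  classical
  by_contra! hcon
  obtain ⟨p, hp⟩ : ∃ p, D.mulVec u p ≠ 0 := by
    by_contra! h
    obtain ⟨c, rfl⟩ := (hD.ker u).1 (funext h)
    rw [hD.form_const_right] at hu
    exact zero_ne_one hu
  obtain ⟨i, hi⟩ := hfix p p.2
  set x := D.mulVec u p with hx
  set y := D.mulVec v p with hy
  -- The rotation of the pair `(u, v)` for which the normal derivative of `a` at `p` vanishes.
  set a := y • u - x • v with ha
  set b := x • u + y • v with hb
  have ha0 : D.mulVec a p = 0 := by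
    rw [ha, Matrix.mulVec_sub, Matrix.mulVec_smul, Matrix.mulVec_smul]
    simp only [Pi.sub_apply, Pi.smul_apply, smul_eq_mul, ← hx, ← hy]
    ring
  have hb0 : D.mulVec b p = x ^ 2 + y ^ 2 := by
    rw [hb, Matrix.mulVec_add, Matrix.mulVec_smul, Matrix.mulVec_smul]
    simp only [Pi.add_apply, Pi.smul_apply, smul_eq_mul, ← hx, ← hy]
    ring
  have hpos : 0 < x ^ 2 + y ^ 2 := by positivity
  have hab : ∀ w, energyForm D (hD.Aword w a) (hD.Aword w a) =
      energyForm D (hD.Aword w b) (hD.Aword w b) := by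
    intro w
    obtain ⟨h1, h2⟩ := hcon w
    have h3 := h2
    rw [hD.symm_form] at h3
    simp only [ha, hb, map_sub, map_add, map_smul, LinearMap.sub_apply, LinearMap.add_apply,
      LinearMap.smul_apply, smul_eq_mul, h1, h2, h3]
    ring
  obtain ⟨m, hm⟩ := hD.exists_tendsto_energy_replicate hpcf hfix (hconn p p.2) hi hp ha0
  set E := energyForm D (Pi.single p (1 : ℝ)) (Pi.single p (1 : ℝ))
  have hle : ∀ k : ℕ, (x ^ 2 + y ^ 2) ^ 2 ≤ E *
      (energyForm D (hD.Aword (List.replicate (k * m) i) a)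
        (hD.Aword (List.replicate (k * m) i) a) / (r i ^ (k * m)) ^ 2) := by
    intro k
    have h1 := form_sq_le hD.symm_form hD.nonneg_form (Pi.single p (1 : ℝ))
      (hD.Aword (List.replicate (k * m) i) b)
    rw [form_single_left, hD.mulVec_Aword_replicate hpcf hi, hb0, neg_sq, ← hab] at h1
    have h2 : 0 < (r i ^ (k * m)) ^ 2 := pow_pos (pow_pos (hD.r_pos i) _) 2
    rw [← mul_div_assoc, le_div_iff₀ h2]
    linarith
  have := ge_of_tendsto' (hm.const_mul E) hle
  rw [mul_zero] at this
  exact absurd this (not_le.2 (pow_pos hpos 2))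

end IsHarmonicStructure

end SelfSimilarStructure

/-! ### Areas spanned by two harmonic functions -/

lemma gramArea_le_half_add {a b c : ℝ} (ha : 0 ≤ a) (hb : 0 ≤ b) :
    gramArea a b c ≤ (a + b) / 2 := by
  refine Real.sqrt_le_iff.2 ⟨by positivity, ?_⟩
  nlinarith [sq_nonneg (a - b), sq_nonneg c]

lemma gramArea_lt_half_add {a b c : ℝ} (ha : 0 ≤ a) (hb : 0 ≤ b) (hc : c ^ 2 ≤ a * b)
    (h : ¬(a = b ∧ c = 0)) : gramArea a b c < (a + b) / 2 := by
  refine lt_of_le_of_ne (gramArea_le_half_add ha hb) fun he => h ?_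
  have h3 := Real.sq_sqrt (sub_nonneg.2 hc)
  rw [gramArea] at he
  rw [he] at h3
  have h5 : (a - b) ^ 2 = 0 := by nlinarith [sq_nonneg (a - b), sq_nonneg c]
  have h6 : c ^ 2 = 0 := by nlinarith [sq_nonneg (a - b), sq_nonneg c]
  exact ⟨sub_eq_zero.1 (pow_eq_zero_iff two_ne_zero |>.1 h5), pow_eq_zero_iff two_ne_zero |>.1 h6⟩

namespace SelfSimilarStructure

namespace IsHarmonicStructure

variable {K : Type*} [TopologicalSpace K] {N : ℕ} {L : SelfSimilarStructure K N}
  [Fintype L.V0] {D : Matrix L.V0 L.V0 ℝ} {r : Fin N → ℝ}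

/-- The action of the symbol `i` on a pair of boundary functions. -/
noncomputable def pairA (hD : L.IsHarmonicStructure D r) (i : Fin N)
    (x : (L.V0 → ℝ) × (L.V0 → ℝ)) : (L.V0 → ℝ) × (L.V0 → ℝ) :=
  (hD.A i x.1, hD.A i x.2)

lemma foldl_pairA (hD : L.IsHarmonicStructure D r) (w : List (Fin N))
    (x : (L.V0 → ℝ) × (L.V0 → ℝ)) :
    w.foldl (fun y i => hD.pairA i y) x = (hD.Aword w x.1, hD.Aword w x.2) := by
  induction w generalizing x with
  | nil => rfl
  | cons i w ih => rw [List.foldl_cons, ih]; rfl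

/-- The sum over the words `w` of length `n` of the areas (with respect to the energy of the cell
`ψ_w(K)`) spanned by the harmonic extensions of a pair of boundary functions. -/
noncomputable def areaSum (hD : L.IsHarmonicStructure D r) (n : ℕ)
    (x : (L.V0 → ℝ) × (L.V0 → ℝ)) : ℝ :=
  (transfer r hD.pairA)^[n] (fun y => formArea (energyForm D) y.1 y.2) x

lemma areaSum_zero (hD : L.IsHarmonicStructure D r) (x : (L.V0 → ℝ) × (L.V0 → ℝ)) :
    hD.areaSum 0 x = formArea (energyForm D) x.1 x.2 := rfl

/-- The total area decreases from one level to the next, by superadditivity of areas. -/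
lemma areaSum_succ_le (hD : L.IsHarmonicStructure D r) (n : ℕ) (x : (L.V0 → ℝ) × (L.V0 → ℝ)) :
    hD.areaSum (n + 1) x ≤ hD.areaSum n x := by
  rw [areaSum, Function.iterate_succ_apply]
  refine transfer_iterate_mono hD.r_pos n (fun y => ?_) x
  have hinv := fun i => (inv_pos.2 (hD.r_pos i)).le
  have h := (sum_gramArea_le Finset.univ
    (fun i => (r i)⁻¹ * energyForm D (hD.A i y.1) (hD.A i y.1))
    (fun i => (r i)⁻¹ * energyForm D (hD.A i y.2) (hD.A i y.2))
    (fun i => (r i)⁻¹ * energyForm D (hD.A i y.1) (hD.A i y.2))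
    (fun i => mul_nonneg (hinv i) (hD.nonneg_form _))
    (fun i => mul_nonneg (hinv i) (hD.nonneg_form _)) fun i => by
      have := mul_le_mul_of_nonneg_left
        (form_sq_le hD.symm_form hD.nonneg_form (hD.A i y.1) (hD.A i y.2)) (sq_nonneg (r i)⁻¹)
      linarith).1
  rw [hD.sum_form_A_A, hD.sum_form_A_A, hD.sum_form_A_A] at h
  refine le_trans (le_of_eq ?_) h
  exact Finset.sum_congr rfl fun i _ => (gramArea_smul (hinv i) _ _ _).symm

lemma areaSum_antitone (hD : L.IsHarmonicStructure D r) (x : (L.V0 → ℝ) × (L.V0 → ℝ)) :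
    Antitone fun n => hD.areaSum n x :=
  antitone_nat_of_succ_le fun n => hD.areaSum_succ_le n x

lemma areaSum_nonneg (hD : L.IsHarmonicStructure D r) (n : ℕ) (x : (L.V0 → ℝ) × (L.V0 → ℝ)) :
    0 ≤ hD.areaSum n x :=
  transfer_iterate_nonneg hD.r_pos n (fun _ => gramArea_nonneg _ _ _) x

lemma continuous_areaSum (hD : L.IsHarmonicStructure D r) (n : ℕ) : Continuous (hD.areaSum n) := by
  have hA : ∀ i, Continuous (hD.A i) := fun i => LinearMap.continuous_of_finiteDimensional _
  have hE : ∀ {f g : (L.V0 → ℝ) × (L.V0 → ℝ) → (L.V0 → ℝ)}, Continuous f → Continuous g →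
      Continuous fun x => energyForm D (f x) (g x) := by
    intro f g hf hg
    simp only [energyForm_eq_sum]
    refine (continuous_finsetSum _ fun p _ => continuous_finsetSum _ fun q _ => ?_).neg
    exact (continuous_const.mul ((continuous_apply p).comp hf)).mul ((continuous_apply q).comp hg)
  induction n with
  | zero =>
    exact (((hE continuous_fst continuous_fst).mul (hE continuous_snd continuous_snd)).sub
      ((hE continuous_fst continuous_snd).pow 2)).sqrt
  | succ n ih =>
    have e : hD.areaSum (n + 1) = fun x => ∑ i, (r i)⁻¹ * hD.areaSum n (hD.pairA i x) := by
      funext x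
      exact transfer_iterate_succ n _ x
    rw [e]
    refine continuous_finsetSum _ fun i _ => continuous_const.mul (ih.comp ?_)
    exact ((hA i).comp continuous_fst).prodMk ((hA i).comp continuous_snd)

/-- The total area of a pair of functions of unit energy eventually drops strictly below the bound
`1` that is given by the half trace of the Gram matrix. -/
lemma exists_areaSum_lt_one [CompactSpace K] [T2Space K] [ConnectedSpace K]
    (hD : L.IsHarmonicStructure D r) (hpcf : L.postCritical.Finite)
    (hfix : ∀ p ∈ L.V0, ∃ i, L.ψ i p = p)
    (hconn : ∀ p ∈ L.V0, IsPreconnected ({p}ᶜ : Set K)) {u v : L.V0 → ℝ}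
    (hu : energyForm D u u = 1) (hv : energyForm D v v = 1) :
    ∃ n, hD.areaSum n (u, v) < 1 := by
  obtain ⟨w, hw⟩ := hD.exists_word_not_proportional hpcf hfix hconn hu (v := v)
  refine ⟨w.length, ?_⟩
  -- The half trace has constant sum `1` and dominates the area, strictly on the cell `w`.
  let Φ : (L.V0 → ℝ) × (L.V0 → ℝ) → ℝ := fun y =>
    (1 / 2 : ℝ) * (energyForm D y.1 y.1 + energyForm D y.2 y.2)
  have hΦ : (transfer r hD.pairA)^[w.length] Φ (u, v) = 1 := by
    rw [transfer_iterate_eq_self]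
    · simp only [Φ, hu, hv]
      norm_num
    · intro x
      rw [show Φ x = (1 / 2 : ℝ) * (energyForm D x.1 x.1 + energyForm D x.2 x.2) from rfl,
        ← hD.sum_form_A_A x.1 x.1, ← hD.sum_form_A_A x.2 x.2, ← Finset.sum_add_distrib,
        Finset.mul_sum]
      exact Finset.sum_congr rfl fun i _ => by simp only [Φ, pairA]; ring
  have h1 := transfer_iterate_ge_word (act := hD.pairA)
    (Φ := fun y => Φ y - formArea (energyForm D) y.1 y.2) hD.r_pos w (u, v) fun w' _ => by
      rw [sub_nonneg]
      refine (gramArea_le_half_add (hD.nonneg_form _) (hD.nonneg_form _)).trans (le_of_eq ?_)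
      simp only [Φ]
      ring
  rw [transfer_iterate_sub, hΦ, foldl_pairA] at h1
  have hprod : 0 < (w.map fun i => (r i)⁻¹).prod := by
    refine List.prod_pos ?_
    simp only [List.mem_map, forall_exists_index, and_imp]
    rintro _ i _ rfl
    exact inv_pos.2 (hD.r_pos i)
  have h2 := gramArea_lt_half_add (hD.nonneg_form (hD.Aword w u)) (hD.nonneg_form (hD.Aword w v))
    (form_sq_le hD.symm_form hD.nonneg_form _ _) hw
  have h3 : 0 < Φ (hD.Aword w u, hD.Aword w v) -
      formArea (energyForm D) (hD.Aword w u) (hD.Aword w v) := by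
    rw [sub_pos]
    refine h2.trans_le (le_of_eq ?_)
    simp only [Φ]
    ring
  have h4 := (mul_pos hprod h3).trans_le h1
  exact sub_pos.1 h4

/-- Poincaré inequality: the energy is a norm on the functions that vanish at `p₀`. -/
lemma exists_norm_sq_le (hD : L.IsHarmonicStructure D r) (p₀ : L.V0) :
    ∃ C : ℝ, ∀ u : L.V0 → ℝ, u p₀ = 0 → ‖u‖ ^ 2 ≤ C * energyForm D u u := by
  have hcont : Continuous fun u : L.V0 → ℝ => energyForm D u u := by
    simp only [energyForm_eq_sum]
    fun_prop
  let T : Set (L.V0 → ℝ) := Metric.sphere 0 1 ∩ {u | u p₀ = 0}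
  have hT : IsCompact T := (isCompact_sphere _ _).inter_right
    (isClosed_eq (continuous_apply p₀) continuous_const)
  have hTpos : ∀ u ∈ T, 0 < energyForm D u u := by
    intro u hu
    refine lt_of_le_of_ne (hD.nonneg_form u) fun h => ?_
    obtain ⟨c, rfl⟩ := hD.exists_const_of_form_eq_zero h.symm
    have hc : c = 0 := hu.2
    have := hu.1
    rw [hc, mem_sphere_zero_iff_norm] at this
    have h0 : ‖(fun _ => (0 : ℝ) : L.V0 → ℝ)‖ = 0 := norm_zero
    rw [h0] at this
    exact zero_ne_one this
  obtain ⟨c, hc, hcT⟩ : ∃ c : ℝ, 0 < c ∧ ∀ u ∈ T, c ≤ energyForm D u u := by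
    rcases T.eq_empty_or_nonempty with h | h
    · exact ⟨1, one_pos, fun u hu => by simp [h] at hu⟩
    · obtain ⟨u, hu, hmin⟩ := hT.exists_isMinOn h hcont.continuousOn
      exact ⟨_, hTpos u hu, fun v hv => hmin hv⟩
  refine ⟨c⁻¹, fun u hu => ?_⟩
  by_cases hu0 : u = 0
  · simp [hu0]
  have hn : 0 < ‖u‖ := norm_pos_iff.2 hu0
  have hmem : ‖u‖⁻¹ • u ∈ T := by
    refine ⟨?_, ?_⟩
    · rw [mem_sphere_zero_iff_norm, norm_smul, norm_inv, norm_norm, inv_mul_cancel₀ hn.ne']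
    · change (‖u‖⁻¹ • u) p₀ = 0
      rw [Pi.smul_apply, hu, smul_zero]
  have h1 := hcT _ hmem
  simp only [map_smul, LinearMap.smul_apply, smul_eq_mul] at h1
  rw [inv_mul_eq_div, le_div_iff₀ hc]
  field_simp at h1
  linarith

/-- By compactness of the set of pairs of unit energy, normalized at `p₀`, the strict decrease is
uniform. -/
lemma exists_areaSum_le_const [CompactSpace K] [T2Space K] [ConnectedSpace K]
    (hD : L.IsHarmonicStructure D r) (hpcf : L.postCritical.Finite)
    (hfix : ∀ p ∈ L.V0, ∃ i, L.ψ i p = p)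
    (hconn : ∀ p ∈ L.V0, IsPreconnected ({p}ᶜ : Set K)) (p₀ : L.V0) :
    ∃ n, ∃ κ : ℝ, 0 ≤ κ ∧ κ < 1 ∧ ∀ u v : L.V0 → ℝ, u p₀ = 0 → v p₀ = 0 →
      energyForm D u u = 1 → energyForm D v v = 1 → hD.areaSum n (u, v) ≤ κ := by
  let S : Set ((L.V0 → ℝ) × (L.V0 → ℝ)) := {x | x.1 p₀ = 0 ∧ x.2 p₀ = 0 ∧
    energyForm D x.1 x.1 = 1 ∧ energyForm D x.2 x.2 = 1}
  obtain ⟨C, hC⟩ := hD.exists_norm_sq_le p₀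
  have hS : IsCompact S := by
    refine Metric.isCompact_of_isClosed_isBounded ?_ ?_
    · have h1 : Continuous fun x : (L.V0 → ℝ) × (L.V0 → ℝ) => energyForm D x.1 x.1 := by
        simp only [energyForm_eq_sum]; fun_prop
      have h2 : Continuous fun x : (L.V0 → ℝ) × (L.V0 → ℝ) => energyForm D x.2 x.2 := by
        simp only [energyForm_eq_sum]; fun_prop
      have h3 : Continuous fun x : (L.V0 → ℝ) × (L.V0 → ℝ) => x.1 p₀ := by fun_prop
      have h4 : Continuous fun x : (L.V0 → ℝ) × (L.V0 → ℝ) => x.2 p₀ := by fun_prop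
      exact (isClosed_eq h3 continuous_const).inter ((isClosed_eq h4 continuous_const).inter
        ((isClosed_eq h1 continuous_const).inter (isClosed_eq h2 continuous_const)))
    · refine isBounded_iff_forall_norm_le.2 ⟨√C, fun x hx => ?_⟩
      obtain ⟨h1, h2, h3, h4⟩ := hx
      have e1 := hC x.1 h1
      have e2 := hC x.2 h2
      rw [h3, mul_one] at e1
      rw [h4, mul_one] at e2
      exact max_le (Real.le_sqrt_of_sq_le e1) (Real.le_sqrt_of_sq_le e2)
  obtain ⟨n, hn⟩ := hS.elim_directed_cover (fun n => {x | hD.areaSum n x < 1})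
    (fun n => isOpen_lt (hD.continuous_areaSum n) continuous_const)
    (fun x hx => Set.mem_iUnion.2
      (hD.exists_areaSum_lt_one hpcf hfix hconn (u := x.1) (v := x.2) hx.2.2.1 hx.2.2.2))
    (Monotone.directed_le fun m n hmn x hx => lt_of_le_of_lt (hD.areaSum_antitone x hmn) hx)
  rcases S.eq_empty_or_nonempty with h | h
  · exact ⟨n, 0, le_rfl, one_pos, fun u v h1 h2 h3 h4 =>
      absurd (show (u, v) ∈ S from ⟨h1, h2, h3, h4⟩) (by simp [h])⟩
  · obtain ⟨x, hx, hmax⟩ := hS.exists_isMaxOn h (hD.continuous_areaSum n).continuousOn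
    exact ⟨n, hD.areaSum n x, hD.areaSum_nonneg n x, hn hx, fun u v h1 h2 h3 h4 =>
      hmax (show (u, v) ∈ S from ⟨h1, h2, h3, h4⟩)⟩

/-- Triangular changes of basis (and adding constants) multiply all areas by the determinant. -/
lemma areaSum_triangular [CompactSpace K] [T2Space K] [ConnectedSpace K]
    (hD : L.IsHarmonicStructure D r) (hfix : ∀ p ∈ L.V0, ∃ i, L.ψ i p = p)
    (n : ℕ) (u v : L.V0 → ℝ) {a d : ℝ} (ha : 0 ≤ a) (hd : 0 ≤ d) (b c c' : ℝ) :
    hD.areaSum n (a • u + fun _ => c, b • u + d • v + fun _ => c') =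
      a * d * hD.areaSum n (u, v) := by
  let e : (L.V0 → ℝ) × (L.V0 → ℝ) → (L.V0 → ℝ) × (L.V0 → ℝ) := fun x =>
    (a • x.1 + fun _ => c, b • x.1 + d • x.2 + fun _ => c')
  have he : ∀ i x, e (hD.pairA i x) = hD.pairA i (e x) := by
    intro i x
    simp only [e, pairA, map_add, map_smul, hD.A_const hfix]
  have h1 := transfer_iterate_comp (r := r) he n (fun y => formArea (energyForm D) y.1 y.2) (u, v)
  have h2 : ∀ y, formArea (energyForm D) (e y).1 (e y).2 =
      a * d * formArea (energyForm D) y.1 y.2 := by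
    intro y
    simp only [e, formArea, map_add, map_smul, LinearMap.add_apply, LinearMap.smul_apply,
      smul_eq_mul, hD.form_const_right, hD.form_const_left, hD.symm_form y.2 y.1, add_zero,
      mul_zero]
    rw [← gramArea_smul (mul_nonneg ha hd), gramArea, gramArea]
    congr 1
    ring
  simp only [h2, transfer_iterate_const_mul] at h1
  exact h1.symm

/-- One step of the geometric decay of the total area. -/
lemma exists_areaSum_le_mul [CompactSpace K] [T2Space K] [ConnectedSpace K]
    (hD : L.IsHarmonicStructure D r) (hpcf : L.postCritical.Finite)
    (hfix : ∀ p ∈ L.V0, ∃ i, L.ψ i p = p)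
    (hconn : ∀ p ∈ L.V0, IsPreconnected ({p}ᶜ : Set K)) (p₀ : L.V0) :
    ∃ n, ∃ κ : ℝ, 0 ≤ κ ∧ κ < 1 ∧ ∀ x, hD.areaSum n x ≤ κ * hD.areaSum 0 x := by
  obtain ⟨n, κ, hκ0, hκ1, h⟩ := hD.exists_areaSum_le_const hpcf hfix hconn p₀
  refine ⟨n, κ, hκ0, hκ1, fun ⟨u, v⟩ => ?_⟩
  rcases (hD.areaSum_nonneg 0 (u, v)).eq_or_lt with h0 | h0
  · rw [← h0, mul_zero, h0]
    exact hD.areaSum_antitone _ (Nat.zero_le n)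
  have hdet : 0 < energyForm D u u * energyForm D v v - energyForm D u v ^ 2 :=
    Real.sqrt_pos.1 h0
  have hu : 0 < energyForm D u u := by
    refine lt_of_le_of_ne (hD.nonneg_form u) fun h' => ?_
    rw [← h'] at hdet
    nlinarith [sq_nonneg (energyForm D u v)]
  -- Gram-Schmidt orthonormalization of the pair.
  set E := energyForm D u u with hE
  set s := energyForm D u v / E with hs
  set F := energyForm D v v - energyForm D u v ^ 2 / E with hF
  have hEF : E * F = energyForm D u u * energyForm D v v - energyForm D u v ^ 2 := by
    rw [hF, ← hE, mul_sub, mul_div_cancel₀ _ hu.ne']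
  have hFpos : 0 < F := by
    rw [← hEF] at hdet
    exact pos_of_mul_pos_right hdet hu.le
  have hE1 : (√E)⁻¹ ^ 2 * E = 1 := by
    rw [inv_pow, Real.sq_sqrt hu.le, inv_mul_cancel₀ hu.ne']
  have hF1 : (√F)⁻¹ ^ 2 * F = 1 := by
    rw [inv_pow, Real.sq_sqrt hFpos.le, inv_mul_cancel₀ hFpos.ne']
  have ha : 0 ≤ (√E)⁻¹ := inv_nonneg.2 (Real.sqrt_nonneg _)
  have hd : 0 ≤ (√F)⁻¹ := inv_nonneg.2 (Real.sqrt_nonneg _)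
  have hmain := h ((√E)⁻¹ • u + fun _ => -((√E)⁻¹ * u p₀))
    ((-((√F)⁻¹ * s)) • u + (√F)⁻¹ • v + fun _ => -(-((√F)⁻¹ * s) * u p₀ + (√F)⁻¹ * v p₀))
    (by simp) (by simp)
    (by
      simp only [map_add, map_smul, LinearMap.add_apply, LinearMap.smul_apply, smul_eq_mul,
        hD.form_const_right, hD.form_const_left, add_zero, ← hE]
      linarith)
    (by
      simp only [map_add, map_smul, LinearMap.add_apply, LinearMap.smul_apply, smul_eq_mul,
        hD.form_const_right, hD.form_const_left, add_zero, mul_zero, ← hE, hD.symm_form v u]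
      have hsE : s * E = energyForm D u v := div_mul_cancel₀ _ hu.ne'
      have hF' : F = energyForm D v v - s * energyForm D u v := by rw [hF, hs]; ring
      rw [← hsE] at hF' ⊢
      rw [← hF1, hF']
      ring)
  rw [hD.areaSum_triangular hfix n u v ha hd] at hmain
  have h5 : hD.areaSum 0 (u, v) = √E * √F := by
    rw [← Real.sqrt_mul hu.le, hEF]; rfl
  have h6 : 0 < √E := Real.sqrt_pos.2 hu
  have h7 : 0 < √F := Real.sqrt_pos.2 hFpos
  rw [h5]
  rw [← mul_inv, inv_mul_eq_div, div_le_iff₀ (mul_pos h6 h7)] at hmain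
  exact hmain

/-- The total area spanned on the cells of level `n` by two harmonic functions tends to zero,
uniformly. -/
lemma exists_areaSum_le_eps [CompactSpace K] [T2Space K] [ConnectedSpace K]
    (hD : L.IsHarmonicStructure D r) (hpcf : L.postCritical.Finite)
    (hfix : ∀ p ∈ L.V0, ∃ i, L.ψ i p = p)
    (hconn : ∀ p ∈ L.V0, IsPreconnected ({p}ᶜ : Set K)) (p₀ : L.V0) {ε : ℝ} (hε : 0 < ε) :
    ∃ n, ∀ x, hD.areaSum n x ≤ ε * hD.areaSum 0 x := by
  obtain ⟨n, κ, hκ0, hκ1, h⟩ := hD.exists_areaSum_le_mul hpcf hfix hconn p₀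
  have hk : ∀ k x, hD.areaSum (k * n) x ≤ κ ^ k * hD.areaSum 0 x := by
    intro k
    induction k with
    | zero => intro x; simp
    | succ k ih =>
      intro x
      have e : hD.areaSum ((k + 1) * n) x = (transfer r hD.pairA)^[k * n] (hD.areaSum n) x := by
        rw [areaSum, add_mul, one_mul, Function.iterate_add_apply]
        rfl
      rw [e]
      refine (transfer_iterate_mono hD.r_pos _ h x).trans ?_
      rw [transfer_iterate_const_mul, pow_succ', mul_assoc]
      exact mul_le_mul_of_nonneg_left (ih x) hκ0
  obtain ⟨k, hk'⟩ := exists_pow_lt_of_lt_one hε hκ1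
  exact ⟨k * n, fun x => (hk k x).trans
    (mul_le_mul_of_nonneg_right hk'.le (hD.areaSum_nonneg 0 x))⟩

end IsHarmonicStructure

end SelfSimilarStructure

/-! ### The limit energy -/

namespace SelfSimilarStructure

namespace IsHarmonicStructure

variable {K : Type*} [TopologicalSpace K] {N : ℕ} {L : SelfSimilarStructure K N}
  [Fintype L.V0] {D : Matrix L.V0 L.V0 ℝ} {r : Fin N → ℝ}

lemma form0_nonneg (hD : L.IsHarmonicStructure D r) (f : K → ℝ) : 0 ≤ L.form0 D f f := by
  rw [hD.form0_eq]
  exact hD.nonneg_form _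

lemma form_add_left (hD : L.IsHarmonicStructure D r) (n : ℕ) (f g h : K → ℝ) :
    L.form D r n (f + g) h = L.form D r n f h + L.form D r n g h := by
  simp only [form, hD.form0_eq, ← Finset.sum_add_distrib, ← mul_add]
  refine Finset.sum_congr rfl fun w _ => ?_
  rw [← LinearMap.add_apply, ← map_add, ← map_add]
  rfl

lemma form_smul_left (hD : L.IsHarmonicStructure D r) (n : ℕ) (t : ℝ) (f h : K → ℝ) :
    L.form D r n (t • f) h = t * L.form D r n f h := by
  simp only [form, hD.form0_eq, Finset.mul_sum]
  refine Finset.sum_congr rfl fun w _ => ?_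
  rw [show L.bdry ((t • f) ∘ L.ψword (List.ofFn w)) =
      t • L.bdry (f ∘ L.ψword (List.ofFn w)) from rfl,
    map_smul, LinearMap.smul_apply, smul_eq_mul]
  ring

lemma form_comm (hD : L.IsHarmonicStructure D r) (n : ℕ) (f g : K → ℝ) :
    L.form D r n f g = L.form D r n g f := by
  simp only [form, hD.form0_eq]
  exact Finset.sum_congr rfl fun w _ => by rw [hD.symm_form]

lemma form_add_right (hD : L.IsHarmonicStructure D r) (n : ℕ) (f g h : K → ℝ) :
    L.form D r n f (g + h) = L.form D r n f g + L.form D r n f h := by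
  rw [hD.form_comm, hD.form_add_left, hD.form_comm n g, hD.form_comm n h]

lemma form_smul_right (hD : L.IsHarmonicStructure D r) (n : ℕ) (t : ℝ) (f h : K → ℝ) :
    L.form D r n f (t • h) = t * L.form D r n f h := by
  rw [hD.form_comm, hD.form_smul_left, hD.form_comm]

lemma form_add_smul_self (hD : L.IsHarmonicStructure D r) (n : ℕ) (t : ℝ) (f g : K → ℝ) :
    L.form D r n (f + t • g) (f + t • g) =
      L.form D r n f f + 2 * t * L.form D r n f g + t ^ 2 * L.form D r n g g := by
  rw [hD.form_add_left, hD.form_add_right, hD.form_add_right, hD.form_smul_left, hD.form_smul_left,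
    hD.form_smul_right, hD.form_smul_right, hD.form_comm n g f]
  ring

lemma form_nonneg (hD : L.IsHarmonicStructure D r) (n : ℕ) (f : K → ℝ) : 0 ≤ L.form D r n f f := by
  have hr := hD.r_pos
  exact Finset.sum_nonneg fun w _ => mul_nonneg
    (inv_nonneg.2 (Finset.prod_nonneg fun k _ => (hr _).le)) (hD.form0_nonneg _)

lemma transfer_form0_fst (n : ℕ) (x : (K → ℝ) × (K → ℝ)) :
    (transfer r L.compPair)^[n] (fun y => L.form0 D y.1 y.1) x = L.form D r n x.1 x.1 := by
  rw [form_eq_transfer]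
  exact transfer_iterate_comp (act := L.compPair) (act' := L.compPair) (e := fun y => (y.1, y.1))
    (fun _ _ => rfl) n (fun y => L.form0 D y.1 y.2) x

lemma transfer_form0_snd (n : ℕ) (x : (K → ℝ) × (K → ℝ)) :
    (transfer r L.compPair)^[n] (fun y => L.form0 D y.2 y.2) x = L.form D r n x.2 x.2 := by
  rw [form_eq_transfer]
  exact transfer_iterate_comp (act := L.compPair) (act' := L.compPair) (e := fun y => (y.2, y.2))
    (fun _ _ => rfl) n (fun y => L.form0 D y.1 y.2) x

lemma transfer_form_fst (k n : ℕ) (x : (K → ℝ) × (K → ℝ)) :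
    (transfer r L.compPair)^[k] (fun y => L.form D r n y.1 y.1) x =
      L.form D r (k + n) x.1 x.1 := by
  have h : (fun y : (K → ℝ) × (K → ℝ) => L.form D r n y.1 y.1) =
      (transfer r L.compPair)^[n] fun y => L.form0 D y.1 y.1 :=
    funext fun y => (transfer_form0_fst n y).symm
  rw [← transfer_form0_fst, Function.iterate_add_apply, h]

lemma transfer_form_snd (k n : ℕ) (x : (K → ℝ) × (K → ℝ)) :
    (transfer r L.compPair)^[k] (fun y => L.form D r n y.2 y.2) x =
      L.form D r (k + n) x.2 x.2 := by
  have h : (fun y : (K → ℝ) × (K → ℝ) => L.form D r n y.2 y.2) =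
      (transfer r L.compPair)^[n] fun y => L.form0 D y.2 y.2 :=
    funext fun y => (transfer_form0_snd n y).symm
  rw [← transfer_form0_snd, Function.iterate_add_apply, h]

lemma form_monotone (hD : L.IsHarmonicStructure D r) (f : K → ℝ) :
    Monotone fun n => L.form D r n f f := by
  refine monotone_nat_of_le_succ fun n => ?_
  have h := transfer_iterate_mono (act := L.compPair) hD.r_pos n
    (Φ := fun y => L.form0 D y.1 y.1) (Ψ := fun y => L.form D r 1 y.1 y.1)
    (fun y => hD.le_form y.1) (f, f)
  rwa [transfer_form0_fst, transfer_form_fst] at h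

lemma form0_le_form (hD : L.IsHarmonicStructure D r) (n : ℕ) (f : K → ℝ) :
    L.form0 D f f ≤ L.form D r n f f := by
  rw [← form_zero (r := r)]
  exact hD.form_monotone f (Nat.zero_le n)

lemma tendsto_form_self {f : K → ℝ} (hf : f ∈ L.domain D r) :
    Tendsto (fun n => L.form D r n f f) atTop (𝓝 (L.energy D r f f)) := by
  obtain ⟨-, l, hl⟩ := hf
  rw [energy, hl.limUnder_eq]
  exact hl

lemma form_le_energy (hD : L.IsHarmonicStructure D r) {f : K → ℝ} (hf : f ∈ L.domain D r) (n : ℕ) :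
    L.form D r n f f ≤ L.energy D r f f :=
  (hD.form_monotone f).ge_of_tendsto (tendsto_form_self hf) n

lemma form0_le_energy (hD : L.IsHarmonicStructure D r) {f : K → ℝ} (hf : f ∈ L.domain D r) :
    L.form0 D f f ≤ L.energy D r f f := by
  rw [← form_zero (r := r)]
  exact hD.form_le_energy hf 0

lemma energy_self_nonneg (hD : L.IsHarmonicStructure D r) {f : K → ℝ} (hf : f ∈ L.domain D r) :
    0 ≤ L.energy D r f f := (hD.form0_nonneg f).trans (hD.form0_le_energy hf)

lemma mem_domain_of_le (hD : L.IsHarmonicStructure D r) {f : K → ℝ} (hf : Continuous f) {C : ℝ}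
    (h : ∀ n, L.form D r n f f ≤ C) : f ∈ L.domain D r := by
  refine ⟨hf, _, tendsto_atTop_ciSup (hD.form_monotone f) ⟨C, ?_⟩⟩
  rintro _ ⟨n, rfl⟩
  exact h n

lemma comp_ψ_mem_domain (hD : L.IsHarmonicStructure D r) {f : K → ℝ} (hf : f ∈ L.domain D r)
    (i : Fin N) : f ∘ L.ψ i ∈ L.domain D r := by
  refine hD.mem_domain_of_le (C := r i * L.energy D r f f) (hf.1.comp (L.ψ_continuous i))
    fun n => ?_
  have h1 := hD.form_le_energy hf (n + 1)
  rw [form_succ] at h1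
  have h2 : (r i)⁻¹ * L.form D r n (f ∘ L.ψ i) (f ∘ L.ψ i) ≤ _ :=
    Finset.single_le_sum (f := fun i => (r i)⁻¹ * L.form D r n (f ∘ L.ψ i) (f ∘ L.ψ i))
      (fun j _ => mul_nonneg (inv_pos.2 (hD.r_pos j)).le (hD.form_nonneg n _)) (Finset.mem_univ i)
  exact (inv_mul_le_iff₀ (hD.r_pos i)).1 (h2.trans h1)

lemma comp_ψword_mem_domain (hD : L.IsHarmonicStructure D r) {f : K → ℝ} (hf : f ∈ L.domain D r)
    (w : List (Fin N)) : f ∘ L.ψword w ∈ L.domain D r := by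
  induction w generalizing f with
  | nil => exact hf
  | cons i w ih => exact ih (hD.comp_ψ_mem_domain hf i)

lemma add_smul_mem_domain (hD : L.IsHarmonicStructure D r) {f g : K → ℝ} (hf : f ∈ L.domain D r)
    (hg : g ∈ L.domain D r) (t : ℝ) : f + t • g ∈ L.domain D r := by
  refine hD.mem_domain_of_le (C := 2 * L.energy D r f f + 2 * t ^ 2 * L.energy D r g g)
    (hf.1.add (hg.1.const_smul t)) fun n => ?_
  have h1 := hD.form_add_smul_self n t f g
  have h2 := hD.form_add_smul_self n (-t) f g
  have h3 := hD.form_nonneg n (f + (-t) • g)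
  have h4 := hD.form_le_energy hf n
  have h5 := mul_le_mul_of_nonneg_left (hD.form_le_energy hg n) (sq_nonneg t)
  linarith

lemma add_mem_domain (hD : L.IsHarmonicStructure D r) {f g : K → ℝ} (hf : f ∈ L.domain D r)
    (hg : g ∈ L.domain D r) : f + g ∈ L.domain D r := by
  simpa using hD.add_smul_mem_domain hf hg 1

lemma sub_mem_domain (hD : L.IsHarmonicStructure D r) {f g : K → ℝ} (hf : f ∈ L.domain D r)
    (hg : g ∈ L.domain D r) : f - g ∈ L.domain D r := by
  have := hD.add_smul_mem_domain hf hg (-1)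
  rwa [neg_one_smul, ← sub_eq_add_neg] at this

lemma tendsto_form (hD : L.IsHarmonicStructure D r) {f g : K → ℝ} (hf : f ∈ L.domain D r)
    (hg : g ∈ L.domain D r) :
    Tendsto (fun n => L.form D r n f g) atTop (𝓝 (L.energy D r f g)) := by
  have h : Tendsto (fun n => L.form D r n f g) atTop
      (𝓝 ((L.energy D r (f + (1 : ℝ) • g) (f + (1 : ℝ) • g) - L.energy D r f f -
        L.energy D r g g) / 2)) := by
    refine ((((tendsto_form_self (hD.add_smul_mem_domain hf hg 1)).sub (tendsto_form_self hf)).sub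
      (tendsto_form_self hg)).div_const 2).congr fun n => ?_
    rw [hD.form_add_smul_self]
    ring
  rw [energy, h.limUnder_eq]
  exact h

lemma energy_comm (hD : L.IsHarmonicStructure D r) (f g : K → ℝ) :
    L.energy D r f g = L.energy D r g f := by
  simp only [energy, hD.form_comm _ f g]

lemma energy_add_left (hD : L.IsHarmonicStructure D r) {f g h : K → ℝ} (hf : f ∈ L.domain D r)
    (hg : g ∈ L.domain D r) (hh : h ∈ L.domain D r) :
    L.energy D r (f + g) h = L.energy D r f h + L.energy D r g h := by
  refine tendsto_nhds_unique (hD.tendsto_form (hD.add_mem_domain hf hg) hh)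
    (((hD.tendsto_form hf hh).add (hD.tendsto_form hg hh)).congr fun n => ?_)
  rw [hD.form_add_left]

lemma energy_add_smul_self (hD : L.IsHarmonicStructure D r) {f g : K → ℝ} (hf : f ∈ L.domain D r)
    (hg : g ∈ L.domain D r) (t : ℝ) :
    L.energy D r (f + t • g) (f + t • g) =
      L.energy D r f f + 2 * t * L.energy D r f g + t ^ 2 * L.energy D r g g := by
  refine tendsto_nhds_unique (tendsto_form_self (hD.add_smul_mem_domain hf hg t))
    ((((tendsto_form_self hf).add ((hD.tendsto_form hf hg).const_mul (2 * t))).add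
      ((tendsto_form_self hg).const_mul (t ^ 2))).congr fun n => ?_)
  rw [hD.form_add_smul_self]

lemma energy_eq_sum (hD : L.IsHarmonicStructure D r) {f g : K → ℝ} (hf : f ∈ L.domain D r)
    (hg : g ∈ L.domain D r) :
    L.energy D r f g = ∑ i, (r i)⁻¹ * L.energy D r (f ∘ L.ψ i) (g ∘ L.ψ i) := by
  refine tendsto_nhds_unique ((tendsto_add_atTop_iff_nat 1).2 (hD.tendsto_form hf hg)) ?_
  simp only [form_succ]
  exact tendsto_finsetSum _ fun i _ =>
    (hD.tendsto_form (hD.comp_ψ_mem_domain hf i) (hD.comp_ψ_mem_domain hg i)).const_mul _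

lemma form0_sq_le (hD : L.IsHarmonicStructure D r) (f g : K → ℝ) :
    L.form0 D f g ^ 2 ≤ L.form0 D f f * L.form0 D g g := by
  simp only [hD.form0_eq]
  exact form_sq_le hD.symm_form hD.nonneg_form _ _

/-- The difference of the limit energy and the boundary energy is positive semidefinite and hence
satisfies the Cauchy-Schwarz inequality. -/
lemma energy_sub_form0_sq_le (hD : L.IsHarmonicStructure D r) {f g : K → ℝ}
    (hf : f ∈ L.domain D r) (hg : g ∈ L.domain D r) :
    (L.energy D r f g - L.form0 D f g) ^ 2 ≤
      (L.energy D r f f - L.form0 D f f) * (L.energy D r g g - L.form0 D g g) := by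
  refine sq_le_mul_of_forall_quadratic_nonneg fun t => ?_
  have h1 := hD.form0_le_energy (hD.add_smul_mem_domain hf hg t)
  have h2 := hD.form_add_smul_self 0 t f g
  simp only [form_zero] at h2
  rw [hD.energy_add_smul_self hf hg, h2] at h1
  linarith

/-! ### The total area of the cells tends to zero -/

/-- The action of a symbol on two functions together with two boundary functions. -/
noncomputable def compAPair (hD : L.IsHarmonicStructure D r) (i : Fin N)
    (x : ((K → ℝ) × (L.V0 → ℝ)) × ((K → ℝ) × (L.V0 → ℝ))) :
    ((K → ℝ) × (L.V0 → ℝ)) × ((K → ℝ) × (L.V0 → ℝ)) :=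
  (hD.compA i x.1, hD.compA i x.2)

/-- The energy at level `n` of the difference between `f` and the harmonic function with the same
boundary values. -/
lemma transfer_form_sub (hD : L.IsHarmonicStructure D r) (n : ℕ) (f : K → ℝ) :
    (transfer r hD.compA)^[n]
      (fun y => energyForm D (L.bdry y.1 - y.2) (L.bdry y.1 - y.2)) (f, L.bdry f) =
      L.form D r n f f - L.form0 D f f := by
  have e : (fun y : (K → ℝ) × (L.V0 → ℝ) =>
      energyForm D (L.bdry y.1 - y.2) (L.bdry y.1 - y.2)) = fun y =>
      (L.form0 D y.1 y.1 - 2 * energyForm D (L.bdry y.1) y.2) + energyForm D y.2 y.2 := by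
    funext y
    simp only [map_sub, LinearMap.sub_apply, hD.form0_eq, hD.symm_form y.2 (L.bdry y.1)]
    ring
  rw [e, transfer_iterate_add, transfer_iterate_sub, transfer_iterate_const_mul]
  have h1 : (transfer r hD.compA)^[n] (fun y => L.form0 D y.1 y.1) (f, L.bdry f) =
      L.form D r n f f := by
    rw [form_eq_transfer]
    exact transfer_iterate_comp (act := hD.compA) (act' := L.compPair) (e := fun y => (y.1, y.1))
      (fun _ _ => rfl) n (fun y => L.form0 D y.1 y.2) (f, L.bdry f)
  have h2 : (transfer r hD.compA)^[n] (fun y => energyForm D (L.bdry y.1) y.2) (f, L.bdry f) =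
      energyForm D (L.bdry f) (L.bdry f) :=
    transfer_iterate_eq_self (fun x => hD.sum_form_A x.1 x.2) n _
  have h3 : (transfer r hD.compA)^[n] (fun y => energyForm D y.2 y.2) (f, L.bdry f) =
      energyForm D (L.bdry f) (L.bdry f) :=
    transfer_iterate_eq_self (fun x => hD.sum_form_A_A x.2 x.2) n _
  rw [h1, h2, h3, hD.form0_eq]
  ring

/-- Comparison of the boundary areas of the cells of level `n` with those of harmonic functions. -/
lemma transfer_formArea_le (hD : L.IsHarmonicStructure D r) (n : ℕ) (x : (K → ℝ) × (K → ℝ)) :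
    (transfer r L.compPair)^[n] (fun y => formArea (energyForm D) (L.bdry y.1) (L.bdry y.2)) x ≤
      hD.areaSum n (L.bdry x.1, L.bdry x.2) +
      √(L.form D r n x.1 x.1 - L.form0 D x.1 x.1) * √(L.form D r n x.2 x.2) +
      √(L.form0 D x.1 x.1) * √(L.form D r n x.2 x.2 - L.form0 D x.2 x.2) := by
  obtain ⟨f, g⟩ := x
  let z : ((K → ℝ) × (L.V0 → ℝ)) × ((K → ℝ) × (L.V0 → ℝ)) := ((f, L.bdry f), (g, L.bdry g))
  have hW : (transfer r L.compPair)^[n]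
      (fun y => formArea (energyForm D) (L.bdry y.1) (L.bdry y.2)) (f, g) =
      (transfer r hD.compAPair)^[n]
        (fun y => formArea (energyForm D) (L.bdry y.1.1) (L.bdry y.2.1)) z :=
    (transfer_iterate_comp (act := hD.compAPair) (act' := L.compPair)
      (e := fun y => (y.1.1, y.2.1)) (fun _ _ => rfl) n
      (fun y => formArea (energyForm D) (L.bdry y.1) (L.bdry y.2)) z).symm
  have hA : (transfer r hD.compAPair)^[n]
      (fun y => formArea (energyForm D) y.1.2 y.2.2) z = hD.areaSum n (L.bdry f, L.bdry g) :=
    transfer_iterate_comp (act := hD.compAPair) (act' := hD.pairA)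
      (e := fun y => (y.1.2, y.2.2)) (fun _ _ => rfl) n
      (fun y => formArea (energyForm D) y.1 y.2) z
  have hf : (transfer r hD.compAPair)^[n] (fun y =>
      energyForm D (L.bdry y.1.1 - y.1.2) (L.bdry y.1.1 - y.1.2)) z = _ :=
    (transfer_iterate_comp (act := hD.compAPair) (act' := hD.compA) (e := fun y => y.1)
      (fun _ _ => rfl) n
      (fun y => energyForm D (L.bdry y.1 - y.2) (L.bdry y.1 - y.2)) z).trans
      (hD.transfer_form_sub n f)
  have hg : (transfer r hD.compAPair)^[n] (fun y =>
      energyForm D (L.bdry y.2.1 - y.2.2) (L.bdry y.2.1 - y.2.2)) z = _ :=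
    (transfer_iterate_comp (act := hD.compAPair) (act' := hD.compA) (e := fun y => y.2)
      (fun _ _ => rfl) n
      (fun y => energyForm D (L.bdry y.1 - y.2) (L.bdry y.1 - y.2)) z).trans
      (hD.transfer_form_sub n g)
  have hg' : (transfer r hD.compAPair)^[n] (fun y =>
      energyForm D (L.bdry y.2.1) (L.bdry y.2.1)) z = L.form D r n g g := by
    simp only [form_eq_transfer, hD.form0_eq]
    exact transfer_iterate_comp (act := hD.compAPair) (act' := L.compPair)
      (e := fun y => (y.2.1, y.2.1)) (fun _ _ => rfl) n
      (fun y => energyForm D (L.bdry y.1) (L.bdry y.2)) z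
  have hf' : (transfer r hD.compAPair)^[n] (fun y => energyForm D y.1.2 y.1.2) z =
      L.form0 D f f := by
    rw [hD.form0_eq]
    exact transfer_iterate_eq_self (fun x => hD.sum_form_A_A x.1.2 x.1.2) n z
  have s1 := transfer_iterate_add_sqrt_le (act := hD.compAPair) hD.r_pos n
    (W := fun y => formArea (energyForm D) y.1.2 y.2.2)
    (Φ := fun y => energyForm D (L.bdry y.1.1 - y.1.2) (L.bdry y.1.1 - y.1.2))
    (Ψ := fun y => energyForm D (L.bdry y.2.1) (L.bdry y.2.1))
    (fun y => hD.nonneg_form _) (fun y => hD.nonneg_form _) hA.le hf hg'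
  have s2 := transfer_iterate_add_sqrt_le (act := hD.compAPair) hD.r_pos n
    (Φ := fun y => energyForm D y.1.2 y.1.2)
    (Ψ := fun y => energyForm D (L.bdry y.2.1 - y.2.2) (L.bdry y.2.1 - y.2.2))
    (fun y => hD.nonneg_form _) (fun y => hD.nonneg_form _) s1 hf' hg
  rw [hW]
  have s3 := transfer_iterate_mono (act := hD.compAPair) hD.r_pos n
    (Φ := fun y => formArea (energyForm D) (L.bdry y.1.1) (L.bdry y.2.1))
    (Ψ := fun y => formArea (energyForm D) y.1.2 y.2.2 +
      √(energyForm D (L.bdry y.1.1 - y.1.2) (L.bdry y.1.1 - y.1.2)) *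
        √(energyForm D (L.bdry y.2.1) (L.bdry y.2.1)) +
      √(energyForm D y.1.2 y.1.2) *
        √(energyForm D (L.bdry y.2.1 - y.2.2) (L.bdry y.2.1 - y.2.2)))
    (fun y => formArea_le_add hD.symm_form hD.nonneg_form (L.bdry y.1.1) y.1.2 (L.bdry y.2.1) y.2.2)
    z
  exact le_trans s3 s2

/-- The boundary areas of the cells of level `k + n`, if `n` is so large that the areas of harmonic
functions are contracted by the factor `ε`. -/
lemma transfer_formArea_add_le (hD : L.IsHarmonicStructure D r) {n : ℕ} {ε : ℝ} (hε : 0 ≤ ε)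
    (hn : ∀ x, hD.areaSum n x ≤ ε * hD.areaSum 0 x) (k : ℕ) (f g : K → ℝ) :
    (transfer r L.compPair)^[k + n]
      (fun y => formArea (energyForm D) (L.bdry y.1) (L.bdry y.2)) (f, g) ≤
      ε * (√(L.form D r k f f) * √(L.form D r k g g)) +
      √(L.form D r (k + n) f f - L.form D r k f f) * √(L.form D r (k + n) g g) +
      √(L.form D r k f f) * √(L.form D r (k + n) g g - L.form D r k g g) := by
  rw [Function.iterate_add_apply]
  have h1 : ∀ y, (transfer r L.compPair)^[n]
      (fun y => formArea (energyForm D) (L.bdry y.1) (L.bdry y.2)) y ≤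
      ε * (√(L.form0 D y.1 y.1) * √(L.form0 D y.2 y.2)) +
      √(L.form D r n y.1 y.1 - L.form0 D y.1 y.1) * √(L.form D r n y.2 y.2) +
      √(L.form0 D y.1 y.1) * √(L.form D r n y.2 y.2 - L.form0 D y.2 y.2) := by
    intro y
    refine (hD.transfer_formArea_le n y).trans (add_le_add (add_le_add ?_ le_rfl) le_rfl)
    refine (hn _).trans (mul_le_mul_of_nonneg_left ?_ hε)
    rw [areaSum_zero, hD.form0_eq, hD.form0_eq]
    exact gramArea_le_sqrt_mul_sqrt (hD.nonneg_form _)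
  have e1 : (transfer r L.compPair)^[k]
      (fun y => L.form D r n y.1 y.1 - L.form0 D y.1 y.1) (f, g) =
      L.form D r (k + n) f f - L.form D r k f f := by
    rw [transfer_iterate_sub k (fun y : (K → ℝ) × (K → ℝ) => L.form D r n y.1 y.1)
      (fun y => L.form0 D y.1 y.1),
      transfer_form_fst, transfer_form0_fst]
  have e2 : (transfer r L.compPair)^[k]
      (fun y => L.form D r n y.2 y.2 - L.form0 D y.2 y.2) (f, g) =
      L.form D r (k + n) g g - L.form D r k g g := by
    rw [transfer_iterate_sub k (fun y : (K → ℝ) × (K → ℝ) => L.form D r n y.2 y.2)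
      (fun y => L.form0 D y.2 y.2),
      transfer_form_snd, transfer_form0_snd]
  have e0 : (transfer r L.compPair)^[k]
      (fun y => ε * (√(L.form0 D y.1 y.1) * √(L.form0 D y.2 y.2))) (f, g) ≤
      ε * (√(L.form D r k f f) * √(L.form D r k g g)) := by
    rw [transfer_iterate_const_mul k ε (fun y : (K → ℝ) × (K → ℝ) =>
      √(L.form0 D y.1 y.1) * √(L.form0 D y.2 y.2))]
    refine mul_le_mul_of_nonneg_left ?_ hε
    have h := transfer_iterate_sqrt_mul_sqrt_le (act := L.compPair) hD.r_pos k
      (Φ := fun y => L.form0 D y.1 y.1) (Ψ := fun y => L.form0 D y.2 y.2)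
      (fun y => hD.form0_nonneg _) (fun y => hD.form0_nonneg _) (f, g)
    rwa [transfer_form0_fst, transfer_form0_snd] at h
  have e3 := transfer_iterate_add_sqrt_le (act := L.compPair) hD.r_pos k
    (W := fun y => ε * (√(L.form0 D y.1 y.1) * √(L.form0 D y.2 y.2)))
    (Φ := fun y => L.form D r n y.1 y.1 - L.form0 D y.1 y.1)
    (Ψ := fun y => L.form D r n y.2 y.2)
    (fun y => sub_nonneg.2 (hD.form0_le_form n y.1)) (fun y => hD.form_nonneg n y.2) e0 e1
    (transfer_form_snd k n (f, g))
  have e4 := transfer_iterate_add_sqrt_le (act := L.compPair) hD.r_pos k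
    (Φ := fun y => L.form0 D y.1 y.1)
    (Ψ := fun y => L.form D r n y.2 y.2 - L.form0 D y.2 y.2) (fun y => hD.form0_nonneg y.1)
    (fun y => sub_nonneg.2 (hD.form0_le_form n y.2)) e3 (transfer_form0_fst k (f, g)) e2
  have e5 := transfer_iterate_mono (act := L.compPair) hD.r_pos k h1 (f, g)
  exact le_trans e5 e4

variable (L D r) in
/-- Pairs of functions in the domain of the limit energy. -/
abbrev DomPair : Type _ :=
  {x : (K → ℝ) × (K → ℝ) // x.1 ∈ L.domain D r ∧ x.2 ∈ L.domain D r}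

/-- The action of a symbol on pairs in the domain. -/
def compDom (hD : L.IsHarmonicStructure D r) (i : Fin N) (x : DomPair L D r) : DomPair L D r :=
  ⟨L.compPair i x.1, hD.comp_ψ_mem_domain x.2.1 i, hD.comp_ψ_mem_domain x.2.2 i⟩

lemma transfer_compDom (hD : L.IsHarmonicStructure D r) (n : ℕ) (Φ : (K → ℝ) × (K → ℝ) → ℝ)
    (x : DomPair L D r) :
    (transfer r hD.compDom)^[n] (fun y => Φ y.1) x = (transfer r L.compPair)^[n] Φ x.1 :=
  transfer_iterate_comp (e := Subtype.val) (fun _ _ => rfl) n Φ x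

variable (L D r) in
/-- The area spanned by two functions with respect to the limit energy. -/
noncomputable def energyArea (f g : K → ℝ) : ℝ :=
  gramArea (L.energy D r f f) (L.energy D r g g) (L.energy D r f g)

/-- Comparison of the areas for the limit energy with those for the boundary energy. -/
lemma transfer_energyArea_le (hD : L.IsHarmonicStructure D r) (m : ℕ) {f g : K → ℝ}
    (hf : f ∈ L.domain D r) (hg : g ∈ L.domain D r) :
    (transfer r L.compPair)^[m] (fun y => energyArea L D r y.1 y.2) (f, g) ≤
      (transfer r L.compPair)^[m]
        (fun y => formArea (energyForm D) (L.bdry y.1) (L.bdry y.2)) (f, g) +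
      √(L.form D r m f f) * √(L.energy D r g g - L.form D r m g g) +
      √(L.energy D r f f - L.form D r m f f) * √(L.form D r m g g) +
      √(L.energy D r f f - L.form D r m f f) * √(L.energy D r g g - L.form D r m g g) := by
  let x : DomPair L D r := ⟨(f, g), hf, hg⟩
  have hmono := transfer_iterate_mono (act := hD.compDom) hD.r_pos m
    (Φ := fun y => energyArea L D r y.1.1 y.1.2)
    (Ψ := fun y => formArea (energyForm D) (L.bdry y.1.1) (L.bdry y.1.2) +
      √(L.form0 D y.1.1 y.1.1) * √(L.energy D r y.1.2 y.1.2 - L.form0 D y.1.2 y.1.2) +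
      √(L.energy D r y.1.1 y.1.1 - L.form0 D y.1.1 y.1.1) * √(L.form0 D y.1.2 y.1.2) +
      √(L.energy D r y.1.1 y.1.1 - L.form0 D y.1.1 y.1.1) *
        √(L.energy D r y.1.2 y.1.2 - L.form0 D y.1.2 y.1.2)) (fun y => by
      have := gramArea_add_le_of_small (hD.form0_nonneg y.1.1) (hD.form0_nonneg y.1.2)
        (sub_nonneg.2 (hD.form0_le_energy y.2.1)) (sub_nonneg.2 (hD.form0_le_energy y.2.2))
        (hD.form0_sq_le y.1.1 y.1.2) (hD.energy_sub_form0_sq_le y.2.1 y.2.2)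
      simp only [add_sub_cancel] at this
      refine this.trans (le_of_eq ?_)
      rw [formArea, hD.form0_eq, hD.form0_eq, hD.form0_eq]) x
  have e0 : (transfer r hD.compDom)^[m] (fun y => energyArea L D r y.1.1 y.1.2) x =
      (transfer r L.compPair)^[m] (fun y => energyArea L D r y.1 y.2) (f, g) :=
    hD.transfer_compDom m (fun y => energyArea L D r y.1 y.2) x
  have e1 : (transfer r hD.compDom)^[m]
      (fun y => formArea (energyForm D) (L.bdry y.1.1) (L.bdry y.1.2)) x =
      (transfer r L.compPair)^[m]
        (fun y => formArea (energyForm D) (L.bdry y.1) (L.bdry y.2)) (f, g) :=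
    hD.transfer_compDom m (fun y => formArea (energyForm D) (L.bdry y.1) (L.bdry y.2)) x
  have e2 : (transfer r hD.compDom)^[m] (fun y => L.form0 D y.1.1 y.1.1) x = L.form D r m f f :=
    (hD.transfer_compDom m (fun y => L.form0 D y.1 y.1) x).trans (transfer_form0_fst m _)
  have e3 : (transfer r hD.compDom)^[m] (fun y => L.form0 D y.1.2 y.1.2) x = L.form D r m g g :=
    (hD.transfer_compDom m (fun y => L.form0 D y.2 y.2) x).trans (transfer_form0_snd m _)
  have e4 : (transfer r hD.compDom)^[m]
      (fun y => L.energy D r y.1.1 y.1.1 - L.form0 D y.1.1 y.1.1) x =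
      L.energy D r f f - L.form D r m f f := by
    refine (transfer_iterate_sub (act := hD.compDom) m
      (fun y : DomPair L D r => L.energy D r y.1.1 y.1.1)
      (fun y => L.form0 D y.1.1 y.1.1) x).trans (congrArg₂ (· - ·) ?_ e2)
    have h : ∀ y : DomPair L D r, ∑ i, (r i)⁻¹ * L.energy D r (hD.compDom i y).1.1
        (hD.compDom i y).1.1 = L.energy D r y.1.1 y.1.1 :=
      fun y => (hD.energy_eq_sum y.2.1 y.2.1).symm
    exact transfer_iterate_eq_self (act := hD.compDom)
      (Φ := fun y => L.energy D r y.1.1 y.1.1) h m x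
  have e5 : (transfer r hD.compDom)^[m]
      (fun y => L.energy D r y.1.2 y.1.2 - L.form0 D y.1.2 y.1.2) x =
      L.energy D r g g - L.form D r m g g := by
    refine (transfer_iterate_sub (act := hD.compDom) m
      (fun y : DomPair L D r => L.energy D r y.1.2 y.1.2)
      (fun y => L.form0 D y.1.2 y.1.2) x).trans (congrArg₂ (· - ·) ?_ e3)
    have h : ∀ y : DomPair L D r, ∑ i, (r i)⁻¹ * L.energy D r (hD.compDom i y).1.2
        (hD.compDom i y).1.2 = L.energy D r y.1.2 y.1.2 :=
      fun y => (hD.energy_eq_sum y.2.2 y.2.2).symm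
    exact transfer_iterate_eq_self (act := hD.compDom)
      (Φ := fun y => L.energy D r y.1.2 y.1.2) h m x
  have n1 : ∀ y : DomPair L D r, 0 ≤ L.form0 D y.1.1 y.1.1 := fun y => hD.form0_nonneg _
  have n2 : ∀ y : DomPair L D r, 0 ≤ L.form0 D y.1.2 y.1.2 := fun y => hD.form0_nonneg _
  have n3 : ∀ y : DomPair L D r, 0 ≤ L.energy D r y.1.1 y.1.1 - L.form0 D y.1.1 y.1.1 :=
    fun y => sub_nonneg.2 (hD.form0_le_energy y.2.1)
  have n4 : ∀ y : DomPair L D r, 0 ≤ L.energy D r y.1.2 y.1.2 - L.form0 D y.1.2 y.1.2 :=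
    fun y => sub_nonneg.2 (hD.form0_le_energy y.2.2)
  rw [e0] at hmono
  have s1 := transfer_iterate_add_sqrt_le (act := hD.compDom) hD.r_pos m
    (W := fun y => formArea (energyForm D) (L.bdry y.1.1) (L.bdry y.1.2))
    (Φ := fun y => L.form0 D y.1.1 y.1.1)
    (Ψ := fun y => L.energy D r y.1.2 y.1.2 - L.form0 D y.1.2 y.1.2) n1 n4 e1.le e2 e5
  have s2 := transfer_iterate_add_sqrt_le (act := hD.compDom) hD.r_pos m
    (Φ := fun y => L.energy D r y.1.1 y.1.1 - L.form0 D y.1.1 y.1.1)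
    (Ψ := fun y => L.form0 D y.1.2 y.1.2) n3 n2 s1 e4 e3
  have s3 := transfer_iterate_add_sqrt_le (act := hD.compDom) hD.r_pos m
    (Φ := fun y => L.energy D r y.1.1 y.1.1 - L.form0 D y.1.1 y.1.1)
    (Ψ := fun y => L.energy D r y.1.2 y.1.2 - L.form0 D y.1.2 y.1.2) n3 n4 s2 e4 e5
  exact le_trans hmono s3

/-- The total area spanned by two functions of finite energy on the cells of level `m` becomes
arbitrarily small. This is the analytic core of the one-dimensionality of the energy measures. -/
lemma exists_sum_energyArea_lt [CompactSpace K] [T2Space K] [ConnectedSpace K]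
    (hD : L.IsHarmonicStructure D r) (hpcf : L.postCritical.Finite)
    (hfix : ∀ p ∈ L.V0, ∃ i, L.ψ i p = p)
    (hconn : ∀ p ∈ L.V0, IsPreconnected ({p}ᶜ : Set K)) (hV : L.V0.Nonempty) {f g : K → ℝ}
    (hf : f ∈ L.domain D r) (hg : g ∈ L.domain D r) {δ : ℝ} (hδ : 0 < δ) :
    ∃ m, ∑ w : Fin m → Fin N, (∏ k, r (w k))⁻¹ *
      energyArea L D r (f ∘ L.ψword (List.ofFn w)) (g ∘ L.ψword (List.ofFn w)) < δ := by
  obtain ⟨p₀, hp₀⟩ := hV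
  set c := √(L.energy D r f f) * √(L.energy D r g g) with hc
  have hc0 : 0 ≤ c := by positivity
  set ε := δ / (c + 1) with hε
  have hε0 : 0 < ε := by positivity
  have hεc : ε * c < δ := by
    rw [hε, div_mul_eq_mul_div, div_lt_iff₀ (by positivity)]
    nlinarith
  obtain ⟨n, hn⟩ := hD.exists_areaSum_le_eps hpcf hfix hconn ⟨p₀, hp₀⟩ hε0
  have ff := tendsto_form_self hf
  have fg := tendsto_form_self hg
  have ff' := (tendsto_add_atTop_iff_nat n).2 ff
  have fg' := (tendsto_add_atTop_iff_nat n).2 fg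
  have hsq : ∀ {u : ℕ → ℝ} {a : ℝ}, Tendsto u atTop (𝓝 a) →
      Tendsto (fun k => √(u k)) atTop (𝓝 √a) := fun h => (Real.continuous_sqrt.tendsto _).comp h
  have hlim : Tendsto (fun k =>
      (ε * (√(L.form D r k f f) * √(L.form D r k g g)) +
      √(L.form D r (k + n) f f - L.form D r k f f) * √(L.form D r (k + n) g g) +
      √(L.form D r k f f) * √(L.form D r (k + n) g g - L.form D r k g g)) +
      √(L.form D r (k + n) f f) * √(L.energy D r g g - L.form D r (k + n) g g) +
      √(L.energy D r f f - L.form D r (k + n) f f) * √(L.form D r (k + n) g g) +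
      √(L.energy D r f f - L.form D r (k + n) f f) *
        √(L.energy D r g g - L.form D r (k + n) g g)) atTop (𝓝 (ε * c)) := by
    have h := ((((((hsq ff).mul (hsq fg)).const_mul ε).add
      ((hsq (ff'.sub ff)).mul (hsq fg'))).add ((hsq ff).mul (hsq (fg'.sub fg)))).add
      ((hsq ff').mul (hsq (fg'.const_sub (L.energy D r g g))))).add
      ((hsq (ff'.const_sub (L.energy D r f f))).mul (hsq fg')) |>.add
      ((hsq (ff'.const_sub (L.energy D r f f))).mul (hsq (fg'.const_sub (L.energy D r g g))))
    simp only [sub_self, Real.sqrt_zero, zero_mul, mul_zero, add_zero] at h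
    exact h
  obtain ⟨k, hk⟩ := (hlim.eventually (gt_mem_nhds hεc)).exists
  refine ⟨k + n, lt_of_le_of_lt ?_ hk⟩
  rw [sum_words_eq_transfer r (fun y => energyArea L D r y.1 y.2) (k + n) (f, g)]
  refine (hD.transfer_energyArea_le (k + n) hf hg).trans ?_
  gcongr
  exact hD.transfer_formArea_add_le hε0.le hn k f g

end IsHarmonicStructure

end SelfSimilarStructure

/-! ### Measures on the sequence space with given values on cylinders -/

section Cylinders

open scoped NNReal ENNReal BoundedContinuousFunction

variable {N : ℕ}

/-- The set of all sequences that begin with the word `w`. -/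
def wordCylinder {m : ℕ} (w : Fin m → Fin N) : Set (ℕ → Fin N) := {ω | ∀ k : Fin m, ω k = w k}

lemma mem_wordCylinder {m : ℕ} {w : Fin m → Fin N} {ω : ℕ → Fin N} :
    ω ∈ wordCylinder w ↔ (fun k : Fin m => ω k) = w := by
  rw [funext_iff]; rfl

lemma wordCylinder_eq_preimage {m : ℕ} (w : Fin m → Fin N) :
    wordCylinder w = (fun (ω : ℕ → Fin N) (k : Fin m) => ω k) ⁻¹' {w} :=
  Set.ext fun _ => mem_wordCylinder

lemma isClopen_wordCylinder {m : ℕ} (w : Fin m → Fin N) : IsClopen (wordCylinder w) := by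
  rw [wordCylinder_eq_preimage]
  exact (isClopen_discrete _).preimage (continuous_pi fun k => continuous_apply _)

lemma measurableSet_wordCylinder {m : ℕ} (w : Fin m → Fin N) : MeasurableSet (wordCylinder w) := by
  rw [wordCylinder_eq_preimage]
  exact (measurableSet_singleton w).preimage
    (measurable_pi_lambda _ fun k => measurable_pi_apply _)

lemma wordCylinder_zero (w : Fin 0 → Fin N) : wordCylinder w = Set.univ :=
  Set.eq_univ_of_forall fun _ k => k.elim0

lemma iUnion_wordCylinder (m : ℕ) :
    ⋃ w : Fin m → Fin N, wordCylinder w = Set.univ :=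
  Set.eq_univ_of_forall fun ω => Set.mem_iUnion.2 ⟨fun k => ω k, fun _ => rfl⟩

lemma pairwise_disjoint_wordCylinder (m : ℕ) :
    Pairwise (Function.onFun Disjoint fun w : Fin m → Fin N => wordCylinder w) := by
  intro w w' h
  refine Set.disjoint_left.2 fun ω h1 h2 => h ?_
  rw [← mem_wordCylinder.1 h1, mem_wordCylinder.1 h2]

/-- The cylinders, together with the empty set. -/
def wordCylinders (N : ℕ) : Set (Set (ℕ → Fin N)) :=
  insert ∅ {A | ∃ (m : ℕ) (w : Fin m → Fin N), A = wordCylinder w}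

/-- Two cylinders are disjoint or nested. -/
lemma wordCylinder_inter {m n : ℕ} (hmn : m ≤ n) (w : Fin m → Fin N) (v : Fin n → Fin N) :
    wordCylinder w ∩ wordCylinder v = ∅ ∨ wordCylinder w ∩ wordCylinder v = wordCylinder v := by
  by_cases h : ∀ k : Fin m, v (Fin.castLE hmn k) = w k
  · refine Or.inr (Set.inter_eq_right.2 fun ω hω k => ?_)
    rw [← h k, ← hω (Fin.castLE hmn k)]
    rfl
  · refine Or.inl (Set.eq_empty_of_forall_notMem fun ω hω => h fun k => ?_)
    rw [← hω.1 k, ← hω.2 (Fin.castLE hmn k)]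
    rfl

lemma isPiSystem_wordCylinders : IsPiSystem (wordCylinders N) := by
  rintro A (rfl | ⟨m, w, rfl⟩) B (rfl | ⟨n, v, rfl⟩) -
  · exact Or.inl (Set.inter_self _)
  · exact Or.inl (Set.empty_inter _)
  · exact Or.inl (Set.inter_empty _)
  · rcases le_total m n with h | h
    · exact (wordCylinder_inter h w v).imp id fun h => ⟨n, v, h⟩
    · rw [Set.inter_comm]
      exact (wordCylinder_inter h v w).imp id fun h => ⟨m, w, h⟩

lemma generateFrom_wordCylinders :
    (MeasurableSpace.pi : MeasurableSpace (ℕ → Fin N)) =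
      MeasurableSpace.generateFrom (wordCylinders N) := by
  refine le_antisymm ?_ (MeasurableSpace.generateFrom_le ?_)
  · refine iSup_le fun n => ?_
    rintro _ ⟨s, -, rfl⟩
    have : (fun ω : ℕ → Fin N => ω n) ⁻¹' s =
        ⋃ w : {w : Fin (n + 1) → Fin N // w (Fin.last n) ∈ s}, wordCylinder w.1 := by
      ext ω
      simp only [Set.mem_preimage, Set.mem_iUnion]
      refine ⟨fun h => ⟨⟨fun k => ω k, h⟩, fun _ => rfl⟩, ?_⟩
      rintro ⟨⟨w, hw⟩, h⟩
      have := h (Fin.last n)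
      simp only [Fin.val_last] at this
      rwa [this]
    rw [this]
    exact MeasurableSet.iUnion fun w =>
      MeasurableSpace.measurableSet_generateFrom (Or.inr ⟨_, _, rfl⟩)
  · rintro A (rfl | ⟨m, w, rfl⟩)
    · exact MeasurableSet.empty
    · exact measurableSet_wordCylinder w

/-- A finite signed measure on the sequence space is determined by its values on cylinders. -/
lemma signedMeasure_ext_wordCylinder {μ ν : SignedMeasure (ℕ → Fin N)}
    (h : ∀ (m : ℕ) (w : Fin m → Fin N), μ (wordCylinder w) = ν (wordCylinder w)) : μ = ν := by
  refine VectorMeasure.ext_of_generateFrom (wordCylinders N) ?_ generateFrom_wordCylinders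
    isPiSystem_wordCylinders ?_
  · rintro A (rfl | ⟨m, w, rfl⟩)
    · simp
    · exact h m w
  · rw [← wordCylinder_zero (fun k : Fin 0 => k.elim0)]
    exact h 0 _

/-- The extension of a finite word by the constant sequence `a`. -/
def extendWord (a : Fin N) {m : ℕ} (w : Fin m → Fin N) (k : ℕ) : Fin N :=
  if h : k < m then w ⟨k, h⟩ else a

lemma extendWord_mem_wordCylinder_iff (a : Fin N) {m : ℕ} (w v : Fin m → Fin N) :
    extendWord a w ∈ wordCylinder v ↔ w = v := by
  rw [mem_wordCylinder]
  simp [extendWord]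

lemma extendWord_snoc_mem_wordCylinder_iff (a : Fin N) {m n : ℕ} (hmn : m ≤ n) (w : Fin n → Fin N)
    (i : Fin N) (v : Fin m → Fin N) :
    extendWord a (Fin.snoc w i : Fin (n + 1) → Fin N) ∈ wordCylinder v ↔
      extendWord a w ∈ wordCylinder v := by
  refine forall_congr' fun k => ?_
  have h : (k : ℕ) < n := k.2.trans_le hmn
  have h' : (k : ℕ) < n + 1 := h.trans n.lt_succ_self
  simp [extendWord, Fin.snoc, h, h']

/-- The sum of point masses, one for each word of length `n`, with the given weights. -/
noncomputable def levelMeasure (a : Fin N) (c : ∀ m, (Fin m → Fin N) → ℝ≥0) (n : ℕ) :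
    Measure (ℕ → Fin N) :=
  ∑ w : Fin n → Fin N, (c n w : ℝ≥0∞) • Measure.dirac (extendWord a w)

lemma levelMeasure_apply (a : Fin N) (c : ∀ m, (Fin m → Fin N) → ℝ≥0) (n : ℕ) {m : ℕ}
    (v : Fin m → Fin N) : levelMeasure a c n (wordCylinder v) =
      ∑ w : Fin n → Fin N, (c n w : ℝ≥0∞) * (wordCylinder v).indicator 1 (extendWord a w) := by
  simp only [levelMeasure, Measure.finsetSum_apply, Measure.smul_apply, smul_eq_mul,
    Measure.dirac_apply' _ (measurableSet_wordCylinder v)]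

lemma levelMeasure_wordCylinder (a : Fin N) {c : ∀ m, (Fin m → Fin N) → ℝ≥0}
    (hc : ∀ m w, c m w = ∑ i, c (m + 1) (Fin.snoc w i)) {m n : ℕ} (hmn : m ≤ n)
    (v : Fin m → Fin N) : levelMeasure a c n (wordCylinder v) = c m v := by
  induction n, hmn using Nat.le_induction with
  | base =>
    rw [levelMeasure_apply, Finset.sum_eq_single v]
    · rw [Set.indicator_of_mem ((extendWord_mem_wordCylinder_iff a v v).2 rfl)]
      simp
    · intro w _ hw
      rw [Set.indicator_of_notMem (fun h => hw ((extendWord_mem_wordCylinder_iff a w v).1 h)),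
        mul_zero]
    · simp
  | succ n hmn ih =>
    rw [← ih, levelMeasure_apply, levelMeasure_apply,
      ← (Fin.snocEquiv fun _ : Fin (n + 1) => Fin N).sum_comp, Fintype.sum_prod_type_right]
    refine Finset.sum_congr rfl fun w _ => ?_
    rw [hc n w, ENNReal.ofNNReal_finsetSum, Finset.sum_mul]
    refine Finset.sum_congr rfl fun i _ => ?_
    congr 1
    have h := extendWord_snoc_mem_wordCylinder_iff a hmn w i v
    by_cases hw : extendWord a w ∈ wordCylinder v
    · exact (Set.indicator_of_mem (h.2 hw) 1).trans
        (Set.indicator_of_mem hw (1 : (ℕ → Fin N) → ℝ≥0∞)).symm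
    · exact (Set.indicator_of_notMem (mt h.1 hw) _).trans (Set.indicator_of_notMem hw _).symm

/-- Consistent weights on words are the values of a measure on cylinders: a limit point of the
measures `levelMeasure` in the compact space of finite measures of given mass. -/
theorem exists_measure_wordCylinder (a : Fin N) {c : ∀ m, (Fin m → Fin N) → ℝ≥0}
    (hc : ∀ m w, c m w = ∑ i, c (m + 1) (Fin.snoc w i)) :
    ∃ ν : Measure (ℕ → Fin N), IsFiniteMeasure ν ∧
      ∀ (m : ℕ) (w : Fin m → Fin N), ν (wordCylinder w) = c m w := by
  have hfin : ∀ n, IsFiniteMeasure (levelMeasure a c n) := fun n => ⟨by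
    rw [← wordCylinder_zero (fun k : Fin 0 => k.elim0),
      levelMeasure_wordCylinder a hc (Nat.zero_le n)]
    exact ENNReal.coe_lt_top⟩
  let μ : ℕ → FiniteMeasure (ℕ → Fin N) := fun n => ⟨levelMeasure a c n, hfin n⟩
  have hmass : ∀ n, (μ n).mass = c 0 (fun k => k.elim0) := fun n => by
    rw [← ENNReal.coe_inj, FiniteMeasure.ennreal_mass,
      ← levelMeasure_wordCylinder a hc (Nat.zero_le n), wordCylinder_zero]
    rfl
  obtain ⟨ν, -, hν⟩ := (isCompact_setOfPred_finiteMeasure_eq_of_compactSpace (ℕ → Fin N)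
    (c 0 fun k => k.elim0)).ultrafilter_le_nhds ((hyperfilter ℕ).map μ)
    (le_principal_iff.2 (Filter.mem_map.2 (Filter.univ_mem' hmass)))
  refine ⟨ν, inferInstance, fun m w => ?_⟩
  have h1 := FiniteMeasure.tendsto_iff_forall_integral_tendsto.1 (show Tendsto μ _ _ from hν)
    (BoundedContinuousFunction.indicator (wordCylinder w) (isClopen_wordCylinder w))
  have e : ∀ ρ : Measure (ℕ → Fin N), ∫ ω, BoundedContinuousFunction.indicator (wordCylinder w)
      (isClopen_wordCylinder w) ω ∂ρ = ρ.real (wordCylinder w) := fun ρ =>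
    integral_indicator_one (measurableSet_wordCylinder w)
  simp only [e] at h1
  have h2 : ∀ᶠ n in (hyperfilter ℕ : Filter ℕ), (μ n : Measure (ℕ → Fin N)).real (wordCylinder w) =
      c m w :=
    ((eventually_ge_atTop m).filter_mono (Nat.hyperfilter_le_atTop)).mono fun n hn => by
      rw [measureReal_def]
      exact congrArg ENNReal.toReal (levelMeasure_wordCylinder a hc hn w)
  have h3 := tendsto_nhds_unique (tendsto_const_nhds.congr' (h2.mono fun _ h => h.symm)) h1
  rw [← ENNReal.toReal_eq_toReal_iff' (measure_ne_top _ _) ENNReal.coe_ne_top]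
  exact h3.symm

end Cylinders

namespace SelfSimilarStructure

namespace IsHarmonicStructure

variable {K : Type*} [TopologicalSpace K] {N : ℕ} {L : SelfSimilarStructure K N}
  [Fintype L.V0] {D : Matrix L.V0 L.V0 ℝ} {r : Fin N → ℝ}

variable (L D r) in
/-- Twice the mutual energy of `f` and `g` on the cell of the word `w`. -/
noncomputable def cellEnergy (f g : K → ℝ) {m : ℕ} (w : Fin m → Fin N) : ℝ :=
  2 * ((∏ k, r (w k))⁻¹ *
    L.energy D r (f ∘ L.ψword (List.ofFn w)) (g ∘ L.ψword (List.ofFn w)))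

lemma cellEnergy_self_nonneg (hD : L.IsHarmonicStructure D r) {f : K → ℝ} (hf : f ∈ L.domain D r)
    {m : ℕ} (w : Fin m → Fin N) : 0 ≤ cellEnergy L D r f f w :=
  mul_nonneg zero_le_two (mul_nonneg (inv_nonneg.2 (Finset.prod_nonneg fun _ _ => (hD.r_pos _).le))
    (hD.energy_self_nonneg (hD.comp_ψword_mem_domain hf _)))

lemma cellEnergy_self_eq_sum (hD : L.IsHarmonicStructure D r) {f : K → ℝ} (hf : f ∈ L.domain D r)
    {m : ℕ} (w : Fin m → Fin N) : cellEnergy L D r f f w =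
      ∑ i, cellEnergy L D r f f (Fin.snoc w i : Fin (m + 1) → Fin N) := by
  have h := hD.comp_ψword_mem_domain hf (List.ofFn w)
  rw [cellEnergy, hD.energy_eq_sum h h, Finset.mul_sum, Finset.mul_sum]
  refine Finset.sum_congr rfl fun i _ => ?_
  have e : L.ψword (List.ofFn (Fin.snoc w i : Fin (m + 1) → Fin N)) =
      L.ψword (List.ofFn w) ∘ L.ψ i := by
    rw [List.ofFn_succ']
    simp only [Fin.snoc_castSucc, Fin.snoc_last, List.concat_eq_append, ψword_append]
    rfl
  rw [cellEnergy, e, Fin.prod_univ_castSucc]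
  simp only [Fin.snoc_castSucc, Fin.snoc_last, mul_inv, Function.comp_assoc, mul_assoc]

/-- The measure `energyMeasure` takes its defining branch for every function of finite energy. -/
lemma isEnergyMeasure_energyMeasure [Nonempty K] (hD : L.IsHarmonicStructure D r) {f : K → ℝ}
    (hf : f ∈ L.domain D r) : L.IsEnergyMeasure D r f (L.energyMeasure D r f) := by
  obtain ⟨ω, -⟩ := L.π_surjective (Classical.arbitrary K)
  obtain ⟨ν, h1, h2⟩ := exists_measure_wordCylinder (ω 0)
    (c := fun m w => (cellEnergy L D r f f w).toNNReal) (fun m w => by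
      rw [hD.cellEnergy_self_eq_sum hf w, Real.toNNReal_sum_of_nonneg]
      exact fun i _ => hD.cellEnergy_self_nonneg hf _)
  have h : ∃ ν, L.IsEnergyMeasure D r f ν := ⟨ν, h1, fun m w => h2 m w⟩
  rw [energyMeasure, dif_pos h]
  exact h.choose_spec

end IsHarmonicStructure

end SelfSimilarStructure

/-! ### The area of a matrix of densities -/

section GramIntegral

variable {Ω : Type*} [MeasurableSpace Ω] {μ : Measure Ω} {a b c : Ω → ℝ}

lemma gramArea_le_add {a b c : ℝ} (ha : 0 ≤ a) (hb : 0 ≤ b) : gramArea a b c ≤ a + b :=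
  Real.sqrt_le_iff.2 ⟨add_nonneg ha hb, by nlinarith [sq_nonneg c, mul_nonneg ha hb]⟩

lemma integrable_gramArea (ha : Integrable a μ) (hb : Integrable b μ) (hc : Integrable c μ)
    (ha0 : 0 ≤ᵐ[μ] a) (hb0 : 0 ≤ᵐ[μ] b) : Integrable (fun ω => gramArea (a ω) (b ω) (c ω)) μ := by
  refine (ha.add hb).mono' ?_ ?_
  · exact Real.continuous_sqrt.comp_aestronglyMeasurable
      ((ha.1.mul hb.1).sub (hc.1.pow 2))
  · filter_upwards [ha0, hb0] with ω h1 h2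
    rw [Real.norm_of_nonneg (gramArea_nonneg _ _ _)]
    exact gramArea_le_add h1 h2

/-- Jensen's inequality for the concave function `gramArea` on positive semidefinite matrices. -/
lemma integral_gramArea_le (ha : Integrable a μ) (hb : Integrable b μ) (hc : Integrable c μ)
    (ha0 : 0 ≤ᵐ[μ] a) (hb0 : 0 ≤ᵐ[μ] b) (h : ∀ᵐ ω ∂μ, c ω ^ 2 ≤ a ω * b ω)
    (h' : (∫ ω, c ω ∂μ) ^ 2 ≤ (∫ ω, a ω ∂μ) * ∫ ω, b ω ∂μ) :
    ∫ ω, gramArea (a ω) (b ω) (c ω) ∂μ ≤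
      gramArea (∫ ω, a ω ∂μ) (∫ ω, b ω ∂μ) (∫ ω, c ω ∂μ) := by
  set A := ∫ ω, a ω ∂μ
  set B := ∫ ω, b ω ∂μ
  set C := ∫ ω, c ω ∂μ
  have hA : 0 ≤ A := integral_nonneg_of_ae ha0
  have hB : 0 ≤ B := integral_nonneg_of_ae hb0
  -- The inequality is proved for the positive definite matrix `(A + ε, B + ε, C)`.
  have key : ∀ ε : ℝ, 0 < ε →
      ∫ ω, gramArea (a ω) (b ω) (c ω) ∂μ ≤ gramArea (A + ε) (B + ε) C := by
    intro ε hε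
    have hdet : 0 < (A + ε) * (B + ε) - C ^ 2 := by nlinarith [mul_nonneg hA hB]
    have hG : 0 < gramArea (A + ε) (B + ε) C := Real.sqrt_pos.2 hdet
    have hG2 : gramArea (A + ε) (B + ε) C ^ 2 = (A + ε) * (B + ε) - C ^ 2 := Real.sq_sqrt hdet.le
    have h1 : ∫ ω, 2 * (gramArea (a ω) (b ω) (c ω) * gramArea (A + ε) (B + ε) C) ∂μ ≤
        ∫ ω, (a ω * (B + ε) + (A + ε) * b ω - 2 * c ω * C) ∂μ := by
      refine integral_mono_ae (((integrable_gramArea ha hb hc ha0 hb0).mul_const _).const_mul 2)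
        (((ha.mul_const _).add (hb.const_mul _)).sub ((hc.const_mul 2).mul_const C)) ?_
      filter_upwards [ha0, hb0, h] with ω h1 h2 h3
      exact two_mul_gramArea_mul_gramArea_le h1 h2 (by positivity) (by positivity) h3
        (by linarith)
    rw [integral_const_mul, integral_mul_const, integral_sub, integral_add, integral_mul_const,
      integral_const_mul, integral_mul_const, integral_const_mul] at h1
    · refine le_of_mul_le_mul_right ?_ hG
      nlinarith
    · exact ha.mul_const _
    · exact hb.const_mul _
    · exact (ha.mul_const _).add (hb.const_mul _)
    · exact (hc.const_mul 2).mul_const C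
  have hcont : Tendsto (fun ε : ℝ => gramArea (A + ε) (B + ε) C) (𝓝[>] 0)
      (𝓝 (gramArea A B C)) := by
    have : Continuous fun ε : ℝ => gramArea (A + ε) (B + ε) C := by
      unfold gramArea
      fun_prop
    have h0 := (this.tendsto 0).mono_left (nhdsWithin_le_nhds (s := Set.Ioi 0))
    simpa using h0
  exact ge_of_tendsto hcont (eventually_mem_nhdsWithin.mono fun ε hε => key ε hε)

end GramIntegral

/-! ### Mutual energy measures and their densities -/

namespace SelfSimilarStructure

namespace IsHarmonicStructure

variable {K : Type*} [TopologicalSpace K] {N : ℕ} {L : SelfSimilarStructure K N}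
  [Fintype L.V0] {D : Matrix L.V0 L.V0 ℝ} {r : Fin N → ℝ}

lemma cellEnergy_add_smul_self (hD : L.IsHarmonicStructure D r) {f g : K → ℝ}
    (hf : f ∈ L.domain D r) (hg : g ∈ L.domain D r) (t : ℝ) {m : ℕ} (w : Fin m → Fin N) :
    cellEnergy L D r (f + t • g) (f + t • g) w = cellEnergy L D r f f w +
      2 * t * cellEnergy L D r f g w + t ^ 2 * cellEnergy L D r g g w := by
  have h := hD.energy_add_smul_self (hD.comp_ψword_mem_domain hf (List.ofFn w))
    (hD.comp_ψword_mem_domain hg (List.ofFn w)) t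
  simp only [cellEnergy, Pi.add_comp, Pi.smul_comp, h]
  ring

lemma cellEnergy_add_left (hD : L.IsHarmonicStructure D r) {f g h : K → ℝ}
    (hf : f ∈ L.domain D r) (hg : g ∈ L.domain D r) (hh : h ∈ L.domain D r) {m : ℕ}
    (w : Fin m → Fin N) : cellEnergy L D r (f + g) h w =
      cellEnergy L D r f h w + cellEnergy L D r g h w := by
  simp only [cellEnergy, Pi.add_comp, hD.energy_add_left (hD.comp_ψword_mem_domain hf _)
    (hD.comp_ψword_mem_domain hg _) (hD.comp_ψword_mem_domain hh _)]
  ring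

lemma cellEnergy_comm (hD : L.IsHarmonicStructure D r) (f g : K → ℝ) {m : ℕ} (w : Fin m → Fin N) :
    cellEnergy L D r f g w = cellEnergy L D r g f w := by
  rw [cellEnergy, hD.energy_comm, cellEnergy]

lemma gramArea_cellEnergy (hD : L.IsHarmonicStructure D r) (f g : K → ℝ) {m : ℕ}
    (w : Fin m → Fin N) :
    gramArea (cellEnergy L D r f f w) (cellEnergy L D r g g w) (cellEnergy L D r f g w) =
      2 * ((∏ k, r (w k))⁻¹ *
        energyArea L D r (f ∘ L.ψword (List.ofFn w)) (g ∘ L.ψword (List.ofFn w))) := by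
  rw [cellEnergy, cellEnergy, cellEnergy, gramArea_smul zero_le_two,
    gramArea_smul (inv_nonneg.2 (Finset.prod_nonneg fun _ _ => (hD.r_pos _).le)), energyArea]

section Measures

variable {μ : Measure (ℕ → Fin N)}

variable (L D r) in
/-- The density of the mutual energy measure of `f` and `g` with respect to `μ`. -/
noncomputable def energyDensity (μ : Measure (ℕ → Fin N)) (f g : K → ℝ) : (ℕ → Fin N) → ℝ :=
  (L.mutualEnergyMeasure D r f g).rnDeriv μ

lemma measurable_energyDensity (f g : K → ℝ) : Measurable (energyDensity L D r μ f g) :=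
  SignedMeasure.measurable_rnDeriv _ _

lemma integrable_energyDensity (f g : K → ℝ) : Integrable (energyDensity L D r μ f g) μ :=
  SignedMeasure.integrable_rnDeriv _ _

variable [Nonempty K]

lemma toSignedMeasure_energyMeasure_wordCylinder (hD : L.IsHarmonicStructure D r) {f : K → ℝ}
    (hf : f ∈ L.domain D r) {m : ℕ} (w : Fin m → Fin N) :
    (L.energyMeasure D r f).toSignedMeasure (wordCylinder w) = cellEnergy L D r f f w := by
  rw [Measure.toSignedMeasure_apply_measurable (measurableSet_wordCylinder w), measureReal_def,
    wordCylinder, (hD.isEnergyMeasure_energyMeasure hf).2 m w]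
  exact ENNReal.toReal_ofReal (hD.cellEnergy_self_nonneg hf w)

lemma mutualEnergyMeasure_wordCylinder (hD : L.IsHarmonicStructure D r) {f g : K → ℝ}
    (hf : f ∈ L.domain D r) (hg : g ∈ L.domain D r) {m : ℕ} (w : Fin m → Fin N) :
    L.mutualEnergyMeasure D r f g (wordCylinder w) = cellEnergy L D r f g w := by
  have h1 := hD.cellEnergy_add_smul_self hf hg 1 w
  have h2 := hD.cellEnergy_add_smul_self hf hg (-1) w
  rw [one_smul] at h1
  rw [neg_one_smul, ← sub_eq_add_neg] at h2
  rw [mutualEnergyMeasure, smul_apply, sub_apply,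
    hD.toSignedMeasure_energyMeasure_wordCylinder (hD.add_mem_domain hf hg),
    hD.toSignedMeasure_energyMeasure_wordCylinder (hD.sub_mem_domain hf hg), h1, h2, smul_eq_mul]
  ring

lemma mutualEnergyMeasure_comm (hD : L.IsHarmonicStructure D r) {f g : K → ℝ}
    (hf : f ∈ L.domain D r) (hg : g ∈ L.domain D r) :
    L.mutualEnergyMeasure D r f g = L.mutualEnergyMeasure D r g f :=
  signedMeasure_ext_wordCylinder fun m w => by
    rw [hD.mutualEnergyMeasure_wordCylinder hf hg, hD.mutualEnergyMeasure_wordCylinder hg hf,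
      hD.cellEnergy_comm]

lemma mutualEnergyMeasure_self (hD : L.IsHarmonicStructure D r) {f : K → ℝ}
    (hf : f ∈ L.domain D r) :
    L.mutualEnergyMeasure D r f f = (L.energyMeasure D r f).toSignedMeasure :=
  signedMeasure_ext_wordCylinder fun m w => by
    rw [hD.mutualEnergyMeasure_wordCylinder hf hf,
      hD.toSignedMeasure_energyMeasure_wordCylinder hf]

lemma mutualEnergyMeasure_add_left (hD : L.IsHarmonicStructure D r) {f g h : K → ℝ}
    (hf : f ∈ L.domain D r) (hg : g ∈ L.domain D r) (hh : h ∈ L.domain D r) :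
    L.mutualEnergyMeasure D r (f + g) h =
      L.mutualEnergyMeasure D r f h + L.mutualEnergyMeasure D r g h :=
  signedMeasure_ext_wordCylinder fun m w => by
    rw [add_apply, hD.mutualEnergyMeasure_wordCylinder (hD.add_mem_domain hf hg) hh,
      hD.mutualEnergyMeasure_wordCylinder hf hh, hD.mutualEnergyMeasure_wordCylinder hg hh,
      hD.cellEnergy_add_left hf hg hh]

lemma toSignedMeasure_energyMeasure_add_smul (hD : L.IsHarmonicStructure D r) {f g : K → ℝ}
    (hf : f ∈ L.domain D r) (hg : g ∈ L.domain D r) (t : ℝ) :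
    (L.energyMeasure D r (f + t • g)).toSignedMeasure = L.mutualEnergyMeasure D r f f +
      (2 * t) • L.mutualEnergyMeasure D r f g + t ^ 2 • L.mutualEnergyMeasure D r g g :=
  signedMeasure_ext_wordCylinder fun m w => by
    rw [add_apply, add_apply, smul_apply,
      smul_apply, hD.mutualEnergyMeasure_wordCylinder hf hf,
      hD.mutualEnergyMeasure_wordCylinder hf hg, hD.mutualEnergyMeasure_wordCylinder hg hg,
      hD.toSignedMeasure_energyMeasure_wordCylinder (hD.add_smul_mem_domain hf hg t),
      hD.cellEnergy_add_smul_self hf hg, smul_eq_mul, smul_eq_mul]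

/-- The quadratic polynomial is the mass of the measure `λ_⟨f + t g⟩`. -/
lemma mutualEnergyMeasure_quadratic_nonneg (hD : L.IsHarmonicStructure D r) {f g : K → ℝ}
    (hf : f ∈ L.domain D r) (hg : g ∈ L.domain D r) (t : ℝ) {A : Set (ℕ → Fin N)}
    (hA : MeasurableSet A) :
    0 ≤ L.mutualEnergyMeasure D r f f A + 2 * t * L.mutualEnergyMeasure D r f g A +
      t ^ 2 * L.mutualEnergyMeasure D r g g A := by
  have h := congrArg (fun ν : SignedMeasure _ => ν A)
    (hD.toSignedMeasure_energyMeasure_add_smul hf hg t)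
  simp only [add_apply, smul_apply, smul_eq_mul,
    Measure.toSignedMeasure_apply_measurable hA] at h
  rw [← h]
  exact measureReal_nonneg

lemma mutualEnergyMeasure_sq_le (hD : L.IsHarmonicStructure D r) {f g : K → ℝ}
    (hf : f ∈ L.domain D r) (hg : g ∈ L.domain D r) {A : Set (ℕ → Fin N)}
    (hA : MeasurableSet A) :
    L.mutualEnergyMeasure D r f g A ^ 2 ≤
      L.mutualEnergyMeasure D r f f A * L.mutualEnergyMeasure D r g g A :=
  sq_le_mul_of_forall_quadratic_nonneg fun t => hD.mutualEnergyMeasure_quadratic_nonneg hf hg t hA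

lemma mutualEnergyMeasure_absolutelyContinuous (hD : L.IsHarmonicStructure D r) {f g : K → ℝ}
    (hf : f ∈ L.domain D r) (hg : g ∈ L.domain D r) (hμ : L.energyMeasure D r f ≪ μ) :
    L.mutualEnergyMeasure D r f g ≪ᵥ μ.toENNRealVectorMeasure := by
  refine VectorMeasure.AbsolutelyContinuous.mk fun A hA h => ?_
  rw [Measure.toENNRealVectorMeasure_apply_measurable hA] at h
  have h1 := hD.mutualEnergyMeasure_sq_le hf hg hA
  rw [hD.mutualEnergyMeasure_self hf, Measure.toSignedMeasure_apply_measurable hA,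
    measureReal_def, hμ h, ENNReal.toReal_zero, zero_mul] at h1
  exact pow_eq_zero_iff two_ne_zero |>.1 (le_antisymm h1 (sq_nonneg _))

lemma energyMeasure_add_absolutelyContinuous (hD : L.IsHarmonicStructure D r) {f g : K → ℝ}
    (hf : f ∈ L.domain D r) (hg : g ∈ L.domain D r) (hμf : L.energyMeasure D r f ≪ μ)
    (hμg : L.energyMeasure D r g ≪ μ) : L.energyMeasure D r (f + g) ≪ μ := by
  refine Measure.AbsolutelyContinuous.mk fun A hA h => ?_
  have h1 := hD.toSignedMeasure_energyMeasure_add_smul hf hg 1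
  rw [one_smul] at h1
  have h2 := congrArg (fun ν : SignedMeasure _ => ν A) h1
  have h' : μ.toENNRealVectorMeasure A = 0 := by
    rwa [Measure.toENNRealVectorMeasure_apply_measurable hA]
  simp only [add_apply, smul_apply, smul_eq_mul,
    Measure.toSignedMeasure_apply_measurable hA,
    hD.mutualEnergyMeasure_absolutelyContinuous hf hf hμf h',
    hD.mutualEnergyMeasure_absolutelyContinuous hf hg hμf h',
    hD.mutualEnergyMeasure_absolutelyContinuous hg hg hμg h', mul_zero, add_zero] at h2
  exact (measureReal_eq_zero_iff).1 h2

lemma energyDensity_comm (hD : L.IsHarmonicStructure D r) {f g : K → ℝ}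
    (hf : f ∈ L.domain D r) (hg : g ∈ L.domain D r) :
    energyDensity L D r μ f g = energyDensity L D r μ g f := by
  rw [energyDensity, hD.mutualEnergyMeasure_comm hf hg, energyDensity]

variable [IsFiniteMeasure μ]

lemma setIntegral_energyDensity (hD : L.IsHarmonicStructure D r) {f g : K → ℝ}
    (hf : f ∈ L.domain D r) (hg : g ∈ L.domain D r) (hμ : L.energyMeasure D r f ≪ μ)
    {A : Set (ℕ → Fin N)} (hA : MeasurableSet A) :
    ∫ ω in A, energyDensity L D r μ f g ω ∂μ = L.mutualEnergyMeasure D r f g A := by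
  rw [← withDensityᵥ_apply (integrable_energyDensity f g) hA, energyDensity,
    SignedMeasure.withDensityᵥ_rnDeriv_eq _ _
      (hD.mutualEnergyMeasure_absolutelyContinuous hf hg hμ)]

lemma energyDensity_add_left (hD : L.IsHarmonicStructure D r) {f g h : K → ℝ}
    (hf : f ∈ L.domain D r) (hg : g ∈ L.domain D r) (hh : h ∈ L.domain D r) :
    energyDensity L D r μ (f + g) h =ᵐ[μ]
      energyDensity L D r μ f h + energyDensity L D r μ g h := by
  rw [energyDensity, hD.mutualEnergyMeasure_add_left hf hg hh]
  exact SignedMeasure.rnDeriv_add _ _ _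

lemma energyDensity_quadratic_nonneg (hD : L.IsHarmonicStructure D r) {f g : K → ℝ}
    (hf : f ∈ L.domain D r) (hg : g ∈ L.domain D r) (hμf : L.energyMeasure D r f ≪ μ)
    (hμg : L.energyMeasure D r g ≪ μ) (t : ℝ) :
    ∀ᵐ ω ∂μ, 0 ≤ energyDensity L D r μ f f ω + 2 * t * energyDensity L D r μ f g ω +
      t ^ 2 * energyDensity L D r μ g g ω := by
  have i1 := integrable_energyDensity (L := L) (D := D) (r := r) (μ := μ) f f
  have i2 := (integrable_energyDensity (L := L) (D := D) (r := r) (μ := μ) f g).const_mul (2 * t)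
  have i3 := (integrable_energyDensity (L := L) (D := D) (r := r) (μ := μ) g g).const_mul (t ^ 2)
  refine ae_nonneg_of_forall_setIntegral_nonneg ((i1.add i2).add i3) fun A hA _ => ?_
  have i4 : Integrable (fun ω => energyDensity L D r μ f f ω +
      2 * t * energyDensity L D r μ f g ω) μ := i1.add i2
  rw [integral_add i4.integrableOn i3.integrableOn,
    integral_add i1.integrableOn i2.integrableOn, integral_const_mul, integral_const_mul,
    hD.setIntegral_energyDensity hf hf hμf hA, hD.setIntegral_energyDensity hf hg hμf hA,
    hD.setIntegral_energyDensity hg hg hμg hA]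
  exact hD.mutualEnergyMeasure_quadratic_nonneg hf hg t hA

lemma energyDensity_sq_le (hD : L.IsHarmonicStructure D r) {f g : K → ℝ}
    (hf : f ∈ L.domain D r) (hg : g ∈ L.domain D r) (hμf : L.energyMeasure D r f ≪ μ)
    (hμg : L.energyMeasure D r g ≪ μ) :
    ∀ᵐ ω ∂μ, energyDensity L D r μ f g ω ^ 2 ≤
      energyDensity L D r μ f f ω * energyDensity L D r μ g g ω := by
  -- The null set depends on `t`, so rational `t` are used first.
  have h := ae_all_iff.2 fun q : ℚ => hD.energyDensity_quadratic_nonneg hf hg hμf hμg (q : ℝ)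
  filter_upwards [h] with ω hω
  refine sq_le_mul_of_forall_quadratic_nonneg fun t => ?_
  refine Rat.denseRange_cast.induction_on t (isClosed_le continuous_const (by fun_prop)) hω

lemma energyDensity_self_nonneg (hD : L.IsHarmonicStructure D r) {f : K → ℝ}
    (hf : f ∈ L.domain D r) (hμf : L.energyMeasure D r f ≪ μ) :
    0 ≤ᵐ[μ] energyDensity L D r μ f f := by
  filter_upwards [hD.energyDensity_quadratic_nonneg hf hf hμf hμf 0] with ω h
  simpa using h

/-- The matrix of densities of two functions of finite energy is degenerate almost everywhere: the
integral of its area is at most the total area of the cells, for every level. -/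
lemma energyDensity_mul_self_eq_sq [CompactSpace K] [T2Space K] [ConnectedSpace K]
    (hD : L.IsHarmonicStructure D r) (hpcf : L.postCritical.Finite)
    (hfix : ∀ p ∈ L.V0, ∃ i, L.ψ i p = p)
    (hconn : ∀ p ∈ L.V0, IsPreconnected ({p}ᶜ : Set K)) (hV : L.V0.Nonempty) {f g : K → ℝ}
    (hf : f ∈ L.domain D r) (hg : g ∈ L.domain D r) (hμf : L.energyMeasure D r f ≪ μ)
    (hμg : L.energyMeasure D r g ≪ μ) :
    ∀ᵐ ω ∂μ, energyDensity L D r μ f f ω * energyDensity L D r μ g g ω =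
      energyDensity L D r μ f g ω ^ 2 := by
  have i1 := integrable_energyDensity (L := L) (D := D) (r := r) (μ := μ) f f
  have i2 := integrable_energyDensity (L := L) (D := D) (r := r) (μ := μ) g g
  have i3 := integrable_energyDensity (L := L) (D := D) (r := r) (μ := μ) f g
  have p1 := hD.energyDensity_self_nonneg hf hμf
  have p2 := hD.energyDensity_self_nonneg hg hμg
  have p3 := hD.energyDensity_sq_le hf hg hμf hμg
  set F : (ℕ → Fin N) → ℝ := fun ω => gramArea (energyDensity L D r μ f f ω)
    (energyDensity L D r μ g g ω) (energyDensity L D r μ f g ω) with hF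
  have hFi : Integrable F μ := integrable_gramArea i1 i2 i3 p1 p2
  have hF0 : 0 ≤ F := fun ω => gramArea_nonneg _ _ _
  have hcell : ∀ {m : ℕ} (w : Fin m → Fin N), ∫ ω in wordCylinder w, F ω ∂μ ≤
      2 * ((∏ k, r (w k))⁻¹ *
        energyArea L D r (f ∘ L.ψword (List.ofFn w)) (g ∘ L.ψword (List.ofFn w))) := by
    intro m w
    have hA := measurableSet_wordCylinder w
    have e1 := hD.setIntegral_energyDensity hf hf hμf hA
    have e2 := hD.setIntegral_energyDensity hg hg hμg hA
    have e3 := hD.setIntegral_energyDensity hf hg hμf hA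
    have h := integral_gramArea_le i1.integrableOn i2.integrableOn i3.integrableOn
      (ae_restrict_of_ae p1) (ae_restrict_of_ae p2) (ae_restrict_of_ae p3)
      (by rw [e1, e2, e3]; exact hD.mutualEnergyMeasure_sq_le hf hg hA)
    rwa [e1, e2, e3, hD.mutualEnergyMeasure_wordCylinder hf hf,
      hD.mutualEnergyMeasure_wordCylinder hg hg, hD.mutualEnergyMeasure_wordCylinder hf hg,
      hD.gramArea_cellEnergy] at h
  have hint : ∫ ω, F ω ∂μ = 0 := by
    refine le_antisymm (le_of_forall_pos_le_add fun δ hδ => ?_) (integral_nonneg hF0)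
    obtain ⟨m, hm⟩ := hD.exists_sum_energyArea_lt hpcf hfix hconn hV hf hg (half_pos hδ)
    rw [← setIntegral_univ, ← iUnion_wordCylinder m, integral_iUnion_fintype
      measurableSet_wordCylinder (pairwise_disjoint_wordCylinder m) fun _ => hFi.integrableOn]
    refine (Finset.sum_le_sum fun w _ => hcell w).trans ?_
    rw [← Finset.mul_sum]
    linarith
  filter_upwards [(integral_eq_zero_iff_of_nonneg hF0 hFi).1 hint, p3] with ω h1 h2
  have h3 := (Real.sqrt_eq_zero (sub_nonneg.2 h2)).1 h1
  linarith

/-- Polarization of `energyDensity_mul_self_eq_sq`: the matrix of densities has rank at most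
one. -/
lemma energyDensity_mul_eq_mul [CompactSpace K] [T2Space K] [ConnectedSpace K]
    (hD : L.IsHarmonicStructure D r) (hpcf : L.postCritical.Finite)
    (hfix : ∀ p ∈ L.V0, ∃ i, L.ψ i p = p)
    (hconn : ∀ p ∈ L.V0, IsPreconnected ({p}ᶜ : Set K)) (hV : L.V0.Nonempty) {f g h : K → ℝ}
    (hf : f ∈ L.domain D r) (hg : g ∈ L.domain D r) (hh : h ∈ L.domain D r)
    (hμf : L.energyMeasure D r f ≪ μ) (hμg : L.energyMeasure D r g ≪ μ)
    (hμh : L.energyMeasure D r h ≪ μ) :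
    ∀ᵐ ω ∂μ, energyDensity L D r μ f g ω * energyDensity L D r μ h h ω =
      energyDensity L D r μ f h ω * energyDensity L D r μ g h ω := by
  have hfg := hD.add_mem_domain hf hg
  have hμfg := hD.energyMeasure_add_absolutelyContinuous hf hg hμf hμg
  filter_upwards [hD.energyDensity_mul_self_eq_sq hpcf hfix hconn hV hf hh hμf hμh,
    hD.energyDensity_mul_self_eq_sq hpcf hfix hconn hV hg hh hμg hμh,
    hD.energyDensity_mul_self_eq_sq hpcf hfix hconn hV hfg hh hμfg hμh,
    hD.energyDensity_add_left (μ := μ) hf hg hh, hD.energyDensity_add_left (μ := μ) hf hg hfg,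
    hD.energyDensity_add_left (μ := μ) hf hg hf, hD.energyDensity_add_left (μ := μ) hf hg hg]
    with ω h1 h2 h3 h4 h5 h6 h7
  simp only [Pi.add_apply] at h4 h5 h6 h7
  rw [hD.energyDensity_comm hf hfg, hD.energyDensity_comm hg hfg, h6, h7,
    hD.energyDensity_comm hg hf] at h5
  rw [h4, h5] at h3
  linarith

end Measures

end IsHarmonicStructure

end SelfSimilarStructure

namespace SelfSimilarStructure

/-- Every member of the family is dominated by the weighted sum, since its weight is positive. -/
lemma energyMeasure_absolutelyContinuous_weighted {K : Type*} [TopologicalSpace K] {N : ℕ}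
    (L : SelfSimilarStructure K N) [Fintype L.V0] (D : Matrix L.V0 L.V0 ℝ) (r : Fin N → ℝ)
    {J : Type*} {b : J → ℝ} (hb : ∀ i, 0 < b i) (f : J → K → ℝ) (i : J) :
    L.energyMeasure D r (f i) ≪ L.weightedEnergyMeasure D r b f := by
  refine Measure.AbsolutelyContinuous.mk fun A _ h => ?_
  have h1 := le_antisymm ((Measure.le_sum
    (fun i => ENNReal.ofReal (b i) • L.energyMeasure D r (f i)) i A).trans_eq h) bot_le
  rw [Measure.smul_apply, smul_eq_mul, mul_eq_zero] at h1
  exact h1.resolve_left (ENNReal.ofReal_pos.2 (hb i)).ne'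

end SelfSimilarStructure

/-! ### Factorization of a measurable family of matrices of rank at most one -/

/-- A countable family of measurable functions `Z i j` which is, almost everywhere, a positive
semidefinite matrix of rank at most one is of the form `ζ i * ζ j` with measurable `ζ`. -/
lemma exists_measurable_factorization {Ω J : Type*} [MeasurableSpace Ω] {μ : Measure Ω}
    [Countable J] {Z : J → J → Ω → ℝ} (hZ : ∀ i j, Measurable (Z i j))
    (hpos : ∀ i, 0 ≤ᵐ[μ] Z i i)
    (hsq : ∀ i j, ∀ᵐ ω ∂μ, Z i j ω ^ 2 ≤ Z i i ω * Z j j ω)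
    (hrank : ∀ i j k, ∀ᵐ ω ∂μ, Z i j ω * Z k k ω = Z i k ω * Z j k ω) :
    ∃ ζ : J → Ω → ℝ, (∀ i, Measurable (ζ i)) ∧
      ∀ i j, Z i j =ᵐ[μ] fun ω => ζ i ω * ζ j ω := by
  classical
  rcases isEmpty_or_nonempty J with hJ | hJ
  · exact ⟨fun i => (hJ.false i).elim, fun i => (hJ.false i).elim, fun i => (hJ.false i).elim⟩
  obtain ⟨e, he⟩ := exists_surjective_nat J
  -- `P n ω` selects the indices with a positive diagonal entry, and all indices if there is none.
  let P : ℕ → Ω → Prop := fun n ω =>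
    0 < Z (e n) (e n) ω ∨ ∀ k, ¬ 0 < Z (e k) (e k) ω
  have hP : ∀ ω, ∃ n, P n ω := fun ω => by
    by_cases h : ∃ n, 0 < Z (e n) (e n) ω
    · exact h.imp fun n hn => Or.inl hn
    · exact ⟨0, Or.inr (not_exists.1 h)⟩
  have hnone : MeasurableSet {ω | ∀ k, ¬ 0 < Z (e k) (e k) ω} := by
    rw [Set.ofPred_forall]
    exact MeasurableSet.iInter fun k =>
      (measurableSet_lt measurable_const (hZ (e k) (e k))).compl
  have hPm : ∀ n, MeasurableSet {ω | P n ω} := fun n =>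
    (measurableSet_lt measurable_const (hZ _ _)).union hnone
  refine ⟨fun i ω => Z i (e (Nat.find (hP ω))) ω /
    √(Z (e (Nat.find (hP ω))) (e (Nat.find (hP ω))) ω), fun i => ?_, fun i j => ?_⟩
  · exact Measurable.find (f := fun n ω => Z i (e n) ω / √(Z (e n) (e n) ω))
      (fun n => (hZ _ _).div (hZ _ _).sqrt) hPm hP
  · filter_upwards [ae_all_iff.2 fun k => hrank i j k, hsq i j, hpos i,
      ae_all_iff.2 hpos] with ω h1 h2 h3 h4
    set k := e (Nat.find (hP ω))
    rw [div_mul_div_comm, Real.mul_self_sqrt (h4 k), ← h1 k]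
    rcases Nat.find_spec (hP ω) with h | h
    · rw [mul_div_assoc, div_self (ne_of_gt h), mul_one]
    · -- All diagonal entries vanish, and the quotient by zero is zero.
      have hz : ∀ l, Z l l ω = 0 := fun l => by
        obtain ⟨n, rfl⟩ := he l
        exact le_antisymm (not_lt.1 (h n)) (h4 _)
      rw [hz i, zero_mul] at h2
      rw [hz k, div_zero]
      exact pow_eq_zero_iff two_ne_zero |>.1 (le_antisymm h2 (sq_nonneg _))

theorem proposition5
    {K : Type*} [TopologicalSpace K] [CompactSpace K] [TopologicalSpace.MetrizableSpace K]
    [ConnectedSpace K]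
    {N : ℕ} (hN : 2 ≤ N) (L : SelfSimilarStructure K N)
    -- the structure is post-critically finite
    (hpcf : L.postCritical.Finite) [Fintype L.V0]
    -- every boundary point is a fixed point of some `ψ i`, and its complement is connected
    (hV0 : ∀ p ∈ L.V0, (∃ i, L.ψ i p = p) ∧ IsConnected ({p}ᶜ : Set K))
    -- `(D, r)` is a regular harmonic structure
    (D : Matrix L.V0 L.V0 ℝ) (r : Fin N → ℝ)
    (hD : L.IsHarmonicStructure D r) (hreg : ∀ i, r i < 1)
    -- a finite or countably infinite family in the domain, with positive weights
    {J : Type*} [Countable J] (f : J → K → ℝ) (hf : ∀ i, f i ∈ L.domain D r)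
    (b : J → ℝ) (hb : ∀ i, 0 < b i)
    (hprob : IsProbabilityMeasure (L.weightedEnergyMeasure D r b f)) :
    (∀ i j, L.mutualEnergyMeasure D r (f i) (f j) ≪ᵥ
      (L.weightedEnergyMeasure D r b f).toENNRealVectorMeasure) ∧
    ∃ ζ : J → (ℕ → Fin N) → ℝ, (∀ i, Measurable (ζ i)) ∧
      ∀ i j,
        (L.mutualEnergyMeasure D r (f i) (f j)).rnDeriv (L.weightedEnergyMeasure D r b f)
          =ᵐ[L.weightedEnergyMeasure D r b f] fun ω => ζ i ω * ζ j ω := by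
  have hV := L.nonempty_V0 hN
  have hfix : ∀ p ∈ L.V0, ∃ i, L.ψ i p = p := fun p hp => (hV0 p hp).1
  have hconn : ∀ p ∈ L.V0, IsPreconnected ({p}ᶜ : Set K) := fun p hp => (hV0 p hp).2.isPreconnected
  have hμ := L.energyMeasure_absolutelyContinuous_weighted D r hb f
  refine ⟨fun i j => hD.mutualEnergyMeasure_absolutelyContinuous (hf i) (hf j) (hμ i), ?_⟩
  refine exists_measurable_factorization
    (Z := fun i j => SelfSimilarStructure.IsHarmonicStructure.energyDensity L D r
      (L.weightedEnergyMeasure D r b f) (f i) (f j))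
    (fun i j => SelfSimilarStructure.IsHarmonicStructure.measurable_energyDensity _ _)
    (fun i => hD.energyDensity_self_nonneg (hf i) (hμ i))
    (fun i j => hD.energyDensity_sq_le (hf i) (hf j) (hμ i) (hμ j))
    fun i j k => hD.energyDensity_mul_eq_mul hpcf hfix hconn hV (hf i) (hf j) (hf k) (hμ i) (hμ j)
      (hμ k)
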